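/- Let $\mu$ be a probability measure on $\mathbb{Z}$ with support $S_\mu=\{k:\mu(k)>0\}$ satisfying Hypotheses H: the group generated by $S_\mu$ is $\mathbb{Z}$ (adapted), the group generated by $S_\mu-S_\mu$ is $\mathbb{Z}$ (aperiodic), $\sum_{n\in\mathbb{Z}} r^n\mu(n)<+\infty$ for every $r>0$, and $\sum_n n\mu(n)\ge 0$. Assume moreover that $\mu$ is centered, $\sum_n n\mu(n)=0$, and put $\sigma=\big(\sum_n n^2\mu(n)\big)^{1/2}$. Let $(Y_n)_{n\ge1}$ be i.i.d. with law $\mu$, $S_0=0$, $S_n=Y_1+\dots+Y_n$, $\tau^{*-}=\inf\{n\ge1: S_n<0\}$, $\tau^+=\inf\{n\ge 1: S_n\ge 0\}$ (with $\inf\emptyset=+\infty$), and let $\mu^{*-}$, $\mu^{+}$ be the laws of $S_{\tau^{*-}}$ and $S_{\tau^+}$. For $x\in\mathbb{Z}$ and $|s|\le 1$ set $$\mathfrak{T}^{*-}(s|x)=\mathbb{E}\big[s^{\tau^{*-}}1_{\{x\}}(S_{\tau^{*-}})\big],\qquad \mathfrak{T}^{+}(s|x)=\mathbb{E}\big[s^{\tau^{+}}1_{\{x\}}(S_{\tau^{+}})\big].$$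 For $\delta>0$ let $\mathcal{O}_\delta(1)=B(1,\delta)\setminus[1,1+\delta[$, and let $\sqrt{\cdot}$ be the principal determination of the square root. A function $f$ is called analytic in the variable $\sqrt{1-s}$ on $\mathcal{O}_\delta(1)$ if there is a function $g$, analytic on the disk $B(0,\sqrt\delta)$, with $f(s)=g(\sqrt{1-s})$ for all $s\in\mathcal{O}_\delta(1)$. Then there exist an open neighborhood $\Omega$ of $\overline{B(0,1)}\setminus\{1\}$, disjoint from $[1,+\infty[$, and $\delta>0$ such that, for every $x\in\mathbb{Z}$, the functions $\mathfrak{T}^{*-}(\cdot|x)$ and $\mathfrak{T}^{+}(\cdot|x)$, restricted to $\overline{B(0,1)}\setminus\{1\}$, extend to analytic functions on $\Omega\cup\mathcal{O}_\delta(1)$ (denoted in the same way), these are analytic in the variable $\sqrt{1-s}$ on $\mathcal{O}_\delta(1)$, and for all $s\in\Omega\cup\mathcal{O}_\delta(1)$ and $x\in\mathbb{Z}$ $$\mathfrak{T}^{*-}(s|x)=\mu^{*-}(x)-\sqrt{1-s}\,\frac{\sqrt2}{\sigma}\,t^{*-}(x)+(1-s)\,\mathbf{O}^{*-}(s|x),\qquad(18)$$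 $$\mathfrak{T}^{+}(s|x)=\mu^{+}(x)-\sqrt{1-s}\,\frac{\sqrt2}{\sigma}\,t^{+}(x)+(1-s)\,\mathbf{O}^{+}(s|x),\qquad(19)$$ where $t^{*-}(x)=\mu^{*-}(]-\infty,x])$ if $x\le -1$ and $t^{*-}(x)=0$ if $x\ge0$, while $t^{+}(x)=\mu^{+}(]x,+\infty[)$ if $x\ge 0$ and $t^{+}(x)=0$ if $x\le -1$, and where the functions $\mathbf{O}^{*-}(\cdot|x)$, $\mathbf{O}^{+}(\cdot|x)$ are analytic in the variable $\sqrt{1-s}$ on $\mathcal{O}_\delta(1)$ and bounded there uniformly in $x\in\mathbb{Z}$. Furthermore, for every $K>1$ there is a constant $C>0$ such that for all $s\in\Omega\cup\mathcal{O}_\delta(1)$ and all $x\in\mathbb{Z}$ $$K^{|x|}|\mathfrak{T}^{*-}(s|x)|\le C,\quad K^{|x|}|\mathfrak{T}^{+}(s|x)|\le C,\quad K^{|x|}|\mathbf{O}^{*-}(s|x)|\le C,\quad K^{|x|}|\mathbf{O}^{+}(s|x)|\le C.\qquad(20)$$ -/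

import Mathlib

open MeasureTheory ProbabilityTheory

noncomputable section

namespace LadderWalk

/-- The support `S_μ` of a measure on `ℤ`. -/
def supp (μ : Measure ℤ) : Set ℤ := {k | μ {k} ≠ 0}

/-- The mean `∑ k μ(k)` (used under `HypothesesH`, where the series converges absolutely). -/
def mean (μ : Measure ℤ) : ℝ := ∑' k : ℤ, (k : ℝ) * μ.real {k}

/-- `σ`, the square root of the second moment `∑ k² μ(k)` (the variance when `μ` is centered). -/
def sigma (μ : Measure ℤ) : ℝ := Real.sqrt (∑' k : ℤ, (k : ℝ) ^ 2 * μ.real {k})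

/-- Hypotheses H: `μ` is adapted and aperiodic on `ℤ`, has exponential moments of every order,
and has nonnegative mean. -/
structure HypothesesH (μ : Measure ℤ) : Prop where
  adapted : AddSubgroup.closure (supp μ) = ⊤
  aperiodic : AddSubgroup.closure {k : ℤ | ∃ a ∈ supp μ, ∃ b ∈ supp μ, k = a - b} = ⊤
  exp_moments : ∀ r : ℝ, 0 < r → Summable fun k : ℤ => r ^ k * μ.real {k}
  mean_nonneg : 0 ≤ mean μ

/-- The random walk `S_0 = 0`, `S_n = Y_1 + ⋯ + Y_n`; the increment `Y_{i+1}` is `Y i`. -/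
def walk {α : Type*} (Y : ℕ → α → ℤ) (n : ℕ) (ω : α) : ℤ := ∑ i ∈ Finset.range n, Y i ω

/-- The first strict descending time `inf {n ≥ 1 | S_n < 0}`, with `inf ∅ = +∞`. -/
def tauDesc {α : Type*} (Y : ℕ → α → ℤ) (ω : α) : ℕ∞ :=
  ⨅ (n : ℕ) (_ : 1 ≤ n ∧ walk Y n ω < 0), (n : ℕ∞)

/-- The first (weak) ascending time `inf {n ≥ 1 | S_n ≥ 0}`, with `inf ∅ = +∞`. -/
def tauAsc {α : Type*} (Y : ℕ → α → ℤ) (ω : α) : ℕ∞ :=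
  ⨅ (n : ℕ) (_ : 1 ≤ n ∧ 0 ≤ walk Y n ω), (n : ℕ∞)

/-- `E[1_{τ < ∞} s^τ 1_{x}(S_τ)]` for a random time `τ`. -/
def ladderGen {α : Type*} [MeasurableSpace α] (P : Measure α) (Y : ℕ → α → ℤ)
    (τ : α → ℕ∞) (x : ℤ) (s : ℂ) : ℂ :=
  open Classical in
  ∫ ω, (if τ ω < ⊤ ∧ walk Y (τ ω).toNat ω = x then s ^ (τ ω).toNat else 0) ∂P

/-- The law of `S_τ`, i.e. `A ↦ P[τ < ∞, S_τ ∈ A]`. -/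
def ladderLaw {α : Type*} [MeasurableSpace α] (P : Measure α) (Y : ℕ → α → ℤ)
    (τ : α → ℕ∞) (A : Set ℤ) : ℝ :=
  P.real {ω | τ ω < ⊤ ∧ walk Y (τ ω).toNat ω ∈ A}

/-- The slit disk `O_δ(1) = B(1, δ) \ [1, 1 + δ[`. -/
def slitDisk (δ : ℝ) : Set ℂ :=
  Metric.ball (1 : ℂ) δ \ ((fun t : ℝ => (t : ℂ)) '' Set.Ico 1 (1 + δ))

/-- `√(1 - s)`, for the principal determination of the square root. -/
def sqrtOneSub (s : ℂ) : ℂ := (1 - s) ^ (1 / 2 : ℂ)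

/-- `f` is analytic in the variable `√(1 - s)` on the slit disk: there `f(s)` is the value at
`√(1 - s)` of a function which is analytic on the whole disk `B(0, √δ)`, hence the sum of a
convergent power series in `√(1 - s)`. -/
def AnalyticInSqrt (δ : ℝ) (f : ℂ → ℂ) : Prop :=
  ∃ g : ℂ → ℂ, AnalyticOnNhd ℂ g (Metric.ball 0 (Real.sqrt δ)) ∧
    ∀ s ∈ slitDisk δ, f s = g (sqrtOneSub s)

end LadderWalk

end

/-! A descending ladder time is the exit time of the walk from `[0, ∞)`, and an ascending one is
the exit time of the reflected walk from `[1, ∞)`. So it suffices to study the exit from `[m, ∞)`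
for `m = 0` and `m = 1`, for a walk with a centered, aperiodic law `p` having all exponential
moments (`CenteredLaw`). Write `φ` for the generating function of `p`.

*Factorization.* The exit at `x` has the generating function `s ∑_y G_s(y) p(x - y)`, where `G_s`
is the Green function of the killed walk. For `|s| < 1`, splitting the Laurent series of `log (1 -
s φ) = ∑ ℓ_k(s) z ^ k` on the unit circle and using uniqueness in the Wiener–Hopf factorization
gives `∑ G_s(y) z ^ y = exp (-∑_{k ≥ m} ℓ_k(s) z ^ k)` (`CenteredLaw.killedGreen_eq`). Hence
`G_s(y)` is a universal polynomial in the `ℓ_k(s)` times an exponential (`expCoeff`), and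
everything about it follows from the coefficients `ℓ_k` alone.

*Continuation.* Away from `s = 1`, aperiodicity makes `Re (1 - s φ)` positive on the unit circle
for `|s| ≤ 1`, so `ℓ_k` continues a little beyond the unit disk (`CenteredLaw.exists_thickening`).
Near `s = 1` put `s = 1 - ε²`. The equation `s φ(z) = 1` has two roots `Z(±ε)`, holomorphic in
`ε`, on either side of the unit circle for small `ε > 0`, because `1 - 1 / φ` has a double zero at
`1`. Moving the contour in `dℓ_k / dε` outwards across `Z(ε)` shows that it is holomorphic in `ε`
near `0`; the residue is `Z'(ε) Z(ε) ^ (-k - 1)`. Thus `ℓ_k` is a holomorphic function of `√(1 -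
s)` whose derivative at `0` is `√2 / σ` for every `k ≥ 0` (`CenteredLaw.exists_local_logCoeff`).

*Expansion.* Since all the `ℓ_k` have the same velocity `c = √2 / σ` at `ε = 0`, the exponential
is multiplied to first order by `1 - c ε z ^ m / (1 - z)`, and the derivative of the exit
generating function at `ε = 0` is `-c` times a tail of the exit law (`CenteredLaw.deriv_exitGen`).
The remainder is a second difference quotient in `ε`, controlled by the Schwarz lemma. The bounds
with weight `K ^ |x|` hold since `G_s(y)` grows at most geometrically, while `p` decays faster
than every exponential and `|x - y| = |x| + |y|` for `x ≤ 0 ≤ y`. -/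

namespace LadderWalk

open Complex Metric Set Filter Topology

/-! ### Laurent series and centered laws -/

/-- A sequence on `ℤ` that decays faster than every exponential, in both directions. -/
def RapidDecay (c : ℤ → ℂ) : Prop := ∀ r : ℝ, 0 < r → Summable fun k : ℤ => ‖c k‖ * r ^ k

/-- The sum of the Laurent series with coefficients `c`; the junk value `0` where it diverges. -/
noncomputable def laurentSum (c : ℤ → ℂ) (z : ℂ) : ℂ := ∑' k : ℤ, c k * z ^ k

lemma zpow_le_add_zpow {r R : ℝ} (hr : 0 < r) (hrR : r ≤ R) {x : ℝ} (h1 : r ≤ x) (h2 : x ≤ R)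
    (k : ℤ) : x ^ k ≤ r ^ k + R ^ k := by
  have hx : 0 < x := hr.trans_le h1
  rcases le_total 0 k with hk | hk
  · have := zpow_le_zpow_left₀ hk hx.le h2
    have h3 : 0 < r ^ k := zpow_pos hr k
    linarith
  · obtain ⟨n, rfl⟩ : ∃ n : ℕ, k = -n := ⟨k.natAbs, by omega⟩
    have h3 : 0 < R ^ (-(n : ℤ)) := zpow_pos (hr.trans_le hrR) _
    have : x ^ (-(n : ℤ)) ≤ r ^ (-(n : ℤ)) := by
      rw [zpow_neg, zpow_neg, zpow_natCast, zpow_natCast]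
      gcongr
    linarith

lemma pow_natAbs_le_zpow {r : ℝ} (hr : 0 < r) (k : ℤ) : r ^ k.natAbs ≤ r ^ k + r⁻¹ ^ k := by
  have h1 : 0 < r ^ k := zpow_pos hr k
  have h2 : 0 < r⁻¹ ^ k := zpow_pos (inv_pos.2 hr) k
  rcases Int.natAbs_eq k with h | h
  · have : r ^ k = r ^ k.natAbs := by conv_lhs => rw [h, zpow_natCast]
    linarith
  · have : r⁻¹ ^ k = r ^ k.natAbs := by
      conv_lhs => rw [h, zpow_neg, zpow_natCast, inv_pow, inv_inv]
    linarith

lemma natAbs_le_two_pow (k : ℤ) : (k.natAbs : ℝ) ≤ 2 ^ k.natAbs := by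
  exact_mod_cast (Nat.lt_two_pow_self).le

lemma abs_intCast_eq (k : ℤ) : |(k : ℝ)| = k.natAbs := by
  rw [Nat.cast_natAbs, Int.cast_abs]

lemma RapidDecay.summable_norm {c : ℤ → ℂ} (hc : RapidDecay c) {z : ℂ} (hz : z ≠ 0) :
    Summable fun k : ℤ => ‖c k * z ^ k‖ := by
  simpa [norm_mul, norm_zpow] using hc ‖z‖ (norm_pos_iff.2 hz)

lemma RapidDecay.shift_deriv {c : ℤ → ℂ} (hc : RapidDecay c) :
    RapidDecay fun k : ℤ => ((k : ℂ) + 1) * c (k + 1) := by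
  have key : RapidDecay fun k : ℤ => (k : ℂ) * c k := by
    intro r hr
    have h1 := hc (r * 2) (by positivity)
    have h2 := hc (r / 2) (by positivity)
    refine Summable.of_nonneg_of_le (fun k => by positivity) (fun k => ?_) (h1.add h2)
    have hk : ‖(k : ℂ)‖ ≤ (2 : ℝ) ^ k + (1 / 2 : ℝ) ^ k := by
      rw [Complex.norm_intCast, abs_intCast_eq, one_div]
      exact (natAbs_le_two_pow k).trans (pow_natAbs_le_zpow two_pos k)
    calc ‖(k : ℂ) * c k‖ * r ^ k = ‖(k : ℂ)‖ * (‖c k‖ * r ^ k) := by rw [norm_mul]; ring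
      _ ≤ ((2 : ℝ) ^ k + (1 / 2 : ℝ) ^ k) * (‖c k‖ * r ^ k) := by gcongr
      _ = _ := by rw [mul_zpow, div_eq_mul_one_div r 2, mul_zpow]; ring
  intro r hr
  have := ((key r hr).comp_injective (add_left_injective (1 : ℤ))).mul_right r⁻¹
  refine this.congr fun k => ?_
  simp only [Function.comp, Int.cast_add, Int.cast_one]
  rw [zpow_add₀ hr.ne', zpow_one]
  field_simp

lemma RapidDecay.hasDerivAt {c : ℤ → ℂ} (hc : RapidDecay c) {z : ℂ} (hz : z ≠ 0) :
    HasDerivAt (laurentSum c) (laurentSum (fun k : ℤ => ((k : ℂ) + 1) * c (k + 1)) z) z := by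
  have hz0 : 0 < ‖z‖ := norm_pos_iff.2 hz
  set U : Set ℂ := ball z (‖z‖ / 2)
  have hU : ∀ w ∈ U, ‖z‖ / 2 ≤ ‖w‖ ∧ ‖w‖ ≤ 2 * ‖z‖ := by
    intro w hw
    have h1 : ‖w - z‖ < ‖z‖ / 2 := by simpa [U, dist_eq_norm] using hw
    have h2 := norm_sub_norm_le z w
    have h3 := norm_sub_norm_le w z
    rw [norm_sub_rev] at h2
    constructor <;> linarith
  have hU0 : ∀ w ∈ U, w ≠ 0 := fun w hw h => by
    have := (hU w hw).1
    rw [h, norm_zero] at this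
    linarith
  have hu : Summable fun k : ℤ => ‖c k‖ * (‖z‖ / 2) ^ k + ‖c k‖ * (2 * ‖z‖) ^ k :=
    (hc _ (by positivity)).add (hc _ (by positivity))
  have hd : ∀ k : ℤ, DifferentiableOn ℂ (fun w : ℂ => c k * w ^ k) U := fun k w hw =>
    ((differentiableAt_zpow.2 (Or.inl (hU0 w hw))).const_mul _).differentiableWithinAt
  have hb : ∀ (k : ℤ) (w : ℂ), w ∈ U →
      ‖c k * w ^ k‖ ≤ ‖c k‖ * (‖z‖ / 2) ^ k + ‖c k‖ * (2 * ‖z‖) ^ k := by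
    intro k w hw
    rw [norm_mul, norm_zpow, ← mul_add]
    gcongr
    exact zpow_le_add_zpow (by positivity) (by linarith) (hU w hw).1 (hU w hw).2 k
  have hzU : z ∈ U := mem_ball_self (by positivity)
  have h1 : DifferentiableAt ℂ (laurentSum c) z :=
    (differentiableOn_tsum_of_summable_norm hu hd isOpen_ball hb).differentiableAt
      (isOpen_ball.mem_nhds hzU)
  have h2 := hasSum_deriv_of_summable_norm hu hd isOpen_ball hb hzU
  have h3 : deriv (laurentSum c) z = laurentSum (fun k : ℤ => ((k : ℂ) + 1) * c (k + 1)) z := by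
    have h4 : HasSum (fun k : ℤ => deriv (fun w : ℂ => c k * w ^ k) z)
      (deriv (laurentSum c) z) := h2
    rw [← (Equiv.addRight (1 : ℤ)).hasSum_iff] at h4
    rw [← h4.tsum_eq, laurentSum]
    refine tsum_congr fun k => ?_
    simp only [Function.comp, Equiv.coe_addRight]
    rw [deriv_const_mul _ (differentiableAt_zpow.2 (Or.inl hz)), deriv_zpow]
    push_cast
    rw [add_sub_cancel_right]
    ring
  rw [← h3]
  exact h1.hasDerivAt

/-- A probability law on `ℤ`, given by its weights, with all exponential moments, mean zero and
no periodicity. -/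
structure CenteredLaw (p : ℤ → ℝ) : Prop where
  nonneg : ∀ k, 0 ≤ p k
  hasSum_one : HasSum p 1
  exp_moments : ∀ r : ℝ, 0 < r → Summable fun k : ℤ => r ^ k * p k
  mean_zero : ∑' k : ℤ, (k : ℝ) * p k = 0
  aperiodic : AddSubgroup.closure {k : ℤ | ∃ a b, p a ≠ 0 ∧ p b ≠ 0 ∧ k = a - b} = ⊤

/-- The generating function `∑ p(k) z ^ k` of a law on `ℤ`, for `z ≠ 0`. -/
noncomputable def genFun (p : ℤ → ℝ) : ℂ → ℂ := laurentSum fun k => (p k : ℂ)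

/-- The second moment `∑ k² p(k)`. -/
noncomputable def secondMoment (p : ℤ → ℝ) : ℝ := ∑' k : ℤ, (k : ℝ) ^ 2 * p k

namespace CenteredLaw

variable {p : ℤ → ℝ}

lemma reflect (hp : CenteredLaw p) : CenteredLaw fun k => p (-k) where
  nonneg k := hp.nonneg _
  hasSum_one := ((Equiv.neg ℤ).hasSum_iff).2 hp.hasSum_one
  exp_moments r hr := by
    have := ((Equiv.neg ℤ).summable_iff).2 (hp.exp_moments r⁻¹ (inv_pos.2 hr))
    refine this.congr fun k => ?_
    simp
  mean_zero := by
    have := (Equiv.neg ℤ).tsum_eq fun k : ℤ => (k : ℝ) * p k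
    rw [hp.mean_zero] at this
    simpa [tsum_neg] using this
  aperiodic := by
    rw [← hp.aperiodic]
    congr 1
    ext k
    constructor
    · rintro ⟨a, b, ha, hb, rfl⟩
      exact ⟨-b, -a, hb, ha, by ring⟩
    · rintro ⟨a, b, ha, hb, rfl⟩
      exact ⟨-b, -a, by simpa using hb, by simpa using ha, by ring⟩

lemma secondMoment_reflect (p : ℤ → ℝ) : secondMoment (fun k => p (-k)) = secondMoment p := by
  unfold secondMoment
  rw [← (Equiv.neg ℤ).tsum_eq fun k : ℤ => (k : ℝ) ^ 2 * p k]
  simp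

lemma rapidDecay (hp : CenteredLaw p) : RapidDecay fun k => (p k : ℂ) := fun r hr => by
  refine (hp.exp_moments r hr).congr fun k => ?_
  rw [Complex.norm_real, Real.norm_of_nonneg (hp.nonneg k), mul_comm]

lemma genFun_one (hp : CenteredLaw p) : genFun p 1 = 1 := by
  have := (Complex.hasSum_ofReal.2 hp.hasSum_one).tsum_eq
  simpa [genFun, laurentSum] using this

lemma differentiableAt_genFun (hp : CenteredLaw p) {z : ℂ} (hz : z ≠ 0) :
    DifferentiableAt ℂ (genFun p) z := (hp.rapidDecay.hasDerivAt hz).differentiableAt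

lemma summable_mul_of_le (hp : CenteredLaw p) {f : ℤ → ℝ} {r : ℝ} (hr : 0 < r)
    (hf : ∀ k, |f k| ≤ r ^ k + r⁻¹ ^ k) : Summable fun k => f k * p k := by
  refine Summable.of_norm_bounded ((hp.exp_moments r hr).add (hp.exp_moments r⁻¹ (by positivity)))
    fun k => ?_
  rw [norm_mul, Real.norm_eq_abs, Real.norm_of_nonneg (hp.nonneg k), ← add_mul]
  exact mul_le_mul_of_nonneg_right (hf k) (hp.nonneg k)

lemma summable_int_mul (hp : CenteredLaw p) : Summable fun k : ℤ => (k : ℝ) * p k := by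
  refine hp.summable_mul_of_le (r := 2) (by norm_num) fun k => ?_
  rw [abs_intCast_eq]
  exact (natAbs_le_two_pow k).trans (pow_natAbs_le_zpow two_pos k)

lemma summable_sq_mul (hp : CenteredLaw p) : Summable fun k : ℤ => (k : ℝ) ^ 2 * p k := by
  refine hp.summable_mul_of_le (r := 4) (by norm_num) fun k => ?_
  rw [abs_pow, abs_intCast_eq]
  calc (k.natAbs : ℝ) ^ 2 ≤ (2 ^ k.natAbs) ^ 2 := by gcongr; exact natAbs_le_two_pow k
    _ = 4 ^ k.natAbs := by rw [← pow_mul, mul_comm, pow_mul]; norm_num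
    _ ≤ _ := pow_natAbs_le_zpow (by norm_num) k

lemma secondMoment_pos (hp : CenteredLaw p) : 0 < secondMoment p := by
  have hnn : ∀ k : ℤ, 0 ≤ (k : ℝ) ^ 2 * p k := fun k => mul_nonneg (sq_nonneg _) (hp.nonneg k)
  by_contra hneg
  have h0 : ∑' k : ℤ, (k : ℝ) ^ 2 * p k = 0 :=
    le_antisymm (not_lt.1 hneg) (tsum_nonneg hnn)
  have h1 : ∀ k : ℤ, p k ≠ 0 → k = 0 := by
    intro k hk
    have h2 := hp.summable_sq_mul.hasSum
    rw [h0] at h2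
    have h3 := congrFun ((hasSum_zero_iff_of_nonneg hnn).1 h2) k
    simpa [hk] using h3
  have h4 : (1 : ℤ) ∈ AddSubgroup.closure {k : ℤ | ∃ a b, p a ≠ 0 ∧ p b ≠ 0 ∧ k = a - b} := by
    rw [hp.aperiodic]; trivial
  have h5 : AddSubgroup.closure {k : ℤ | ∃ a b, p a ≠ 0 ∧ p b ≠ 0 ∧ k = a - b} ≤ ⊥ := by
    rw [AddSubgroup.closure_le]
    rintro k ⟨a, b, ha, hb, rfl⟩
    simp [h1 a ha, h1 b hb]
  simpa using h5 h4

lemma norm_genFun_le_one (hp : CenteredLaw p) {z : ℂ} (hz : ‖z‖ = 1) : ‖genFun p z‖ ≤ 1 := by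
  refine tsum_of_norm_bounded hp.hasSum_one fun k => ?_
  simp [hz, abs_of_nonneg (hp.nonneg k)]

/-- Aperiodicity: the characteristic function has modulus `1` at the point `1` of the circle
only. -/
lemma norm_genFun_lt_one (hp : CenteredLaw p) {z : ℂ} (hz : ‖z‖ = 1) (hz1 : z ≠ 1) :
    ‖genFun p z‖ < 1 := by
  refine lt_of_le_of_ne (hp.norm_genFun_le_one hz) fun hone => hz1 ?_
  -- equality in the triangle inequality makes `z ^ k` constant on the support of the law, hence
  -- equal to `1` on the group generated by the differences
  have hz0 : z ≠ 0 := norm_pos_iff.1 (by rw [hz]; exact one_pos)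
  set u := genFun p z with hu
  have hS : HasSum (fun k : ℤ => (p k : ℂ) * z ^ k) u :=
    (hp.rapidDecay.summable_norm hz0).of_norm.hasSum
  have hre : HasSum (fun k : ℤ => p k * (1 - (starRingEnd ℂ u * z ^ k).re)) 0 := by
    have h1 := Complex.hasSum_re (hS.mul_left (starRingEnd ℂ u))
    have h2 := hp.hasSum_one.sub h1
    have h3 : (starRingEnd ℂ u * u).re = 1 := by
      rw [← Complex.normSq_eq_conj_mul_self, Complex.normSq_eq_norm_sq, hone]; simp
    rw [h3, sub_self] at h2
    refine (funext fun k => ?_ : (fun k : ℤ => p k * (1 - (starRingEnd ℂ u * z ^ k).re)) = _) ▸ h2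
    rw [mul_left_comm, Complex.re_ofReal_mul]
    ring
  have hle : ∀ k : ℤ, (starRingEnd ℂ u * z ^ k).re ≤ 1 := fun k => by
    refine (Complex.re_le_norm _).trans ?_
    simp [hz, hone]
  have hu1 : ∀ k : ℤ, p k ≠ 0 → z ^ k = u := by
    intro k hk
    have h1 := congrFun ((hasSum_zero_iff_of_nonneg fun k =>
      mul_nonneg (hp.nonneg k) (sub_nonneg.2 (hle k))).1 hre) k
    have h2 : (starRingEnd ℂ u * z ^ k).re = 1 := by
      rcases mul_eq_zero.1 h1 with h | h
      · exact absurd h hk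
      · linarith
    have h3 : starRingEnd ℂ u * z ^ k = 1 := by
      have h4 : ‖starRingEnd ℂ u * z ^ k‖ = 1 := by simp [hz, hone]
      apply Complex.ext
      · simpa using h2
      · have h5 := Complex.sq_norm (starRingEnd ℂ u * z ^ k)
        rw [h4, Complex.normSq_apply, h2] at h5
        simp only [Complex.one_im]
        nlinarith
    have h4 : u * starRingEnd ℂ u = 1 := by
      rw [Complex.mul_conj, Complex.normSq_eq_norm_sq, hone]; simp
    calc z ^ k = (u * starRingEnd ℂ u) * z ^ k := by rw [h4, one_mul]
      _ = u := by rw [mul_assoc, h3, mul_one]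
  have hu0 : u ≠ 0 := norm_pos_iff.1 (by rw [hone]; exact one_pos)
  have hall : ∀ k ∈ AddSubgroup.closure {k : ℤ | ∃ a b, p a ≠ 0 ∧ p b ≠ 0 ∧ k = a - b},
      z ^ k = 1 := by
    intro k hk
    induction hk using AddSubgroup.closure_induction with
    | mem k hk =>
      obtain ⟨a, b, ha, hb, rfl⟩ := hk
      rw [zpow_sub₀ hz0, hu1 a ha, hu1 b hb, div_self hu0]
    | zero => simp
    | add x y _ _ hx hy => rw [zpow_add₀ hz0, hx, hy, one_mul]
    | neg x _ hx => rw [zpow_neg, hx, inv_one]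
  have := hall 1 (by rw [hp.aperiodic]; trivial)
  simpa using this

lemma deriv_genFun_one (hp : CenteredLaw p) : deriv (genFun p) 1 = 0 := by
  have h := (hp.rapidDecay.hasDerivAt one_ne_zero).deriv
  rw [genFun, h, laurentSum]
  have h2 := (Equiv.addRight (1 : ℤ)).tsum_eq fun k : ℤ => ((k : ℂ)) * (p k : ℂ)
  have h3 : ∑' k : ℤ, (k : ℂ) * (p k : ℂ) = 0 := by
    have := congrArg ((↑) : ℝ → ℂ) hp.mean_zero
    push_cast at this
    exact this
  rw [h3] at h2
  simpa using h2

lemma deriv_deriv_genFun_one (hp : CenteredLaw p) :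
    deriv (deriv (genFun p)) 1 = (secondMoment p : ℂ) := by
  have h1 : deriv (genFun p) =ᶠ[𝓝 1]
      laurentSum (fun k : ℤ => ((k : ℂ) + 1) * (p (k + 1) : ℂ)) := by
    filter_upwards [isOpen_ne.mem_nhds (one_ne_zero : (1 : ℂ) ≠ 0)] with z hz
    exact (hp.rapidDecay.hasDerivAt hz).deriv
  rw [h1.deriv_eq, (hp.rapidDecay.shift_deriv.hasDerivAt one_ne_zero).deriv, laurentSum]
  have h2 := (Equiv.addRight (2 : ℤ)).tsum_eq fun k : ℤ => ((k : ℂ) - 1) * (k * (p k : ℂ))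
  have h3 : ∑' k : ℤ, ((k : ℂ) - 1) * (k * (p k : ℂ)) = secondMoment p := by
    have h4 := hp.summable_sq_mul.hasSum.sub hp.summable_int_mul.hasSum
    rw [hp.mean_zero, sub_zero] at h4
    have h5 := (Complex.hasSum_ofReal.2 h4).tsum_eq
    rw [secondMoment, ← h5]
    refine tsum_congr fun k => ?_
    push_cast
    ring
  rw [h3] at h2
  rw [← h2]
  refine tsum_congr fun k => ?_
  simp only [Equiv.coe_addRight, one_zpow, mul_one]
  push_cast
  rw [show k + 1 + 1 = k + 2 by ring]
  ring

end CenteredLaw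

/-! ### Circle averages -/

open Real

lemma norm_circleAverage_le {f : ℂ → ℂ} {R C : ℝ} (hR : 0 < R)
    (hf : ∀ z : ℂ, ‖z‖ = R → ‖f z‖ ≤ C) : ‖circleAverage f 0 R‖ ≤ C := by
  rw [circleAverage_def, norm_smul, Real.norm_of_nonneg (by positivity)]
  have h := intervalIntegral.norm_integral_le_of_norm_le_const (a := 0) (b := 2 * π)
    (f := fun θ => f (circleMap 0 R θ)) (C := C) fun θ _ => hf _ (by simp [abs_of_pos hR])
  rw [sub_zero, abs_of_pos (by positivity)] at h
  calc (2 * π)⁻¹ * ‖∫ θ in 0..2 * π, f (circleMap 0 R θ)‖ ≤ (2 * π)⁻¹ * (C * (2 * π)) := by gcongr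
    _ = C := by field_simp

/-- Differentiation of a circle average with respect to a complex parameter. -/
lemma hasDerivAt_circleAverage {F F' : ℂ → ℂ → ℂ} {U : Set ℂ} {R C : ℝ} (hR : 0 < R)
    (hU : IsOpen U) {x : ℂ} (hx : x ∈ U) (hF : ∀ y ∈ U, ContinuousOn (F y) (sphere 0 R))
    (hF' : ContinuousOn (F' x) (sphere 0 R)) (hb : ∀ y ∈ U, ∀ z ∈ sphere (0 : ℂ) R, ‖F' y z‖ ≤ C)
    (hd : ∀ y ∈ U, ∀ z ∈ sphere (0 : ℂ) R, HasDerivAt (fun y => F y z) (F' y z) y) :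
    HasDerivAt (fun y => circleAverage (F y) 0 R) (circleAverage (F' x) 0 R) x := by
  have hmem : ∀ θ : ℝ, circleMap 0 R θ ∈ sphere (0 : ℂ) R := fun θ =>
    circleMap_mem_sphere _ hR.le _
  have hcont : ∀ f : ℂ → ℂ, ContinuousOn f (sphere 0 R) →
      Continuous fun θ : ℝ => f (circleMap 0 R θ) := fun f hf =>
    hf.comp_continuous (continuous_circleMap 0 R) hmem
  have := (intervalIntegral.hasDerivAt_integral_of_dominated_loc_of_deriv_le
    (μ := volume) (a := 0) (b := 2 * π) (F := fun y θ => F y (circleMap 0 R θ))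
    (F' := fun y θ => F' y (circleMap 0 R θ)) (bound := fun _ => C) (hU.mem_nhds hx)
    (by
      filter_upwards [hU.mem_nhds hx] with y hy
      exact (hcont _ (hF y hy)).aestronglyMeasurable)
    ((hcont _ (hF x hx)).intervalIntegrable _ _)
    (hcont _ hF').aestronglyMeasurable
    (Eventually.of_forall fun θ _ y hy => hb y hy _ (hmem θ))
    intervalIntegrable_const
    (Eventually.of_forall fun θ _ y hy => hd y hy _ (hmem θ))).2
  simp only [circleAverage_def]
  exact this.const_smul ((2 * π)⁻¹ : ℝ)

lemma circleAverage_zpow (n : ℤ) :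
    circleAverage (fun z : ℂ => z ^ n) 0 1 = if n = 0 then 1 else 0 := by
  rw [circleAverage_eq_circleIntegral one_ne_zero]
  have h : (∮ z in C(0, 1), (z - 0)⁻¹ • z ^ n) = ∮ z in C(0, 1), (z - 0) ^ (n - 1) := by
    refine circleIntegral.integral_congr zero_le_one fun z hz => ?_
    have hz0 : z ≠ 0 := by
      rintro rfl
      simp at hz
    simp only [sub_zero, smul_eq_mul]
    rw [zpow_sub_one₀ hz0, mul_comm]
  rw [h]
  split_ifs with hn
  · subst hn
    have := circleIntegral.integral_sub_center_inv (0 : ℂ) (R := 1) one_ne_zero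
    simp only [zero_sub, zpow_neg_one]
    rw [this, smul_eq_mul, inv_mul_cancel₀ (by simp [Real.pi_ne_zero])]
  · rw [circleIntegral.integral_sub_zpow_of_ne (by omega), smul_zero]

/-- The Fourier coefficients of an absolutely convergent Laurent series on the unit circle. -/
lemma circleAverage_laurentSum {c : ℤ → ℂ} (hc : Summable fun k => ‖c k‖) (n : ℤ) :
    circleAverage (fun z => z ^ (-n) * laurentSum c z) 0 1 = c n := by
  have hz : ∀ θ : ℝ, ‖circleMap 0 1 θ‖ = 1 := fun θ => by simp
  have h1 := intervalIntegral.hasSum_integral_of_dominated_convergence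
    (μ := volume) (a := 0) (b := 2 * π)
    (F := fun (k : ℤ) (θ : ℝ) => circleMap 0 1 θ ^ (-n) * (c k * circleMap 0 1 θ ^ k))
    (f := fun θ => circleMap 0 1 θ ^ (-n) * laurentSum c (circleMap 0 1 θ))
    (fun k _ => ‖c k‖)
    (fun k => by
      have h0 : ∀ m : ℤ, Continuous fun θ : ℝ => circleMap 0 1 θ ^ m := fun m =>
        (continuous_circleMap 0 1).zpow₀ m fun θ => Or.inl (by
          rw [← norm_pos_iff, hz]; exact one_pos)
      exact ((h0 _).mul (continuous_const.mul (h0 _))).aestronglyMeasurable)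
    (fun k => Eventually.of_forall fun θ _ => by simp [hz])
    (Eventually.of_forall fun θ _ => hc)
    intervalIntegrable_const
    (Eventually.of_forall fun θ _ => by
      refine HasSum.mul_left _ ?_
      refine Summable.hasSum (Summable.of_norm ?_)
      simpa [hz] using hc)
  have h2 := h1.const_smul ((2 * π)⁻¹ : ℝ)
  have h3 : ∀ k : ℤ, (2 * π)⁻¹ • ∫ θ in 0..2 * π,
      circleMap 0 1 θ ^ (-n) * (c k * circleMap 0 1 θ ^ k) = if k = n then c n else 0 := by
    intro k
    have h4 : (2 * π)⁻¹ • ∫ θ in 0..2 * π,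
        circleMap 0 1 θ ^ (-n) * (c k * circleMap 0 1 θ ^ k) =
        c k • circleAverage (fun z : ℂ => z ^ (k - n)) 0 1 := by
      rw [← circleAverage_smul, circleAverage_def]
      congr 2
      ext θ
      have : circleMap 0 1 θ ≠ 0 := by rw [← norm_pos_iff, hz]; exact one_pos
      simp only [Pi.smul_apply, smul_eq_mul]
      rw [zpow_sub₀ this, zpow_neg]
      ring
    rw [h4, circleAverage_zpow]
    by_cases hk : k = n
    · simp [hk]
    · simp [hk, sub_eq_zero]
  simp only [h3] at h2
  have h5 : HasSum (fun k => if k = n then c n else 0) (c n) := hasSum_ite_eq n (c n)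
  exact h2.unique h5

/-- The residue theorem for a quotient with a single simple pole in an annulus, in terms of
averages over the two boundary circles. -/
lemma circleAverage_div_sub_eq_residue {N D : ℂ → ℂ} {r R : ℝ} {ζ : ℂ} (hr : 0 < r)
    (hN : ∀ z ≠ 0, DifferentiableAt ℂ N z) (hD : ∀ z ≠ 0, DifferentiableAt ℂ D z)
    (hrζ : r < ‖ζ‖) (hζR : ‖ζ‖ < R) (hζ : D ζ = 0) (hζ' : deriv D ζ ≠ 0)
    (huniq : ∀ z, r ≤ ‖z‖ → ‖z‖ ≤ R → D z = 0 → z = ζ) :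
    circleAverage (fun z => N z / D z) 0 R - circleAverage (fun z => N z / D z) 0 r =
      N ζ / (ζ * deriv D ζ) := by
  have hR : 0 < R := by linarith
  have hζ0 : ζ ≠ 0 := norm_pos_iff.1 (hr.trans hrζ)
  set A : Set ℂ := closedBall 0 R \ ball 0 r with hA
  have hA0 : ∀ z ∈ A, z ≠ 0 := fun z hz h => hz.2 (by simp [h, hr])
  have hAn : ∀ z ∈ A, r ≤ ‖z‖ ∧ ‖z‖ ≤ R := fun z hz => by
    have h1 := hz.1; have h2 := hz.2
    simp at h1 h2
    exact ⟨h2, h1⟩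
  set D₁ := dslope D ζ with hD₁
  have hD₁eq : ∀ z, D z = (z - ζ) * D₁ z := fun z => by
    have := sub_smul_dslope D ζ z
    rw [hζ, sub_zero, smul_eq_mul] at this
    exact this.symm
  have hD₁0 : ∀ z ∈ A, D₁ z ≠ 0 := by
    intro z hz h
    have h1 : D z = 0 := by rw [hD₁eq, h, mul_zero]
    have h2 := huniq z (hAn z hz).1 (hAn z hz).2 h1
    rw [h2, hD₁, dslope_same] at h
    exact hζ' h
  have hD₁d : ∀ z ≠ 0, DifferentiableAt ℂ D₁ z := by
    have h1 : DifferentiableOn ℂ D {0}ᶜ := fun z hz => (hD z hz).differentiableWithinAt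
    have h2 := (differentiableOn_dslope (isOpen_compl_singleton.mem_nhds hζ0)).2 h1
    exact fun z hz => h2.differentiableAt (isOpen_compl_singleton.mem_nhds hz)
  set B : ℂ → ℂ := fun z => N z / (z * D₁ z) with hB
  have hBd : ∀ z ∈ A, DifferentiableAt ℂ B z := fun z hz =>
    (hN z (hA0 z hz)).div (differentiableAt_id.mul (hD₁d z (hA0 z hz)))
      (mul_ne_zero (hA0 z hz) (hD₁0 z hz))
  have hζA : ζ ∈ A := ⟨by simpa using hζR.le, by simpa using hrζ.le⟩
  have hcongr : ∀ ρ : ℝ, 0 < ρ → (∀ z : ℂ, ‖z‖ = ρ → z ∈ A ∧ z ≠ ζ) →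
      circleAverage (fun z => N z / D z) 0 ρ =
        (2 * π * I)⁻¹ * ((∮ z in C(0, ρ), dslope B ζ z) + B ζ * ∮ z in C(0, ρ), (z - ζ)⁻¹) := by
    intro ρ hρ hmem
    rw [circleAverage_eq_circleIntegral hρ.ne', smul_eq_mul, ← circleIntegral.integral_const_mul (B ζ),
      ← circleIntegral.integral_add]
    · congr 1
      refine circleIntegral.integral_congr hρ.le fun z hz => ?_
      obtain ⟨hzA, hzζ⟩ := hmem z (by simpa using hz)
      have h1 := hD₁0 z hzA
      have h2 := hA0 z hzA
      have h3 : z - ζ ≠ 0 := sub_ne_zero.2 hzζ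
      have h4 := sub_smul_dslope B ζ z
      rw [smul_eq_mul] at h4
      have h5 : dslope B ζ z = (B z - B ζ) / (z - ζ) := by rw [← h4]; field_simp
      simp only [h5, sub_zero, smul_eq_mul, hD₁eq z]
      rw [hB]
      field_simp
      ring
    · refine ContinuousOn.circleIntegrable hρ.le fun z hz => ?_
      obtain ⟨hzA, hzζ⟩ := hmem z (by simpa using hz)
      exact ((continuousAt_dslope_of_ne hzζ).2 (hBd z hzA).continuousAt).continuousWithinAt
    · refine ContinuousOn.circleIntegrable hρ.le fun z hz => ?_
      obtain ⟨hzA, hzζ⟩ := hmem z (by simpa using hz)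
      exact (continuousAt_const.mul ((continuousAt_id.sub continuousAt_const).inv₀
        (sub_ne_zero.2 hzζ))).continuousWithinAt
  rw [hcongr R hR fun z hz => ⟨⟨by simp [hz], by simp [hz]; linarith⟩, by rintro rfl; linarith⟩,
    hcongr r hr fun z hz => ⟨⟨by simp [hz]; linarith, by simp [hz]⟩, by rintro rfl; linarith⟩]
  have h1 : (∮ z in C(0, R), dslope B ζ z) = ∮ z in C(0, r), dslope B ζ z := by
    refine circleIntegral_eq_of_differentiable_on_annulus_off_countable hr (by linarith)
      (countable_singleton ζ) (fun z hz => ?_) fun z hz => ?_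
    · rcases eq_or_ne z ζ with rfl | h
      · exact (continuousAt_dslope_same.2 (hBd z hz)).continuousWithinAt
      · exact ((continuousAt_dslope_of_ne h).2 (hBd z hz).continuousAt).continuousWithinAt
    · refine (differentiableAt_dslope_of_ne hz.2).2 (hBd z ⟨ball_subset_closedBall hz.1.1, fun h =>
        hz.1.2 (ball_subset_closedBall h)⟩)
  have h2 : (∮ z in C(0, R), (z - ζ)⁻¹) = 2 * π * I :=
    circleIntegral.integral_sub_inv_of_mem_ball (by simpa using hζR)
  have h3 : (∮ z in C(0, r), (z - ζ)⁻¹) = 0 := by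
    have hne : ∀ z ∈ closedBall (0 : ℂ) r, z - ζ ≠ 0 := fun z hz h => by
      rw [sub_eq_zero] at h
      subst h
      simp at hz
      linarith
    refine circleIntegral_eq_zero_of_differentiable_on_off_countable hr.le countable_empty
      (fun z hz => ?_) fun z hz => ?_
    · exact ((continuousAt_id.sub continuousAt_const).inv₀ (hne z hz)).continuousWithinAt
    · exact (differentiableAt_id.sub_const ζ).inv (hne z (ball_subset_closedBall hz.1))
  rw [h1, h2, h3, hB]
  simp only [hD₁, dslope_same]
  have : (2 * π * I : ℂ) ≠ 0 := by simp [Real.pi_ne_zero]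
  rw [← mul_sub, mul_zero, add_zero, add_sub_cancel_left, mul_comm _ (2 * π * I : ℂ),
    inv_mul_cancel_left₀ this]

/-- If `f` and `g` are holomorphic in the unit disk, continuous up to the boundary, and
`f z = g (1 / z)` on the unit circle, then both are constant; the value at `0` fixes the constant.
On the circle `|f - 1| ^ 2` is the holomorphic function `(f z - 1) * conj (g (conj z) - 1)`, so its
mean is the value of the latter at `0`, which vanishes. -/
lemma eq_one_of_eq_conj_on_sphere {f g : ℂ → ℂ} (hf : DiffContOnCl ℂ f (ball 0 1))
    (hg : DiffContOnCl ℂ g (ball 0 1)) (hfg : ∀ z : ℂ, ‖z‖ = 1 → f z = g (starRingEnd ℂ z))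
    (h1 : f 0 = 1 ∨ g 0 = 1) {z : ℂ} (hz : ‖z‖ ≤ 1) : f z = 1 := by
  have hcl : closure (ball (0 : ℂ) 1) = closedBall 0 1 := closure_ball 0 one_ne_zero
  have hmf : circleAverage f 0 1 = f 0 := by
    apply DiffContOnCl.circleAverage
    simpa using hf
  have hmg : circleAverage g 0 1 = g 0 := by
    apply DiffContOnCl.circleAverage
    simpa using hg
  have hconj : ∀ z : ℂ, ‖z‖ = 1 → starRingEnd ℂ z = z⁻¹ := fun z hz =>
    (Complex.inv_eq_conj hz).symm
  have h0 : f 0 = g 0 := by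
    rw [← hmf, ← hmg, ← circleAverage_zero_one_congr_inv (f := g)]
    refine circleAverage_congr_sphere fun z hz => ?_
    have : ‖z‖ = 1 := by simpa using hz
    rw [hfg z this, hconj z this]
  have hf0 : f 0 = 1 := by rcases h1 with h | h <;> simp [h, h0]
  have hg0 : g 0 = 1 := h0 ▸ hf0
  set H : ℂ → ℂ := fun z => (f z - 1) * starRingEnd ℂ (g (starRingEnd ℂ z) - 1) with hH
  have hHd : DiffContOnCl ℂ H (ball 0 1) := by
    refine ⟨fun z hz => ?_, ?_⟩
    · have hz' : starRingEnd ℂ z ∈ ball (0 : ℂ) 1 := by simpa using hz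
      have hgz := ((hg.differentiableAt isOpen_ball hz').sub_const 1).conj_conj
      have hfz := (hf.differentiableAt isOpen_ball hz).sub_const 1
      have : DifferentiableAt ℂ (fun z => starRingEnd ℂ (g (starRingEnd ℂ z) - 1)) z := by
        simpa [Function.comp_def] using hgz
      exact (hfz.mul this).differentiableWithinAt
    · refine ((hf.2.sub continuousOn_const)).mul ?_
      refine Complex.continuous_conj.comp_continuousOn ((hg.2.comp
        Complex.continuous_conj.continuousOn fun z hz => ?_).sub continuousOn_const)
      rw [hcl] at hz ⊢
      simpa using hz
  have hmH : circleAverage H 0 1 = 0 := by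
    have : circleAverage H 0 1 = H 0 := by
      apply DiffContOnCl.circleAverage
      simpa using hHd
    rw [this, hH]
    simp [hf0]
  have hHs : ∀ z : ℂ, ‖z‖ = 1 → H z = ((‖f z - 1‖ ^ 2 : ℝ) : ℂ) := fun z hz => by
    simp only [hH, ← hfg z hz, Complex.mul_conj, Complex.normSq_eq_norm_sq]
  have hfc : ContinuousOn f (closedBall 0 1) := hcl ▸ hf.2
  have hcont : Continuous fun θ : ℝ => ‖f (circleMap 0 1 θ) - 1‖ ^ 2 := by
    refine ((hfc.comp_continuous (continuous_circleMap 0 1) fun θ => ?_).sub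
      continuous_const).norm.pow 2
    simp
  have hint : ∫ θ in 0..2 * π, ‖f (circleMap 0 1 θ) - 1‖ ^ 2 = 0 := by
    rw [circleAverage_def] at hmH
    have h2 : ∫ θ in 0..2 * π, H (circleMap 0 1 θ) =
        ((∫ θ in 0..2 * π, ‖f (circleMap 0 1 θ) - 1‖ ^ 2 : ℝ) : ℂ) := by
      rw [← intervalIntegral.integral_ofReal]
      exact intervalIntegral.integral_congr fun θ _ => hHs _ (by simp)
    rw [h2] at hmH
    have h3 := (smul_eq_zero.1 hmH).resolve_left (by positivity)
    exact_mod_cast h3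
  have hzero : ∀ θ ∈ Icc (0 : ℝ) (2 * π), ‖f (circleMap 0 1 θ) - 1‖ ^ 2 = 0 := by
    by_contra! hne
    obtain ⟨θ, hθ, hne⟩ := hne
    have := intervalIntegral.integral_pos (by positivity : (0 : ℝ) < 2 * π) hcont.continuousOn
      (fun θ _ => by positivity) ⟨θ, hθ, lt_of_le_of_ne (by positivity) hne.symm⟩
    linarith
  have hsph : EqOn f (fun _ => 1) (sphere 0 1) := by
    intro z hz
    have h4 : z ∈ circleMap 0 1 '' Ioc 0 (2 * π) := by
      rw [image_circleMap_Ioc]; simpa using hz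
    obtain ⟨θ, hθ, rfl⟩ := h4
    have := hzero θ (Ioc_subset_Icc_self hθ)
    simpa [sub_eq_zero] using this
  have := Complex.eqOn_closure_of_eqOn_frontier isBounded_ball hf diffContOnCl_const
    (by rwa [frontier_ball (0 : ℂ) one_ne_zero])
  rw [hcl] at this
  exact this (by simpa using hz)

/-! ### The generating function near its double zero -/

lemma deriv_dslope_same {f : ℂ → ℂ} {a : ℂ} (hf : AnalyticAt ℂ f a) :
    deriv (dslope f a) a = deriv (deriv f) a / 2 := by
  obtain ⟨s, hs, hd⟩ := hf.exists_mem_nhds_analyticOnNhd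
  have hds : DifferentiableOn ℂ (dslope f a) s :=
    (Complex.differentiableOn_dslope hs).2 hd.differentiableOn
  have han : AnalyticAt ℂ (dslope f a) a := hds.analyticAt hs
  have heq : deriv f =ᶠ[𝓝 a] fun z => dslope f a z + (z - a) * deriv (dslope f a) z := by
    filter_upwards [han.eventually_analyticAt] with z hz
    have h1 : f = fun z => f a + (z - a) * dslope f a z := by
      ext w
      have := sub_smul_dslope f a w
      rw [smul_eq_mul] at this
      rw [this]; ring
    have h2 := (((hasDerivAt_id z).sub_const a).mul hz.differentiableAt.hasDerivAt).const_add (f a)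
    have h3 : HasDerivAt f (1 * dslope f a z + (z - a) * deriv (dslope f a) z) z := by
      rw [h1]
      simpa [← h1] using h2
    rw [h3.deriv, one_mul]
  have h4 := han.differentiableAt.hasDerivAt.add
    (((hasDerivAt_id a).sub_const a).mul han.deriv.differentiableAt.hasDerivAt)
  have h5 : deriv (deriv f) a = 2 * deriv (dslope f a) a := by
    rw [heq.deriv_eq]
    have := h4.deriv
    simp only [id, sub_self, zero_mul, add_zero, one_mul] at this
    rw [two_mul]
    exact this
  rw [h5]; ring

namespace CenteredLaw

variable {p : ℤ → ℝ}

lemma analyticAt_genFun (hp : CenteredLaw p) {z : ℂ} (hz : z ≠ 0) : AnalyticAt ℂ (genFun p) z :=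
  DifferentiableOn.analyticAt (s := {0}ᶜ)
    (fun _ hw => (hp.differentiableAt_genFun hw).differentiableWithinAt)
    (isOpen_compl_singleton.mem_nhds hz)

/-- The function `1 - 1 / φ` has a double zero at `1`, with leading coefficient `σ² / 2`, so that it
has a holomorphic square root with the derivative `σ / √2`. -/
lemma exists_local_sqrt (hp : CenteredLaw p) :
    ∃ h : ℂ → ℂ, AnalyticAt ℂ h 1 ∧ h 1 = 0 ∧
      HasDerivAt h ((√(secondMoment p) / √2 : ℝ) : ℂ) 1 ∧
      ∀ᶠ z in 𝓝 1, z ≠ 0 ∧ genFun p z ≠ 0 ∧ h z ^ 2 = 1 - (genFun p z)⁻¹ := by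
  have h10 : (1 : ℂ) ≠ 0 := one_ne_zero
  set φ := genFun p with hφ
  have hφa : AnalyticAt ℂ φ 1 := hp.analyticAt_genFun h10
  have hmem : ({0}ᶜ : Set ℂ) ∈ 𝓝 (1 : ℂ) := isOpen_compl_singleton.mem_nhds h10
  have hd0 : DifferentiableOn ℂ φ {0}ᶜ := fun z hz =>
    (hp.differentiableAt_genFun hz).differentiableWithinAt
  have hd1 : DifferentiableOn ℂ (dslope φ 1) {0}ᶜ := (Complex.differentiableOn_dslope hmem).2 hd0
  have hd2 : DifferentiableOn ℂ (dslope (dslope φ 1) 1) {0}ᶜ :=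
    (Complex.differentiableOn_dslope hmem).2 hd1
  set q := dslope (dslope φ 1) 1 with hq
  have hqa : AnalyticAt ℂ q 1 := hd2.analyticAt hmem
  have hq1 : q 1 = ((secondMoment p / 2 : ℝ) : ℂ) := by
    rw [hq, dslope_same, deriv_dslope_same hφa, hφ, hp.deriv_deriv_genFun_one]
    push_cast; rfl
  have hφq : ∀ z, φ z = 1 + (z - 1) ^ 2 * q z := by
    intro z
    have e1 := sub_smul_dslope φ 1 z
    have e2 := sub_smul_dslope (dslope φ 1) 1 z
    rw [dslope_same, hφ, hp.deriv_genFun_one, sub_zero, smul_eq_mul, ← hφ] at e2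
    rw [smul_eq_mul, ← e2, hφ, hp.genFun_one, ← hφ] at e1
    linear_combination -e1
  have hφ1 : φ 1 = 1 := hp.genFun_one
  have hφ0 : ∀ᶠ z in 𝓝 1, φ z ≠ 0 := hφa.continuousAt.eventually_ne (by rw [hφ1]; exact h10)
  have hpos : 0 < secondMoment p / 2 := half_pos hp.secondMoment_pos
  set k : ℂ → ℂ := fun z => q z / φ z with hk
  have hka : AnalyticAt ℂ k 1 := hqa.div hφa (by rw [hφ1]; exact h10)
  have hk1 : k 1 = ((secondMoment p / 2 : ℝ) : ℂ) := by simp only [hk, hφ1, hq1, div_one]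
  have hkslit : k 1 ∈ slitPlane := by rw [hk1]; exact Or.inl (by simpa using hpos)
  set g : ℂ → ℂ := fun z => k z ^ (1 / 2 : ℂ) with hg
  have hga : AnalyticAt ℂ g 1 := hka.cpow analyticAt_const hkslit
  have hg1 : g 1 = ((√(secondMoment p) / √2 : ℝ) : ℂ) := by
    have : (1 / 2 : ℂ) = ((1 / 2 : ℝ) : ℂ) := by push_cast; rfl
    simp only [hg, hk1]
    rw [this, ← Complex.ofReal_cpow hpos.le, ← Real.sqrt_eq_rpow, Real.sqrt_div' _ (by norm_num)]
  refine ⟨fun z => (z - 1) * g z, (analyticAt_id.sub analyticAt_const).mul hga, by simp, ?_, ?_⟩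
  · have := ((hasDerivAt_id (1 : ℂ)).sub_const 1).mul hga.differentiableAt.hasDerivAt
    simp only [id, sub_self, zero_mul, add_zero, one_mul, hg1] at this
    exact this
  · filter_upwards [hφ0, isOpen_compl_singleton.mem_nhds h10] with z hz hz0
    refine ⟨hz0, hz, ?_⟩
    have hsq : g z ^ 2 = k z := by
      simp only [hg]
      rw [one_div]
      exact_mod_cast Complex.cpow_nat_inv_pow (k z) two_ne_zero
    rw [mul_pow, hsq, hk]
    have := hφq z
    field_simp
    rw [this]; ring

/-- The two solutions `Z ε`, `Z (-ε)` near `1` of `(1 - ε²) φ(z) = 1`, that is of `h z = ±ε` for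
the holomorphic square root `h` of `1 - 1 / φ`: the map `Z` is the local inverse of `h`. -/
lemma exists_local_root (hp : CenteredLaw p) :
    ∃ (Z : ℂ → ℂ) (ε₀ η : ℝ), 0 < ε₀ ∧ 0 < η ∧ η ≤ 1 / 2 ∧ Z 0 = 1 ∧
      DifferentiableOn ℂ Z (ball 0 ε₀) ∧
      HasDerivAt Z ((√2 / √(secondMoment p) : ℝ) : ℂ) 0 ∧
      (∀ ε ∈ ball (0 : ℂ) ε₀, Z ε ∈ ball (1 : ℂ) η ∧ (1 - ε ^ 2) * genFun p (Z ε) = 1) ∧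
      ∀ ε ∈ ball (0 : ℂ) ε₀, ∀ z ∈ ball (1 : ℂ) η, (1 - ε ^ 2) * genFun p z = 1 →
        z = Z ε ∨ z = Z (-ε) := by
  obtain ⟨h, ha, h1, hd, hev⟩ := hp.exists_local_sqrt
  set c : ℂ := ((√(secondMoment p) / √2 : ℝ) : ℂ) with hc
  have hσ : 0 < √(secondMoment p) := Real.sqrt_pos.2 hp.secondMoment_pos
  have hc0 : c ≠ 0 := by
    rw [hc, Complex.ofReal_ne_zero]; positivity
  have hcd : ContDiffAt ℂ 1 h 1 := ha.contDiffAt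
  have hstr : HasStrictDerivAt h c 1 := by
    have := hcd.hasStrictDerivAt one_ne_zero
    rwa [hd.deriv] at this
  set Z := hstr.localInverse h c 1 hc0 with hZ
  have hZd : HasStrictDerivAt Z c⁻¹ 0 := by
    have := hstr.to_localInverse hc0
    rwa [h1] at this
  have hZ0 : Z 0 = 1 := by
    have := (hstr.hasStrictFDerivAt_equiv hc0).localInverse_apply_image
    rwa [h1] at this
  have hright : ∀ᶠ ε in 𝓝 (0 : ℂ), h (Z ε) = ε := by
    have := (hstr.hasStrictFDerivAt_equiv hc0).eventually_right_inverse
    rwa [h1] at this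
  have hleft : ∀ᶠ z in 𝓝 (1 : ℂ), Z (h z) = z :=
    (hstr.hasStrictFDerivAt_equiv hc0).eventually_left_inverse
  have hZc : ContDiffAt ℂ 1 Z 0 := by
    have hfd : HasFDerivAt h ((ContinuousLinearEquiv.unitsEquivAut ℂ (Units.mk0 c hc0) :
      ℂ ≃L[ℂ] ℂ) : ℂ →L[ℂ] ℂ) 1 := (hstr.hasStrictFDerivAt_equiv hc0).hasFDerivAt
    have := hcd.to_localInverse hfd one_ne_zero
    rwa [h1] at this
  have hZdiff : ∀ᶠ ε in 𝓝 (0 : ℂ), DifferentiableAt ℂ Z ε := by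
    filter_upwards [hZc.eventually (by simp)] with ε hε
    exact hε.differentiableAt one_ne_zero
  obtain ⟨η₁, hη₁, hη₁'⟩ := Metric.eventually_nhds_iff_ball.1 (hev.and hleft)
  set η := min η₁ (1 / 2) with hη
  have hη0 : 0 < η := lt_min hη₁ (by norm_num)
  have hball : ∀ᶠ ε in 𝓝 (0 : ℂ), Z ε ∈ ball (1 : ℂ) η := by
    have := hZd.hasDerivAt.continuousAt
    rw [ContinuousAt, hZ0] at this
    exact this (ball_mem_nhds _ hη0)
  obtain ⟨ε₀, hε₀, hε₀'⟩ := Metric.eventually_nhds_iff_ball.1 (hright.and (hZdiff.and hball))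
  have hsub : ball (1 : ℂ) η ⊆ ball 1 η₁ := ball_subset_ball (min_le_left _ _)
  refine ⟨Z, ε₀, η, hε₀, hη0, min_le_right _ _, hZ0, fun ε hε =>
    (hε₀' ε hε).2.1.differentiableWithinAt, ?_, ?_, ?_⟩
  · have : ((√2 / √(secondMoment p) : ℝ) : ℂ) = c⁻¹ := by
      rw [hc, ← Complex.ofReal_inv, inv_div]
    rw [this]
    exact hZd.hasDerivAt
  · intro ε hε
    obtain ⟨e1, -, e3⟩ := hε₀' ε hε
    obtain ⟨⟨e4, e5, e6⟩, -⟩ := hη₁' _ (hsub e3)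
    refine ⟨e3, ?_⟩
    rw [e1] at e6
    rw [e6]
    field_simp
    ring
  · intro ε hε z hz hφ
    obtain ⟨⟨e4, e5, e6⟩, e7⟩ := hη₁' _ (hsub hz)
    have e8 : h z ^ 2 = ε ^ 2 := by
      rw [e6]
      field_simp
      linear_combination hφ
    rcases sq_eq_sq_iff_eq_or_eq_neg.1 e8 with e | e
    · left; rw [← e, e7]
    · right; rw [← e, e7]

end CenteredLaw

/-! ### Logarithmic coefficients -/

/-- The Fourier coefficient of index `j` of `log (1 - s φ)` on the unit circle. -/
noncomputable def logCoeff (p : ℤ → ℝ) (j : ℤ) (s : ℂ) : ℂ :=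
  circleAverage (fun z => z ^ (-j) * Complex.log (1 - s * genFun p z)) 0 1

/-- The average over the circle of radius `R` of `z ^ (-j) φ / (1 - s φ)`. For `R = 1` this is
`-dℓ_j / ds`, where `ℓ_j` is the coefficient `logCoeff p j`. -/
noncomputable def resolventCoeff (p : ℤ → ℝ) (R : ℝ) (j : ℤ) (s : ℂ) : ℂ :=
  circleAverage (fun z => z ^ (-j) * genFun p z / (1 - s * genFun p z)) 0 R

lemma ne_zero_of_mem_sphere {R : ℝ} (hR : 0 < R) {z : ℂ} (hz : z ∈ sphere (0 : ℂ) R) : z ≠ 0 := by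
  rintro rfl
  simp at hz
  linarith

lemma continuousOn_zpow_sphere {R : ℝ} (hR : 0 < R) (j : ℤ) :
    ContinuousOn (fun z : ℂ => z ^ j) (sphere 0 R) := fun z hz =>
  (continuousAt_zpow₀ z j (Or.inl (ne_zero_of_mem_sphere hR hz))).continuousWithinAt

lemma norm_zpow_neg_le_one {R : ℝ} (hR : 1 ≤ R) (j : ℕ) {z : ℂ} (hz : ‖z‖ = R) :
    ‖z ^ (-(j : ℤ))‖ ≤ 1 := by
  rw [norm_zpow, hz, zpow_neg, zpow_natCast]
  exact inv_le_one_of_one_le₀ (one_le_pow₀ hR)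

namespace CenteredLaw

variable {p : ℤ → ℝ}

lemma continuousOn_genFun_sphere (hp : CenteredLaw p) {R : ℝ} (hR : 0 < R) :
    ContinuousOn (genFun p) (sphere 0 R) := fun _ hz =>
  (hp.differentiableAt_genFun (ne_zero_of_mem_sphere hR hz)).continuousAt.continuousWithinAt

/-- The logarithmic Fourier coefficients are holomorphic in `s` as long as `1 - s φ` stays in the
slit plane, away from `0`, on the unit circle. -/
lemma hasDerivAt_logCoeff (hp : CenteredLaw p) {U : Set ℂ} (hU : IsOpen U) {κ : ℝ} (hκ : 0 < κ)
    (h1 : ∀ y ∈ U, ∀ z : ℂ, ‖z‖ = 1 → 1 - y * genFun p z ∈ slitPlane)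
    (h2 : ∀ y ∈ U, ∀ z : ℂ, ‖z‖ = 1 → κ ≤ ‖1 - y * genFun p z‖) (j : ℤ) {s : ℂ} (hs : s ∈ U) :
    HasDerivAt (logCoeff p j) (-resolventCoeff p 1 j s) s := by
  have hz1 : ∀ z : ℂ, z ∈ sphere (0 : ℂ) 1 → ‖z‖ = 1 := fun z hz => by simpa using hz
  have hφc := hp.continuousOn_genFun_sphere one_pos
  have hne : ∀ y ∈ U, ∀ z ∈ sphere (0 : ℂ) 1, 1 - y * genFun p z ≠ 0 := fun y hy z hz =>
    slitPlane_ne_zero (h1 y hy z (hz1 z hz))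
  have key := hasDerivAt_circleAverage (R := 1) (C := 1 / κ)
    (F := fun s z => z ^ (-j) * Complex.log (1 - s * genFun p z))
    (F' := fun s z => -(z ^ (-j) * genFun p z / (1 - s * genFun p z))) one_pos hU hs
    (fun y hy => (continuousOn_zpow_sphere one_pos _).mul
      ((continuousOn_const.sub (continuousOn_const.mul hφc)).clog fun z hz =>
        h1 y hy z (hz1 z hz)))
    (((continuousOn_zpow_sphere one_pos _).mul hφc).div
      (continuousOn_const.sub (continuousOn_const.mul hφc)) (hne s hs)).neg
    (fun y hy z hz => by
      rw [norm_neg, norm_div, norm_mul, norm_zpow, hz1 z hz, one_zpow, one_mul]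
      have := h2 y hy z (hz1 z hz)
      have := hp.norm_genFun_le_one (hz1 z hz)
      gcongr)
    (fun y hy z hz => by
      have e1 : HasDerivAt (fun y : ℂ => 1 - y * genFun p z) (-genFun p z) y := by
        simpa using ((hasDerivAt_id y).mul_const (genFun p z)).const_sub 1
      have e2 := (e1.clog (h1 y hy z (hz1 z hz))).const_mul (z ^ (-j))
      exact e2.congr_deriv (by ring))
  have hneg : circleAverage (fun z => -(z ^ (-j) * genFun p z / (1 - s * genFun p z))) 0 1 =
      -resolventCoeff p 1 j s := by
    have := circleAverage_smul (a := (-1 : ℂ)) (c := 0) (R := 1)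
      (f := fun z => z ^ (-j) * genFun p z / (1 - s * genFun p z))
    rw [neg_one_smul, neg_one_smul] at this
    exact this
  rw [← hneg]
  exact key

lemma norm_mul_genFun_lt_one (hp : CenteredLaw p) {s z : ℂ} (hs : ‖s‖ < 1) (hz : ‖z‖ = 1) :
    ‖s * genFun p z‖ < 1 := by
  rw [norm_mul]
  have := hp.norm_genFun_le_one hz
  have := norm_nonneg (genFun p z)
  nlinarith [norm_nonneg s]

lemma one_sub_mem_slitPlane (hp : CenteredLaw p) {s z : ℂ} (hs : ‖s‖ < 1) (hz : ‖z‖ = 1) :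
    1 - s * genFun p z ∈ slitPlane := by
  have h1 := hp.norm_mul_genFun_lt_one hs hz
  have h2 := Complex.re_le_norm (s * genFun p z)
  left
  simp only [sub_re, one_re]
  linarith

lemma hasDerivAt_logCoeff_of_norm_lt_one (hp : CenteredLaw p) (j : ℤ) {s : ℂ} (hs : ‖s‖ < 1) :
    HasDerivAt (logCoeff p j) (-resolventCoeff p 1 j s) s := by
  obtain ⟨r, hr1, hr2⟩ := exists_between hs
  refine hp.hasDerivAt_logCoeff (U := ball 0 r) (κ := 1 - r) isOpen_ball (by linarith)
    (fun y hy z hz => hp.one_sub_mem_slitPlane ?_ hz) (fun y hy z hz => ?_) j (by simpa using hr1)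
  · have : ‖y‖ < r := by simpa using hy
    linarith
  · have h1 : ‖y‖ < r := by simpa using hy
    have h2 := hp.norm_genFun_le_one hz
    have h3 := norm_sub_norm_le 1 (y * genFun p z)
    rw [norm_mul, norm_one] at h3
    have := norm_nonneg (genFun p z)
    nlinarith [norm_nonneg y]

lemma norm_logCoeff_le {C : ℝ} {s : ℂ} (h : ∀ z : ℂ, ‖z‖ = 1 →
    ‖Complex.log (1 - s * genFun p z)‖ ≤ C) (j : ℤ) : ‖logCoeff p j s‖ ≤ C :=
  norm_circleAverage_le one_pos fun z hz => by
    rw [norm_mul, norm_zpow, hz, one_zpow, one_mul]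
    exact h z hz

lemma exists_norm_logCoeff_le (hp : CenteredLaw p) {s : ℂ} (hs : ‖s‖ < 1) :
    ∃ C : ℝ, 0 ≤ C ∧ ∀ j, ‖logCoeff p j s‖ ≤ C := by
  have hc : ContinuousOn (fun z => Complex.log (1 - s * genFun p z)) (sphere 0 1) :=
    (continuousOn_const.sub (continuousOn_const.mul (hp.continuousOn_genFun_sphere one_pos))).clog
      fun z hz => hp.one_sub_mem_slitPlane hs (by simpa using hz)
  obtain ⟨C, hC⟩ := (isCompact_sphere (0 : ℂ) 1).exists_bound_of_continuousOn hc
  refine ⟨max C 0, le_max_right _ _, fun j => norm_logCoeff_le (fun z hz => ?_) j⟩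
  exact (hC z (by simpa using hz)).trans (le_max_left _ _)

/-- On a circle where `1 - s φ` is bounded away from zero, the resolvent coefficients are
holomorphic in `s`. -/
lemma differentiableOn_resolventCoeff (hp : CenteredLaw p) {R κ : ℝ} (hR : 1 ≤ R) (hκ : 0 < κ)
    {U : Set ℂ} (hU : IsOpen U) (h2 : ∀ y ∈ U, ∀ z : ℂ, ‖z‖ = R → κ ≤ ‖1 - y * genFun p z‖)
    (j : ℕ) : DifferentiableOn ℂ (resolventCoeff p R j) U := by
  have hR0 : 0 < R := by linarith
  have hz1 : ∀ z : ℂ, z ∈ sphere (0 : ℂ) R → ‖z‖ = R := fun z hz => by simpa using hz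
  have hφc := hp.continuousOn_genFun_sphere hR0
  obtain ⟨B, hB⟩ := (isCompact_sphere (0 : ℂ) R).exists_bound_of_continuousOn hφc
  have hB' : ∀ z ∈ sphere (0 : ℂ) R, ‖genFun p z‖ ≤ |B| := fun z hz =>
    (hB z hz).trans (le_abs_self B)
  have hne : ∀ y ∈ U, ∀ z ∈ sphere (0 : ℂ) R, 1 - y * genFun p z ≠ 0 := fun y hy z hz =>
    norm_pos_iff.1 (hκ.trans_le (h2 y hy z (hz1 z hz)))
  intro s hs
  refine DifferentiableAt.differentiableWithinAt (HasDerivAt.differentiableAt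
    (hasDerivAt_circleAverage (R := R) (C := |B| ^ 2 / κ ^ 2)
    (F := fun s z => z ^ (-(j : ℤ)) * genFun p z / (1 - s * genFun p z))
    (F' := fun s z => z ^ (-(j : ℤ)) * genFun p z ^ 2 / (1 - s * genFun p z) ^ 2) hR0 hU hs
    (fun y hy => ((continuousOn_zpow_sphere hR0 _).mul hφc).div
      (continuousOn_const.sub (continuousOn_const.mul hφc)) (hne y hy))
    (((continuousOn_zpow_sphere hR0 _).mul (hφc.pow 2)).div
      ((continuousOn_const.sub (continuousOn_const.mul hφc)).pow 2)
      fun z hz => pow_ne_zero 2 (hne s hs z hz))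
    (fun y hy z hz => ?_) (fun y hy z hz => ?_)))
  · rw [norm_div, norm_mul, norm_pow, norm_pow]
    have e1 := h2 y hy z (hz1 z hz)
    have e2 := hB' z hz
    have e3 := norm_zpow_neg_le_one hR j (hz1 z hz)
    calc _ ≤ 1 * |B| ^ 2 / κ ^ 2 := by gcongr
      _ = _ := by rw [one_mul]
  · have e1 : HasDerivAt (fun y : ℂ => 1 - y * genFun p z) (-genFun p z) y := by
      simpa using ((hasDerivAt_id y).mul_const (genFun p z)).const_sub 1
    have e2 := (e1.fun_inv (hne y hy z hz)).const_mul (z ^ (-(j : ℤ)) * genFun p z)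
    simp only [div_eq_mul_inv] at e2 ⊢
    exact e2.congr_deriv (by ring)

lemma norm_resolventCoeff_le {R B κ : ℝ} (hR : 1 ≤ R) (hκ : 0 < κ) {s : ℂ}
    (hB : ∀ z : ℂ, ‖z‖ = R → ‖genFun p z‖ ≤ B)
    (h2 : ∀ z : ℂ, ‖z‖ = R → κ ≤ ‖1 - s * genFun p z‖) (j : ℕ) :
    ‖resolventCoeff p R j s‖ ≤ B / κ := by
  refine norm_circleAverage_le (by linarith) fun z hz => ?_
  rw [norm_div, norm_mul]
  have e1 := h2 z hz
  have e2 := hB z hz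
  have e3 := norm_zpow_neg_le_one hR j hz
  calc _ ≤ 1 * B / κ := by gcongr; linarith [norm_nonneg (genFun p z)]
    _ = _ := by rw [one_mul]

/-- An annulus `1 ≤ |z| ≤ ρ` in which `φ` takes the value `1` only near the point `1`, with
quantitative bounds. -/
lemma exists_annulus (hp : CenteredLaw p) {η : ℝ} (hη : 0 < η)
    (hη1 : ∀ z ∈ ball (1 : ℂ) η, genFun p z = 1 → z = 1) :
    ∃ ρ κ B : ℝ, 1 < ρ ∧ 0 < κ ∧ 0 < B ∧ (∀ z : ℂ, 1 ≤ ‖z‖ → ‖z‖ ≤ ρ → ‖genFun p z‖ ≤ B) ∧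
      (∀ z : ℂ, 1 ≤ ‖z‖ → ‖z‖ ≤ ρ → z ∉ ball (1 : ℂ) η → κ ≤ ‖1 - genFun p z‖) ∧
      ∀ z : ℂ, ‖z‖ = ρ → κ ≤ ‖1 - genFun p z‖ := by
  set V : Set ℂ := ({0}ᶜ ∩ genFun p ⁻¹' {1}ᶜ) ∪ ball 1 η with hV
  have hVo : IsOpen V := by
    refine IsOpen.union ?_ isOpen_ball
    refine ContinuousOn.isOpen_inter_preimage (fun z hz => ?_) isOpen_compl_singleton
      isOpen_compl_singleton
    exact (hp.differentiableAt_genFun hz).continuousAt.continuousWithinAt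
  have hsub : sphere (0 : ℂ) 1 ⊆ V := by
    intro z hz
    have hz1 : ‖z‖ = 1 := by simpa using hz
    rcases eq_or_ne z 1 with rfl | h
    · exact Or.inr (mem_ball_self hη)
    · refine Or.inl ⟨ne_zero_of_mem_sphere one_pos hz, fun h2 => ?_⟩
      have h3 := hp.norm_genFun_lt_one hz1 h
      rw [mem_singleton_iff.1 h2] at h3
      simp at h3
  obtain ⟨τ, hτ, hτV⟩ := (isCompact_sphere (0 : ℂ) 1).exists_cthickening_subset_open hVo hsub
  set A : Set ℂ := closedBall 0 (1 + τ) \ ball 0 1 with hA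
  have hAmem : ∀ z : ℂ, 1 ≤ ‖z‖ → ‖z‖ ≤ 1 + τ → z ∈ A := fun z h1 h2 =>
    ⟨by simpa using h2, by simpa using h1⟩
  have hAn : ∀ z ∈ A, 1 ≤ ‖z‖ ∧ ‖z‖ ≤ 1 + τ := fun z hz => by
    have h1 := hz.1; have h2 := hz.2
    simp only [mem_closedBall, mem_ball, dist_zero_right, not_lt] at h1 h2
    exact ⟨h2, h1⟩
  have hA0 : ∀ z ∈ A, z ≠ 0 := fun z hz => norm_pos_iff.1 (by linarith [(hAn z hz).1])
  have hAV : A ⊆ V := by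
    intro z hz
    obtain ⟨h1, h2⟩ := hAn z hz
    have hz0 : (‖z‖ : ℂ) ≠ 0 := by rw [Complex.ofReal_ne_zero]; linarith
    refine hτV (mem_cthickening_of_dist_le z (z / ‖z‖) τ _ (by simp [hA0 z hz]) ?_)
    rw [dist_eq_norm]
    have : z - z / ‖z‖ = ((‖z‖ - 1 : ℝ) : ℂ) * (z / ‖z‖) := by push_cast; field_simp
    rw [this, norm_mul, Complex.norm_real, Real.norm_of_nonneg (by linarith), norm_div,
      Complex.norm_real, norm_norm, div_self (by linarith)]
    linarith
  have hAc : IsCompact A := (isCompact_closedBall (0 : ℂ) (1 + τ)).diff isOpen_ball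
  have hφA : ContinuousOn (genFun p) A := fun z hz =>
    (hp.differentiableAt_genFun (hA0 z hz)).continuousAt.continuousWithinAt
  obtain ⟨B, hB⟩ := hAc.exists_bound_of_continuousOn hφA
  have hone : ∀ z ∈ A, genFun p z = 1 → z = 1 := by
    intro z hz h
    rcases hAV hz with h1 | h1
    · exact absurd h h1.2
    · exact hη1 z h1 h
  have hcn : ∀ K ⊆ A, (1 : ℂ) ∉ K → IsCompact K → ∃ κ : ℝ, 0 < κ ∧
      ∀ z ∈ K, κ ≤ ‖1 - genFun p z‖ := by
    intro K hK h1 hKc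
    refine hKc.exists_forall_le' (continuousOn_const.sub (hφA.mono hK)).norm fun z hz => ?_
    rw [norm_pos_iff]
    refine sub_ne_zero.2 ?_
    exact fun h => h1 (hone z (hK hz) h.symm ▸ hz)
  obtain ⟨κ₁, hκ₁, hκ₁'⟩ := hcn (A \ ball 1 η) sdiff_subset
    (fun h => h.2 (mem_ball_self hη)) (hAc.diff isOpen_ball)
  obtain ⟨κ₂, hκ₂, hκ₂'⟩ := hcn (sphere 0 (1 + τ))
    (fun z hz => by
      have : ‖z‖ = 1 + τ := by simpa using hz
      exact hAmem z (by linarith) this.le)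
    (by simp; linarith) (isCompact_sphere _ _)
  refine ⟨1 + τ, min κ₁ κ₂, |B| + 1, by linarith, lt_min hκ₁ hκ₂, by positivity,
    fun z h1 h2 => ?_, fun z h1 h2 h3 => ?_, fun z h1 => ?_⟩
  · have := hB z (hAmem z h1 h2)
    have := le_abs_self B
    linarith
  · exact (min_le_left _ _).trans (hκ₁' z ⟨hAmem z h1 h2, h3⟩)
  · exact (min_le_right _ _).trans (hκ₂' z (by simpa using h1))

end CenteredLaw

/-! ### The logarithmic coefficients near the singular point -/

namespace CenteredLaw
variable {p : ℤ → ℝ}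

/-- Moving the contour from the unit circle to the circle of radius `ρ` picks up the residue at
the root `ζ = Z(ε)`; by the equation `(1 - ε²) φ(Z(ε)) = 1` that residue is `Z'(ε) ζ ^ (-j - 1)`. -/
lemma two_mul_resolventCoeff_one (hp : CenteredLaw p) {Z : ℂ → ℂ} {ε₀ ρ : ℝ}
    (hZd : DifferentiableOn ℂ Z (ball 0 ε₀))
    (hZφ : ∀ ε ∈ ball (0 : ℂ) ε₀, (1 - ε ^ 2) * genFun p (Z ε) = 1)
    {ε : ℂ} (hε : ε ∈ ball (0 : ℂ) ε₀) (hε0 : ε ≠ 0) (h1 : 1 < ‖Z ε‖) (hρ : ‖Z ε‖ < ρ)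
    (huniq : ∀ z, 1 ≤ ‖z‖ → ‖z‖ ≤ ρ → (1 - ε ^ 2) * genFun p z = 1 → z = Z ε) (j : ℕ) :
    2 * ε * resolventCoeff p 1 j (1 - ε ^ 2) =
      2 * ε * resolventCoeff p ρ j (1 - ε ^ 2) + deriv Z ε * (Z ε)⁻¹ ^ (j + 1) := by
  have hζ0 : Z ε ≠ 0 := norm_pos_iff.1 (by linarith)
  have hφd : DifferentiableAt ℂ (genFun p) (Z ε) := hp.differentiableAt_genFun hζ0
  have hmem := isOpen_ball.mem_nhds hε
  have hder : -(2 * ε) * genFun p (Z ε) +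
      (1 - ε ^ 2) * (deriv (genFun p) (Z ε) * deriv Z ε) = 0 := by
    have e1 : HasDerivAt (fun ε : ℂ => 1 - ε ^ 2) (-(2 * ε)) ε := by
      simpa using (hasDerivAt_pow 2 ε).const_sub 1
    have e2 := e1.mul (hφd.hasDerivAt.comp ε (hZd.differentiableAt hmem).hasDerivAt)
    have e3 : (fun ε : ℂ => 1 - ε ^ 2) * (genFun p ∘ Z) =ᶠ[𝓝 ε] fun _ => 1 := by
      filter_upwards [hmem] with w hw
      simpa using hZφ w hw
    have e4 := e3.deriv_eq
    rw [e2.deriv, deriv_const] at e4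
    exact e4
  have hs := hZφ ε hε
  have hφ0 : genFun p (Z ε) ≠ 0 := fun h => by simp [h] at hs
  have hs0 : (1 - ε ^ 2) ≠ 0 := fun h => by simp [h] at hs
  have hφ'0 : deriv (genFun p) (Z ε) ≠ 0 := fun h => by
    rw [h] at hder
    simp [hε0, hφ0] at hder
  have hDd : ∀ z ≠ 0, DifferentiableAt ℂ (fun z => 1 - (1 - ε ^ 2) * genFun p z) z := fun z hz =>
    ((hp.differentiableAt_genFun hz).const_mul _).const_sub _
  have hD' : deriv (fun z => 1 - (1 - ε ^ 2) * genFun p z) (Z ε) =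
      -((1 - ε ^ 2) * deriv (genFun p) (Z ε)) := by
    rw [deriv_const_sub, deriv_const_mul _ hφd]
  have hres := circleAverage_div_sub_eq_residue (N := fun z => z ^ (-(j : ℤ)) * genFun p z)
    (D := fun z => 1 - (1 - ε ^ 2) * genFun p z) one_pos
    (fun z hz => (differentiableAt_zpow.2 (Or.inl hz)).mul (hp.differentiableAt_genFun hz)) hDd
    h1 hρ (by simp [hs]) (by rw [hD']; exact neg_ne_zero.2 (mul_ne_zero hs0 hφ'0))
    (fun z e1 e2 e3 => huniq z e1 e2 (sub_eq_zero.1 e3).symm)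
  rw [hD'] at hres
  have hres' : resolventCoeff p ρ j (1 - ε ^ 2) - resolventCoeff p 1 j (1 - ε ^ 2) =
    Z ε ^ (-(j : ℤ)) * genFun p (Z ε) /
      (Z ε * -((1 - ε ^ 2) * deriv (genFun p) (Z ε))) := hres
  have e5 : 2 * ε * (Z ε ^ (-(j : ℤ)) * genFun p (Z ε) /
      (Z ε * -((1 - ε ^ 2) * deriv (genFun p) (Z ε)))) =
      -(deriv Z ε * (Z ε)⁻¹ ^ (j + 1)) := by
    have e6 : 2 * ε * genFun p (Z ε) =
      (1 - ε ^ 2) * (deriv (genFun p) (Z ε) * deriv Z ε) := by linear_combination -hder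
    rw [zpow_neg, zpow_natCast, inv_pow, pow_succ]
    field_simp
    rw [e6]
    ring
  rw [← hres'] at e5
  linear_combination -e5

/-- A common setting for the local analysis: for `ε` in a small disk and `s = 1 - ε²`, the function
`1 - s φ` stays away from `0` on the circle of radius `ρ > 1`, and for real `ε > 0` the root `Z ε` is the only one in the
annulus `1 ≤ |z| ≤ ρ`, so that the contour can be moved from the unit circle to the outer one. -/
lemma exists_root_annulus (hp : CenteredLaw p) :
    ∃ (Z : ℂ → ℂ) (ε₀ ρ κ B M : ℝ), 0 < ε₀ ∧ ε₀ < 1 ∧ 1 < ρ ∧ 0 < κ ∧ 0 ≤ M ∧ Z 0 = 1 ∧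
      HasDerivAt Z ((√2 / √(secondMoment p) : ℝ) : ℂ) 0 ∧
      DifferentiableOn ℂ Z (ball 0 ε₀) ∧
      (∀ z : ℂ, ‖z‖ = ρ → ‖genFun p z‖ ≤ B) ∧
      (∀ ε ∈ ball (0 : ℂ) ε₀, ‖ε ^ 2‖ * B < κ ∧ 1 / 2 ≤ ‖Z ε‖ ∧ ‖deriv Z ε‖ ≤ M) ∧
      (∀ s : ℂ, ‖1 - s‖ * B < κ → ∀ z : ℂ, ‖z‖ = ρ → κ ≤ ‖1 - s * genFun p z‖) ∧
      ∀ t : ℝ, 0 < t → t < ε₀ → ∀ j : ℕ, 2 * (t : ℂ) * resolventCoeff p 1 j (1 - (t : ℂ) ^ 2) =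
        2 * t * resolventCoeff p ρ j (1 - (t : ℂ) ^ 2) + deriv Z t * (Z t)⁻¹ ^ (j + 1) := by
  obtain ⟨Z, ε₁, η, hε₁, hη, hη2, hZ0, hZd, hZ', hZφ, hZu⟩ := hp.exists_local_root
  obtain ⟨ρ, κ, B, hρ, hκ, hB, hB1, hκ1, hκ2⟩ := hp.exists_annulus hη fun z hz h => by
    have := hZu 0 (mem_ball_self hε₁) z hz (by simp [h])
    simpa [hZ0] using this
  set c : ℝ := √2 / √(secondMoment p) with hc
  have hc0 : 0 < c := by
    have := Real.sqrt_pos.2 hp.secondMoment_pos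
    positivity
  have ev1 : ∀ᶠ ε in 𝓝 (0 : ℂ), ‖Z ε - 1 - ε * c‖ ≤ c / 2 * ‖ε‖ := by
    have := (hasDerivAt_iff_isLittleO.1 hZ').def (half_pos hc0)
    simpa [hZ0] using this
  have ev2 : ∀ᶠ ε in 𝓝 (0 : ℂ), ‖deriv Z ε‖ < c + 1 := by
    have h1 : ContinuousAt (deriv Z) 0 :=
      ((hZd.deriv isOpen_ball).differentiableAt (ball_mem_nhds _ hε₁)).continuousAt
    refine h1.norm.eventually_lt continuousAt_const ?_
    rw [hZ'.deriv, Complex.norm_real, Real.norm_of_nonneg hc0.le]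
    linarith
  have ev3 : ∀ᶠ ε in 𝓝 (0 : ℂ), ‖Z ε‖ < ρ := by
    refine hZ'.continuousAt.norm.eventually_lt continuousAt_const ?_
    rw [hZ0, norm_one]; exact hρ
  have ev4 : ∀ᶠ ε in 𝓝 (0 : ℂ), ‖ε ^ 2‖ * B < κ / 2 := by
    refine ContinuousAt.eventually_lt (by fun_prop) continuousAt_const ?_
    simpa using half_pos hκ
  have ev5 : ∀ᶠ ε in 𝓝 (0 : ℂ), ‖ε‖ * c < 1 := by
    refine ContinuousAt.eventually_lt (by fun_prop) continuousAt_const ?_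
    simp
  obtain ⟨ε₂, hε₂, hall⟩ := Metric.eventually_nhds_iff_ball.1
    (ev1.and (ev2.and (ev3.and (ev4.and (ev5.and (ball_mem_nhds (0 : ℂ) hε₁))))))
  set ε₀ := min ε₂ (1 / 2) with hε₀
  have hε₀0 : 0 < ε₀ := lt_min hε₂ (by norm_num)
  have hall' : ∀ ε ∈ ball (0 : ℂ) ε₀, _ := fun ε hε => hall ε (ball_subset_ball (min_le_left _ _) hε)
  have hsub : ball (0 : ℂ) ε₀ ⊆ ball 0 ε₁ := fun ε hε => (hall' ε hε).2.2.2.2.2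
  refine ⟨Z, ε₀, ρ, κ / 2, B, c + 1, hε₀0, (min_le_right _ _).trans_lt (by norm_num), hρ,
    half_pos hκ, by positivity, hZ0, hZ', hZd.mono hsub,
    fun z hz => hB1 z (by linarith) hz.le, fun ε hε => ?_, fun s hs z hz => ?_,
    fun t ht0 ht1 j => ?_⟩
  · obtain ⟨-, e2, -, e4, -, e6⟩ := hall' ε hε
    refine ⟨e4, ?_, e2.le⟩
    have e7 := (hZφ ε e6).1
    rw [mem_ball, dist_eq_norm, norm_sub_rev] at e7
    have := norm_sub_norm_le 1 (Z ε)
    rw [norm_one] at this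
    linarith
  · have e1 := hκ2 z hz
    have e2 := hB1 z (by linarith) hz.le
    have e3 : 1 - genFun p z = (1 - s * genFun p z) - (1 - s) * genFun p z := by ring
    have e4 := norm_sub_le (1 - s * genFun p z) ((1 - s) * genFun p z)
    rw [← e3, norm_mul] at e4
    have e5 : ‖1 - s‖ * ‖genFun p z‖ ≤ ‖1 - s‖ * B := by gcongr
    linarith
  · have htn : ‖(t : ℂ)‖ = t := by rw [Complex.norm_real, Real.norm_of_nonneg ht0.le]
    have htm : (t : ℂ) ∈ ball (0 : ℂ) ε₀ := by simpa [htn, abs_of_pos ht0] using ht1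
    have htm' : -(t : ℂ) ∈ ball (0 : ℂ) ε₀ := by simpa [htn, abs_of_pos ht0] using ht1
    obtain ⟨a1, a2, a3, a4, a5, a6⟩ := hall' _ htm
    obtain ⟨b1, -, -, -, -, b6⟩ := hall' _ htm'
    rw [htn] at a1 a5
    rw [norm_neg, htn] at b1
    -- as `Z` has a positive derivative at `0`, the two roots are on either side of the unit circle
    have hgt : 1 < ‖Z t‖ := by
      have e1 : ‖1 + (t : ℂ) * c‖ = 1 + t * c := by
        rw [← Complex.ofReal_mul, ← Complex.ofReal_one, ← Complex.ofReal_add, Complex.norm_real,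
          Real.norm_of_nonneg (by positivity)]
      have e2 := norm_sub_norm_le (1 + (t : ℂ) * c) (Z t)
      rw [e1, norm_sub_rev, ← sub_sub] at e2
      nlinarith [mul_pos hc0 ht0]
    have hlt : ‖Z (-t)‖ < 1 := by
      have e1 : ‖1 + -(t : ℂ) * c‖ = 1 - t * c := by
        rw [← Complex.ofReal_neg, ← Complex.ofReal_mul, ← Complex.ofReal_one, ← Complex.ofReal_add,
          Complex.norm_real, Real.norm_of_nonneg (by linarith)]
        ring
      have e2 := norm_sub_norm_le (Z (-t)) (1 + -(t : ℂ) * c)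
      rw [e1, ← sub_sub] at e2
      nlinarith [mul_pos hc0 ht0]
    refine hp.two_mul_resolventCoeff_one (hZd.mono hsub) (fun ε hε => (hZφ ε (hsub hε)).2) htm
      (by simpa using ht0.ne') hgt a3 (fun z h1 h2 h3 => ?_) j
    by_cases hz : z ∈ ball (1 : ℂ) η
    · rcases hZu _ a6 z hz h3 with h | h
      · exact h
      · rw [h] at h1; linarith
    · exfalso
      have e1 := hκ1 z h1 h2 hz
      have e2 : 1 - genFun p z = -((t : ℂ) ^ 2 * genFun p z) := by linear_combination -h3
      rw [e2, norm_neg, norm_mul] at e1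
      have e3 := hB1 z h1 h2
      have e4 : ‖(t : ℂ) ^ 2‖ * ‖genFun p z‖ ≤ ‖(t : ℂ) ^ 2‖ * B := by gcongr
      linarith

/-- The logarithmic coefficients `ℓ_j(s)`, `j ≥ 0`, are near `s = 1` holomorphic functions of
`ε = √(1 - s)`, all with the derivative `√2 / σ` at `ε = 0`. The right-hand side of `two_mul_resolventCoeff_one` is
`dℓ_j / dε` for small real `ε > 0` and is holomorphic near `0`; the extension is its primitive. At
`ε = 0` only the residue `Z'(0) Z(0) ^ (-j - 1) = √2 / σ` is left. -/
lemma exists_local_logCoeff (hp : CenteredLaw p) :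
    ∃ (ε₀ M : ℝ) (Λ : ℕ → ℂ → ℂ), 0 < ε₀ ∧ ε₀ < 1 ∧ 0 ≤ M ∧
      (∀ j, DifferentiableOn ℂ (Λ j) (ball 0 ε₀)) ∧
      (∀ j, ∀ ε ∈ ball (0 : ℂ) ε₀, ‖Λ j ε‖ ≤ M * 2 ^ j) ∧
      (∀ j, HasDerivAt (Λ j) ((√2 / √(secondMoment p) : ℝ) : ℂ) 0) ∧
      ∀ (j : ℕ) (t : ℝ), 0 < t → t < ε₀ → Λ j t = logCoeff p j (1 - (t : ℂ) ^ 2) := by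
  obtain ⟨Z, ε₀, ρ, κ, B, M₁, hε₀, hε₀1, hρ, hκ, hM₁, hZ0, hZ', hZd, hB, hZb, hκs, hres⟩ :=
    hp.exists_root_annulus
  set N : ℕ → ℂ → ℂ := fun j ε =>
    2 * ε * resolventCoeff p ρ j (1 - ε ^ 2) + deriv Z ε * (Z ε)⁻¹ ^ (j + 1) with hN
  set U : Set ℂ := {s | ‖1 - s‖ * B < κ} with hU
  have hUo : IsOpen U := isOpen_lt (by fun_prop) continuous_const
  have hmap : ∀ ε ∈ ball (0 : ℂ) ε₀, 1 - ε ^ 2 ∈ U := fun ε hε => by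
    have := (hZb ε hε).1
    simpa [hU] using this
  have hZne : ∀ ε ∈ ball (0 : ℂ) ε₀, Z ε ≠ 0 := fun ε hε => norm_pos_iff.1
    (by linarith [(hZb ε hε).2.1])
  have hNd : ∀ j, DifferentiableOn ℂ (N j) (ball 0 ε₀) := fun j => by
    have h1 : DifferentiableOn ℂ (resolventCoeff p ρ j) U :=
      hp.differentiableOn_resolventCoeff hρ.le hκ hUo (fun s hs z hz => hκs s hs z hz) j
    refine ((differentiableOn_id.const_mul 2).mul (h1.comp (by fun_prop) hmap)).add
      ((hZd.deriv isOpen_ball).mul ((hZd.inv hZne).pow _))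
  set M₂ : ℝ := 2 * (|B| / κ) + 2 * M₁ with hM₂
  have hM₂0 : 0 ≤ M₂ := by positivity
  have hNb : ∀ j, ∀ ε ∈ ball (0 : ℂ) ε₀, ‖N j ε‖ ≤ M₂ * 2 ^ j := by
    intro j ε hε
    obtain ⟨b1, b2, b3⟩ := hZb ε hε
    have hε1 : ‖ε‖ ≤ 1 := by
      have : ‖ε‖ < ε₀ := by simpa using hε
      linarith
    have e1 : ‖resolventCoeff p ρ j (1 - ε ^ 2)‖ ≤ |B| / κ :=
      norm_resolventCoeff_le hρ.le hκ (fun z hz => (hB z hz).trans (le_abs_self B))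
        (fun z hz => hκs _ (hmap ε hε) z hz) j
    have e2 : ‖(Z ε)⁻¹‖ ≤ 2 := by
      rw [norm_inv]
      calc ‖Z ε‖⁻¹ ≤ (1 / 2 : ℝ)⁻¹ := by gcongr
        _ = 2 := by norm_num
    have e3 : (1 : ℝ) ≤ 2 ^ j := one_le_pow₀ (by norm_num)
    calc ‖N j ε‖ ≤ 2 * ‖ε‖ * ‖resolventCoeff p ρ j (1 - ε ^ 2)‖ +
          ‖deriv Z ε‖ * ‖(Z ε)⁻¹‖ ^ (j + 1) := by
          refine (norm_add_le _ _).trans (le_of_eq ?_)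
          rw [norm_mul, norm_mul, norm_mul, norm_pow]; simp
      _ ≤ 2 * 1 * (|B| / κ) + M₁ * 2 ^ (j + 1) := by gcongr
      _ ≤ 2 * (|B| / κ) * 2 ^ j + M₁ * 2 ^ (j + 1) := by
          have : 0 ≤ 2 * (|B| / κ) := by positivity
          nlinarith
      _ = M₂ * 2 ^ j := by rw [hM₂, pow_succ]; ring
  -- the value of the primitive `F j` is adjusted at the point `t₁` of the real interval
  choose F hF using fun j => (hNd j).isExactOn_ball
  set t₁ : ℝ := ε₀ / 2 with ht₁
  have ht₁0 : 0 < t₁ := half_pos hε₀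
  have hreal : ∀ t : ℝ, 0 < t → t < ε₀ → (t : ℂ) ∈ ball (0 : ℂ) ε₀ := fun t h1 h2 => by
    simpa [abs_of_pos h1] using h2
  have hsq : ∀ t : ℝ, 0 < t → t < ε₀ → ‖(1 - (t : ℂ) ^ 2)‖ < 1 := fun t h1 h2 => by
    have : (1 - (t : ℂ) ^ 2) = ((1 - t ^ 2 : ℝ) : ℂ) := by push_cast; rfl
    rw [this, Complex.norm_real, Real.norm_of_nonneg (by nlinarith)]
    nlinarith
  have ht₁m : (t₁ : ℂ) ∈ ball (0 : ℂ) ε₀ := hreal t₁ ht₁0 (by linarith)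
  obtain ⟨C, hC0, hC⟩ := hp.exists_norm_logCoeff_le (hsq t₁ ht₁0 (by linarith))
  refine ⟨ε₀, C + M₂ * 2, fun j ε => F j ε - F j t₁ + logCoeff p j (1 - (t₁ : ℂ) ^ 2), hε₀, hε₀1,
    by positivity, fun j ε hε => ?_, fun j ε hε => ?_, fun j => ?_, fun j t ht0 ht1 => ?_⟩
  · exact (((hF j ε hε).sub_const _).add_const _).differentiableAt.differentiableWithinAt
  · have e1 : ‖F j ε - F j t₁‖ ≤ M₂ * 2 ^ j * ‖ε - t₁‖ :=
      (convex_ball (0 : ℂ) ε₀).norm_image_sub_le_of_norm_hasDerivWithin_le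
        (fun w hw => (hF j w hw).hasDerivWithinAt) (fun w hw => hNb j w hw) ht₁m hε
    have e2 : ‖ε - t₁‖ ≤ 2 := by
      have h1 : ‖ε‖ < ε₀ := by simpa using hε
      have h2 : ‖(t₁ : ℂ)‖ < ε₀ := by simpa only [mem_ball, dist_zero_right] using ht₁m
      linarith [norm_sub_le ε (t₁ : ℂ)]
    have e3 : (1 : ℝ) ≤ 2 ^ j := one_le_pow₀ (by norm_num)
    calc ‖F j ε - F j t₁ + logCoeff p j (1 - (t₁ : ℂ) ^ 2)‖ ≤ M₂ * 2 ^ j * 2 + C := by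
          refine (norm_add_le _ _).trans (add_le_add (e1.trans ?_) (hC j))
          gcongr
      _ ≤ M₂ * 2 ^ j * 2 + C * 2 ^ j := by nlinarith
      _ = (C + M₂ * 2) * 2 ^ j := by ring
  · have := ((hF j 0 (mem_ball_self hε₀)).sub_const (F j t₁)).add_const
      (logCoeff p j (1 - (t₁ : ℂ) ^ 2))
    have h2 : N j 0 = ((√2 / √(secondMoment p) : ℝ) : ℂ) := by
      simp [hN, hZ0, hZ'.deriv]
    rw [h2] at this
    exact this
  · set r : ℝ → ℂ := fun t => F j t - logCoeff p j (1 - (t : ℂ) ^ 2) with hr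
    have hder : ∀ u ∈ Ioo (0 : ℝ) ε₀, HasDerivAt r 0 u := by
      intro u hu
      have a1 : HasDerivAt (F j) (N j u) (u : ℂ) := hF j u (hreal u hu.1 hu.2)
      have a2 := hp.hasDerivAt_logCoeff_of_norm_lt_one j (hsq u hu.1 hu.2)
      have a3 : HasDerivAt (fun ε : ℂ => 1 - ε ^ 2) (-(2 * (u : ℂ))) (u : ℂ) := by
        simpa using (hasDerivAt_pow 2 (u : ℂ)).const_sub 1
      have a4 : HasDerivAt (fun ε : ℂ => logCoeff p j (1 - ε ^ 2))
          (-resolventCoeff p 1 j (1 - (u : ℂ) ^ 2) * -(2 * u)) (u : ℂ) :=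
        HasDerivAt.comp (u : ℂ) (h₂ := logCoeff p j) (h := fun ε : ℂ => 1 - ε ^ 2) a2 a3
      have a5 := (a1.sub a4).comp_ofReal
      refine a5.congr_deriv ?_
      simp only [hN]
      rw [← hres u hu.1 hu.2 j]
      ring
    have hconst := isOpen_Ioo.is_const_of_deriv_eq_zero isPreconnected_Ioo
      (f := r) (fun u hu => (hder u hu).differentiableAt.differentiableWithinAt)
      (fun u hu => (hder u hu).deriv) ⟨ht0, ht1⟩ (⟨ht₁0, by linarith⟩ : t₁ ∈ Ioo 0 ε₀)
    simp only [hr] at hconst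
    linear_combination hconst

end CenteredLaw

/-! ### Coefficients of the exponential of a power series -/

/-- The Taylor coefficients of `exp (-∑_{j ≥ 1} ℓ j z ^ j)`, defined by the recursion
`n E n = -∑_{j = 1}^n j ℓ j E (n - j)` that comes from the logarithmic derivative. -/
noncomputable def expCoeff (ℓ : ℕ → ℂ) : ℕ → ℂ
  | 0 => 1
  | n + 1 => -(∑ j : Fin (n + 1), ((j : ℂ) + 1) * ℓ (j + 1) * expCoeff ℓ (n - j)) / (n + 1)

lemma expCoeff_zero (ℓ : ℕ → ℂ) : expCoeff ℓ 0 = 1 := by rw [expCoeff]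

lemma expCoeff_succ (ℓ : ℕ → ℂ) (n : ℕ) : expCoeff ℓ (n + 1) =
    -(∑ j ∈ Finset.range (n + 1), ((j : ℂ) + 1) * ℓ (j + 1) * expCoeff ℓ (n - j)) / (n + 1) := by
  rw [expCoeff, Finset.sum_range]

lemma succ_mul_expCoeff_succ (ℓ : ℕ → ℂ) (n : ℕ) : ((n : ℂ) + 1) * expCoeff ℓ (n + 1) =
    -∑ j ∈ Finset.range (n + 1), ((j : ℂ) + 1) * ℓ (j + 1) * expCoeff ℓ (n - j) := by
  have : (n : ℂ) + 1 ≠ 0 := Nat.cast_add_one_ne_zero n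
  rw [expCoeff_succ]
  field_simp

/-- A sequence satisfying the recursion of `expCoeff` is a multiple of it. -/
lemma eq_mul_expCoeff {ℓ G : ℕ → ℂ} (h : ∀ n : ℕ, ((n : ℂ) + 1) * G (n + 1) =
    -∑ j ∈ Finset.range (n + 1), ((j : ℂ) + 1) * ℓ (j + 1) * G (n - j)) (n : ℕ) :
    G n = G 0 * expCoeff ℓ n := by
  induction n using Nat.strong_induction_on with
  | _ n ih =>
    cases n with
    | zero => rw [expCoeff_zero, mul_one]
    | succ n =>
      have hn : (n : ℂ) + 1 ≠ 0 := Nat.cast_add_one_ne_zero n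
      have h1 := succ_mul_expCoeff_succ ℓ n
      apply mul_left_cancel₀ hn
      rw [h, mul_left_comm, h1, mul_neg, Finset.mul_sum]
      congr 1
      refine Finset.sum_congr rfl fun j _ => ?_
      rw [ih (n - j) (by omega)]
      ring

lemma expCoeff_congr {ℓ ℓ' : ℕ → ℂ} (h : ∀ j, ℓ (j + 1) = ℓ' (j + 1)) (n : ℕ) :
    expCoeff ℓ n = expCoeff ℓ' n := by
  have := eq_mul_expCoeff (ℓ := ℓ') (G := expCoeff ℓ) (fun n => by
    rw [succ_mul_expCoeff_succ]
    simp only [h]) n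
  rw [this, expCoeff_zero, one_mul]

lemma norm_expCoeff_le {ℓ : ℕ → ℂ} {M : ℝ} (hM : 0 ≤ M) (h : ∀ j, ‖ℓ j‖ ≤ M * 2 ^ j) (n : ℕ) :
    ‖expCoeff ℓ n‖ ≤ (2 * (1 + M)) ^ n := by
  set R : ℝ := 2 * (1 + M) with hR
  have hgeom : ∀ n : ℕ, ∑ j ∈ Finset.range (n + 1), M * 2 ^ (j + 1) * R ^ (n - j) =
      R ^ (n + 1) - 2 ^ (n + 1) := by
    intro n
    induction n with
    | zero => simp [hR]; ring
    | succ n ih =>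
      rw [Finset.sum_range_succ]
      have : ∑ j ∈ Finset.range (n + 1), M * 2 ^ (j + 1) * R ^ (n + 1 - j) =
          R * ∑ j ∈ Finset.range (n + 1), M * 2 ^ (j + 1) * R ^ (n - j) := by
        rw [Finset.mul_sum]
        refine Finset.sum_congr rfl fun j hj => ?_
        have : n + 1 - j = (n - j) + 1 := by
          have := Finset.mem_range.1 hj
          omega
        rw [this, pow_succ]
        ring
      rw [this, ih, Nat.sub_self, hR]
      ring
  induction n using Nat.strong_induction_on with
  | _ n ih =>
    cases n with
    | zero => simp [expCoeff_zero]
    | succ n =>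
      have hn : (0 : ℝ) < (n : ℝ) + 1 := by positivity
      have h1 : ((n : ℝ) + 1) * ‖expCoeff ℓ (n + 1)‖ ≤ ((n : ℝ) + 1) * R ^ (n + 1) := by
        calc ((n : ℝ) + 1) * ‖expCoeff ℓ (n + 1)‖ = ‖((n : ℂ) + 1) * expCoeff ℓ (n + 1)‖ := by
              rw [norm_mul]
              congr 1
              exact_mod_cast (Complex.norm_natCast (n + 1)).symm
          _ ≤ ∑ j ∈ Finset.range (n + 1), ((n : ℝ) + 1) * (M * 2 ^ (j + 1) * R ^ (n - j)) := by
              rw [succ_mul_expCoeff_succ, norm_neg]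
              refine norm_sum_le_of_le _ fun j hj => ?_
              have hjn := Finset.mem_range.1 hj
              have e1 : ‖(j : ℂ) + 1‖ ≤ (n : ℝ) + 1 := by
                have : ‖(j : ℂ) + 1‖ = (j : ℝ) + 1 := by
                  exact_mod_cast Complex.norm_natCast (j + 1)
                rw [this]
                have : (j : ℝ) ≤ n := by exact_mod_cast Nat.lt_succ_iff.1 hjn
                linarith
              rw [norm_mul, norm_mul, mul_assoc]
              gcongr
              · exact h (j + 1)
              · exact ih (n - j) (by omega)
          _ = ((n : ℝ) + 1) * (R ^ (n + 1) - 2 ^ (n + 1)) := by rw [← Finset.mul_sum, hgeom]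
          _ ≤ _ := by
              have : (0 : ℝ) < 2 ^ (n + 1) := by positivity
              gcongr
              linarith
      exact le_of_mul_le_mul_left h1 hn

lemma differentiableOn_expCoeff {L : ℕ → ℂ → ℂ} {U : Set ℂ}
    (h : ∀ j, DifferentiableOn ℂ (L j) U) (n : ℕ) :
    DifferentiableOn ℂ (fun x => expCoeff (fun j => L j x) n) U := by
  induction n using Nat.strong_induction_on with
  | _ n ih =>
    cases n with
    | zero => simp only [expCoeff_zero]; exact differentiableOn_const _
    | succ n =>
      simp only [expCoeff_succ]
      refine DifferentiableOn.div_const (DifferentiableOn.neg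
        (DifferentiableOn.fun_sum fun j _ => ?_)) _
      exact ((h (j + 1)).const_mul _).mul (ih (n - j) (by omega))

/-- If all the `ℓ j` move with the same velocity `c`, then `exp (-∑_{j ≥ 1} ℓ j z ^ j)` is
multiplied, to first order, by `1 - c z / (1 - z)`. -/
lemma hasDerivAt_expCoeff {L : ℕ → ℂ → ℂ} {x c : ℂ} (h : ∀ j, HasDerivAt (L j) c x) (n : ℕ) :
    HasDerivAt (fun x => expCoeff (fun j => L j x) n)
      (-c * ∑ i ∈ Finset.range n, expCoeff (fun j => L j x) i) x := by
  set E := expCoeff (fun j => L j x) with hE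
  -- the recursion for `E`, summed over the indices up to `n`
  have hconv : ∀ n : ℕ, ∑ j ∈ Finset.range (n + 1), ((j : ℂ) + 1) * L (j + 1) x *
      ∑ i ∈ Finset.range (n - j), E i = -∑ i ∈ Finset.range (n + 1), (i : ℂ) * E i := by
    intro n
    induction n with
    | zero => simp
    | succ n ih =>
      rw [Finset.sum_range_succ, Nat.sub_self, Finset.range_zero, Finset.sum_empty, mul_zero,
        add_zero, Finset.sum_range_succ _ (n + 1), neg_add, ← ih]
      have h1 := succ_mul_expCoeff_succ (fun j => L j x) n
      push_cast
      rw [← hE] at h1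
      rw [h1, neg_neg, ← Finset.sum_add_distrib]
      refine Finset.sum_congr rfl fun j hj => ?_
      have : n + 1 - j = (n - j) + 1 := by
        have := Finset.mem_range.1 hj
        omega
      rw [this, Finset.sum_range_succ]
      ring
  induction n using Nat.strong_induction_on with
  | _ n ih =>
    cases n with
    | zero =>
      simp only [expCoeff_zero, Finset.range_zero, Finset.sum_empty, mul_zero]
      exact hasDerivAt_const _ _
    | succ n =>
      have hn : (n : ℂ) + 1 ≠ 0 := Nat.cast_add_one_ne_zero n
      simp only [expCoeff_succ]
      have h1 := ((HasDerivAt.fun_sum (u := Finset.range (n + 1)) fun j _ =>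
        (((h (j + 1)).const_mul ((j : ℂ) + 1)).mul (ih (n - j) (by omega)))).neg).div_const
          ((n : ℂ) + 1)
      refine h1.congr_deriv ?_
      rw [← hE, div_eq_iff hn, Finset.sum_add_distrib]
      have h2 : ∑ j ∈ Finset.range (n + 1), ((j : ℂ) + 1) * L (j + 1) x *
          (-c * ∑ i ∈ Finset.range (n - j), E i) =
          c * ∑ i ∈ Finset.range (n + 1), (i : ℂ) * E i := by
        have := hconv n
        rw [show c * ∑ i ∈ Finset.range (n + 1), (i : ℂ) * E i =
          -c * -∑ i ∈ Finset.range (n + 1), (i : ℂ) * E i by ring, ← this, Finset.mul_sum]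
        refine Finset.sum_congr rfl fun j _ => ?_
        ring
      have h3 : ∑ j ∈ Finset.range (n + 1), ((j : ℂ) + 1) * c * E (n - j) =
          c * ∑ i ∈ Finset.range (n + 1), ((n : ℂ) + 1 - i) * E i := by
        rw [Finset.mul_sum, ← Finset.sum_range_reflect]
        refine Finset.sum_congr rfl fun j hj => ?_
        have hj' : j ≤ n := Nat.lt_succ_iff.1 (Finset.mem_range.1 hj)
        have e1 : n + 1 - 1 - j = n - j := by omega
        have e2 : n - (n - j) = j := by omega
        rw [e1, e2, Nat.cast_sub hj']
        ring
      rw [h2, h3, ← mul_add, ← Finset.sum_add_distrib, mul_assoc, Finset.sum_mul, neg_mul]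
      congr 2
      refine Finset.sum_congr rfl fun i _ => ?_
      ring

/-- Uniqueness of the coefficients of a power series, from its values on a circle. -/
lemma eq_of_tsum_eq_on_sphere {a b : ℕ → ℂ} {r : ℝ} (hr : 0 < r)
    (ha : Summable fun n => ‖a n‖ * r ^ n) (hb : Summable fun n => ‖b n‖ * r ^ n)
    (hab : ∀ z : ℂ, ‖z‖ = r → ∑' n, a n * z ^ n = ∑' n, b n * z ^ n) : a = b := by
  have hinj : Function.Injective ((↑) : ℕ → ℤ) := Nat.cast_injective
  have key : ∀ a : ℕ → ℂ, Summable (fun n => ‖a n‖ * r ^ n) → ∀ n : ℕ,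
      circleAverage (fun z : ℂ => z ^ (-(n : ℤ)) * ∑' n, a n * ((r : ℂ) * z) ^ n) 0 1 =
        a n * r ^ n := by
    intro a ha n
    set c : ℤ → ℂ := Function.extend ((↑) : ℕ → ℤ) (fun n => a n * r ^ n) 0 with hc
    have hcn : ∀ n : ℕ, c n = a n * r ^ n := fun n => hinj.extend_apply _ _ _
    have hc0 : ∀ k ∉ Set.range ((↑) : ℕ → ℤ), c k = 0 := fun k hk => by
      rw [hc, Function.extend_apply' _ _ _ fun h => hk h]; rfl
    have hcs : Summable fun k => ‖c k‖ := by
      refine (hinj.summable_iff fun k hk => by rw [hc0 k hk, norm_zero]).1 ?_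
      refine ha.congr fun n => ?_
      simp [hcn, abs_of_pos hr]
    have := circleAverage_laurentSum hcs n
    rw [hcn] at this
    rw [← this]
    refine circleAverage_congr_sphere fun z _ => ?_
    congr 1
    rw [laurentSum, ← hinj.tsum_eq (f := fun k : ℤ => c k * z ^ k)]
    · refine tsum_congr fun n => ?_
      rw [hcn, zpow_natCast, mul_pow, mul_assoc]
    · intro k hk
      by_contra h
      exact hk (by simp [hc0 k h])
  ext n
  have h1 := key a ha n
  have h2 := key b hb n
  have h3 : circleAverage (fun z : ℂ => z ^ (-(n : ℤ)) * ∑' n, a n * ((r : ℂ) * z) ^ n) 0 1 =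
      circleAverage (fun z : ℂ => z ^ (-(n : ℤ)) * ∑' n, b n * ((r : ℂ) * z) ^ n) 0 1 := by
    refine circleAverage_congr_sphere fun z hz => ?_
    have hz1 : ‖z‖ = 1 := by simpa using hz
    rw [hab _ (by simp [hz1, abs_of_pos hr])]
  rw [h1, h2] at h3
  exact mul_right_cancel₀ (pow_ne_zero n (Complex.ofReal_ne_zero.2 hr.ne')) h3

/-- Termwise differentiation of a power series with summable coefficients. -/
lemma hasSum_deriv_powerSeries {a : ℕ → ℂ} (ha : Summable fun n => ‖a n‖) {z : ℂ} (hz : ‖z‖ < 1) :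
    HasSum (fun n : ℕ => ((n : ℂ) + 1) * a (n + 1) * z ^ n)
      (deriv (fun z => ∑' n, a n * z ^ n) z) := by
  have h := hasSum_deriv_of_summable_norm (U := ball 0 1) (F := fun n z => a n * z ^ n) ha
    (fun n => by fun_prop) isOpen_ball (fun n w hw => by
      have : ‖w‖ ≤ 1 := (by simpa using hw : ‖w‖ < 1).le
      rw [norm_mul, norm_pow]
      exact mul_le_of_le_one_right (norm_nonneg _) (pow_le_one₀ (norm_nonneg _) this))
    (by simpa using hz : z ∈ ball (0 : ℂ) 1)
  have h0 : deriv (fun z : ℂ => a 0 * z ^ 0) z = 0 := by simp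
  rw [← hasSum_nat_add_iff' 1, Finset.sum_range_one, h0, sub_zero] at h
  have h1 : (fun n : ℕ => ((n : ℂ) + 1) * a (n + 1) * z ^ n) =
      fun n : ℕ => deriv (fun z : ℂ => a (n + 1) * z ^ (n + 1)) z := by
    ext n
    rw [deriv_const_mul _ (by fun_prop), deriv_pow_field]
    push_cast
    ring_nf
  rw [h1]
  exact h

lemma summable_deriv_powerSeries {a : ℕ → ℂ} (ha : Summable fun n => ‖a n‖) :
    Summable fun n : ℕ => ‖((n : ℂ) + 1) * a (n + 1)‖ * (1 / 2 : ℝ) ^ n := by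
  have h1 : Summable fun n : ℕ => ‖a (n + 1)‖ * 1 := by
    simpa using (summable_nat_add_iff 1).2 ha
  refine Summable.of_nonneg_of_le (fun n => by positivity) (fun n => ?_) (h1.mul_left 2)
  have e1 : ‖(n : ℂ) + 1‖ = (n : ℝ) + 1 := by exact_mod_cast Complex.norm_natCast (n + 1)
  have e2 : ((n : ℝ) + 1) * (1 / 2) ^ n ≤ 2 := by
    have : (n : ℝ) + 1 ≤ 2 ^ n * 2 := by
      have := Nat.lt_two_pow_self (n := n + 1)
      rw [pow_succ] at this
      exact_mod_cast this.le
    rw [one_div, inv_pow]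
    rw [mul_inv_le_iff₀ (by positivity)]
    linarith
  rw [norm_mul, e1]
  calc ((n : ℝ) + 1) * ‖a (n + 1)‖ * (1 / 2) ^ n = (((n : ℝ) + 1) * (1 / 2) ^ n) * ‖a (n + 1)‖ := by
        ring
    _ ≤ 2 * ‖a (n + 1)‖ := by gcongr
    _ = _ := by ring

/-- If `∑ G n z ^ n = exp (-∑ ℓ n z ^ n)` in the unit disk, then `G` is given by the recursion
defining `expCoeff`. -/
lemma eq_expCoeff_of_tsum_eq_exp {G ℓ : ℕ → ℂ} (hG : Summable fun n => ‖G n‖)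
    (hℓ : Summable fun n => ‖ℓ n‖)
    (h : ∀ z : ℂ, ‖z‖ < 1 → ∑' n, G n * z ^ n = Complex.exp (-∑' n, ℓ n * z ^ n)) (n : ℕ) :
    G n = Complex.exp (-ℓ 0) * expCoeff ℓ n := by
  have h0 : G 0 = Complex.exp (-ℓ 0) := by
    have := h 0 (by simp)
    have e : ∀ a : ℕ → ℂ, ∑' n, a n * (0 : ℂ) ^ n = a 0 := fun a => by
      rw [tsum_eq_single 0 fun n hn => by simp [hn]]; simp
    rwa [e, e] at this
  rw [← h0]
  refine eq_mul_expCoeff (fun n => ?_) n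
  have hdiff : ∀ a : ℕ → ℂ, Summable (fun n => ‖a n‖) → DifferentiableOn ℂ
      (fun z => ∑' n, a n * z ^ n) (ball 0 1) := fun a ha =>
    differentiableOn_tsum_of_summable_norm ha (fun n => by fun_prop) isOpen_ball (fun n w hw => by
      have : ‖w‖ ≤ 1 := (by simpa using hw : ‖w‖ < 1).le
      rw [norm_mul, norm_pow]
      exact mul_le_of_le_one_right (norm_nonneg _) (pow_le_one₀ (norm_nonneg _) this))
  have hsG := summable_deriv_powerSeries hG
  have hsℓ := summable_deriv_powerSeries hℓ
  have hG2 : Summable fun n : ℕ => ‖G n‖ * (1 / 2 : ℝ) ^ n :=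
    Summable.of_nonneg_of_le (fun n => by positivity) (fun n =>
      mul_le_of_le_one_right (norm_nonneg _) (pow_le_one₀ (by norm_num) (by norm_num))) hG
  -- compare the coefficients in `G' = -ℓ' G` on the circle of radius `1 / 2`
  set b : ℕ → ℂ := fun n =>
    -∑ j ∈ Finset.range (n + 1), ((j : ℂ) + 1) * ℓ (j + 1) * G (n - j) with hb
  have hconv : ∀ z : ℂ, ‖z‖ = 1 / 2 → ∀ n : ℕ, ∑ kl ∈ Finset.HasAntidiagonal.antidiagonal n,
      (((kl.1 : ℂ) + 1) * ℓ (kl.1 + 1) * z ^ kl.1) * (G kl.2 * z ^ kl.2) = -b n * z ^ n := by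
    intro z hz n
    rw [Finset.Nat.sum_antidiagonal_eq_sum_range_succ_mk, hb, neg_neg, Finset.sum_mul]
    refine Finset.sum_congr rfl fun j hj => ?_
    have : n = j + (n - j) := by
      have := Finset.mem_range.1 hj
      omega
    conv_rhs => rw [this, pow_add]
    simp only [Nat.add_sub_cancel_left]
    ring
  have hnorm : ∀ (a : ℕ → ℂ) (z : ℂ), ‖z‖ = 1 / 2 → (fun n => ‖a n * z ^ n‖) =
      fun n => ‖a n‖ * (1 / 2 : ℝ) ^ n := fun a z hz => by
    ext n; rw [norm_mul, norm_pow, hz]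
  have hbs : Summable fun n => ‖b n‖ * (1 / 2 : ℝ) ^ n := by
    have hz : ‖(1 / 2 : ℂ)‖ = 1 / 2 := by norm_num
    have := summable_norm_sum_mul_antidiagonal_of_summable_norm
      (f := fun n : ℕ => (((n : ℂ) + 1) * ℓ (n + 1)) * (1 / 2 : ℂ) ^ n)
      (g := fun n : ℕ => G n * (1 / 2 : ℂ) ^ n)
      (by rw [hnorm (fun n => ((n : ℂ) + 1) * ℓ (n + 1)) _ hz]; exact hsℓ)
      (by rw [hnorm _ _ hz]; exact hG2)
    refine this.congr fun n => ?_
    rw [hconv _ hz n, norm_mul, norm_neg, norm_pow, hz]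
  refine congrFun (eq_of_tsum_eq_on_sphere (r := 1 / 2) (by norm_num) hsG hbs fun z hz => ?_) n
  have hz1 : ‖z‖ < 1 := by rw [hz]; norm_num
  have hzm : z ∈ ball (0 : ℂ) 1 := by simpa using hz1
  rw [(hasSum_deriv_powerSeries hG hz1).tsum_eq]
  have hev : (fun z => ∑' n, G n * z ^ n) =ᶠ[𝓝 z]
      fun z => Complex.exp (-∑' n, ℓ n * z ^ n) := by
    filter_upwards [isOpen_ball.mem_nhds hzm] with w hw
    exact h w (by simpa using hw)
  have hd := ((hdiff ℓ hℓ).differentiableAt (isOpen_ball.mem_nhds hzm)).hasDerivAt.neg.cexp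
  have hd' : deriv (fun z => ∑' n, G n * z ^ n) z =
      Complex.exp (-∑' n, ℓ n * z ^ n) * -deriv (fun z => ∑' n, ℓ n * z ^ n) z :=
    hev.deriv_eq.trans hd.deriv
  rw [hd', ← h z hz1, ← (hasSum_deriv_powerSeries hℓ hz1).tsum_eq, mul_neg, mul_comm,
    tsum_mul_tsum_eq_tsum_sum_antidiagonal_of_summable_norm
      (by rw [hnorm (fun n => ((n : ℂ) + 1) * ℓ (n + 1)) _ hz]; exact hsℓ)
      (by rw [hnorm _ _ hz]; exact hG2), ← tsum_neg]
  refine tsum_congr fun n => ?_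
  rw [hconv z hz n, neg_mul, neg_neg]

/-! ### The killed walk and the Wiener–Hopf factorization -/

lemma summable_norm_mul_zpow {c : ℤ → ℂ} (hc : Summable fun k => ‖c k‖) {z : ℂ} (hz : ‖z‖ = 1) :
    Summable fun k : ℤ => ‖c k * z ^ k‖ := by simpa [hz] using hc

lemma hasSum_laurentSum {c : ℤ → ℂ} (hc : Summable fun k => ‖c k‖) {z : ℂ} (hz : ‖z‖ = 1) :
    HasSum (fun k : ℤ => c k * z ^ k) (laurentSum c z) :=
  (summable_norm_mul_zpow hc hz).of_norm.hasSum

/-- The convolution of two sequences indexed by `ℤ`. -/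
noncomputable def conv (f g : ℤ → ℂ) (x : ℤ) : ℂ := ∑' y, f y * g (x - y)

/-- The change of variables `(x, y) ↦ (y, x - y)` that turns a double sum into a sum of
convolutions. -/
def convEquiv : ℤ × ℤ ≃ ℤ × ℤ where
  toFun q := (q.2, q.1 - q.2)
  invFun q := (q.1 + q.2, q.1)
  left_inv q := by simp
  right_inv q := by simp

lemma summable_conv_aux {f g : ℤ → ℂ} (hf : Summable fun k => ‖f k‖)
    (hg : Summable fun k => ‖g k‖) : Summable fun q : ℤ × ℤ => ‖f q.2 * g (q.1 - q.2)‖ := by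
  have h1 := hf.mul_norm hg
  exact (convEquiv.summable_iff (f := fun q : ℤ × ℤ => ‖f q.1 * g q.2‖)).2 h1

lemma summable_conv_term {f g : ℤ → ℂ} (hf : Summable fun k => ‖f k‖)
    (hg : Summable fun k => ‖g k‖) (x : ℤ) : Summable fun y => ‖f y * g (x - y)‖ :=
  (summable_conv_aux hf hg).prod_factor x

lemma summable_norm_conv {f g : ℤ → ℂ} (hf : Summable fun k => ‖f k‖)
    (hg : Summable fun k => ‖g k‖) : Summable fun x => ‖conv f g x‖ :=
  Summable.of_nonneg_of_le (fun _ => norm_nonneg _)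
    (fun x => norm_tsum_le_tsum_norm (summable_conv_term hf hg x))
    ((summable_conv_aux hf hg).prod)

lemma tsum_norm_conv_le {f g : ℤ → ℂ} (hf : Summable fun k => ‖f k‖)
    (hg : Summable fun k => ‖g k‖) :
    ∑' x, ‖conv f g x‖ ≤ (∑' k, ‖f k‖) * ∑' k, ‖g k‖ := by
  have h1 := hf.mul_norm hg
  have h2 : ∑' q : ℤ × ℤ, ‖f q.2 * g (q.1 - q.2)‖ = (∑' k, ‖f k‖) * ∑' k, ‖g k‖ := by
    rw [hf.tsum_mul_tsum hg (by simpa [norm_mul] using h1),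
      ← convEquiv.tsum_eq (fun q : ℤ × ℤ => ‖f q.1‖ * ‖g q.2‖)]
    exact tsum_congr fun q => norm_mul _ _
  rw [← h2, (summable_conv_aux hf hg).tsum_prod]
  exact (summable_norm_conv hf hg).tsum_le_tsum
    (fun x => norm_tsum_le_tsum_norm (summable_conv_term hf hg x)) ((summable_conv_aux hf hg).prod)

lemma laurentSum_conv {f g : ℤ → ℂ} (hf : Summable fun k => ‖f k‖)
    (hg : Summable fun k => ‖g k‖) {z : ℂ} (hz : ‖z‖ = 1) :
    laurentSum (conv f g) z = laurentSum f z * laurentSum g z := by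
  have hz0 : z ≠ 0 := norm_pos_iff.1 (by rw [hz]; exact one_pos)
  have hf' := summable_norm_mul_zpow hf hz
  have hg' := summable_norm_mul_zpow hg hz
  have hsum : Summable fun q : ℤ × ℤ => f q.2 * g (q.1 - q.2) * z ^ q.1 := by
    refine Summable.of_norm ((summable_conv_aux hf hg).congr fun q => ?_)
    rw [norm_mul _ (z ^ q.1), norm_zpow, hz, one_zpow, mul_one]
  have h1 : laurentSum f z * laurentSum g z = ∑' q : ℤ × ℤ, f q.2 * g (q.1 - q.2) * z ^ q.1 := by
    rw [laurentSum, laurentSum, tsum_mul_tsum_of_summable_norm hf' hg',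
      ← convEquiv.tsum_eq (fun q : ℤ × ℤ => f q.1 * z ^ q.1 * (g q.2 * z ^ q.2))]
    refine tsum_congr fun q => ?_
    simp only [convEquiv, Equiv.coe_fn_mk]
    rw [zpow_sub₀ hz0]
    field_simp
  rw [h1, hsum.tsum_prod, laurentSum]
  exact tsum_congr fun x => tsum_mul_right.symm

/-- Superposition of absolutely convergent Laurent series. -/
lemma laurentSum_tsum {c : ℕ → ℤ → ℂ} {u : ℕ → ℝ} (hc : ∀ n, Summable fun k => ‖c n k‖)
    (hcu : ∀ n, ∑' k, ‖c n k‖ ≤ u n) (hu : Summable u) :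
    (Summable fun k => ‖∑' n, c n k‖) ∧ ∀ z : ℂ, ‖z‖ = 1 →
      HasSum (fun n => laurentSum (c n) z) (laurentSum (fun k => ∑' n, c n k) z) := by
  have hs : Summable fun q : ℕ × ℤ => ‖c q.1 q.2‖ := by
    refine (summable_prod_of_nonneg fun _ => norm_nonneg _).2 ⟨hc, ?_⟩
    exact Summable.of_nonneg_of_le (fun n => tsum_nonneg fun _ => norm_nonneg _) hcu hu
  have hs' : Summable fun q : ℤ × ℕ => ‖c q.2 q.1‖ := hs.prod_symm
  refine ⟨Summable.of_nonneg_of_le (fun _ => norm_nonneg _)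
    (fun k => norm_tsum_le_tsum_norm (hs'.prod_factor k)) hs'.prod, fun z hz => ?_⟩
  have ht : Summable fun q : ℕ × ℤ => c q.1 q.2 * z ^ q.2 := by
    refine Summable.of_norm (hs.congr fun q => ?_)
    rw [norm_mul, norm_zpow, hz, one_zpow, mul_one]
  have h1 := ht.hasSum.prod_fiberwise fun n => hasSum_laurentSum (hc n) hz
  have h2 : ∑' q : ℕ × ℤ, c q.1 q.2 * z ^ q.2 = laurentSum (fun k => ∑' n, c n k) z := by
    have ht' : Summable fun q : ℤ × ℕ => c q.2 q.1 * z ^ q.1 := ht.prod_symm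
    rw [← (Equiv.prodComm ℤ ℕ).tsum_eq]
    refine ht'.tsum_prod.trans (tsum_congr fun k => ?_)
    change ∑' n : ℕ, c n k * z ^ k = (∑' n : ℕ, c n k) * z ^ k
    exact tsum_mul_right
  rw [h2] at h1
  exact h1

lemma laurentSum_eq_tsum_of_nonneg {c : ℤ → ℂ} (hc : ∀ k < 0, c k = 0) (z : ℂ) :
    laurentSum c z = ∑' n : ℕ, c n * z ^ n := by
  rw [laurentSum, ← (Nat.cast_injective (R := ℤ)).tsum_eq]
  · simp
  · intro k hk
    have : 0 ≤ k := by
      by_contra h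
      exact hk (by simp [hc k (by omega)])
    exact ⟨k.toNat, by simpa using this⟩

lemma laurentSum_eq_tsum_of_nonpos {c : ℤ → ℂ} (hc : ∀ k > 0, c k = 0) (z : ℂ) :
    laurentSum c z = ∑' n : ℕ, c (-n) * z⁻¹ ^ n := by
  have hinj : Function.Injective fun n : ℕ => -(n : ℤ) := fun a b h => by simpa using h
  rw [laurentSum, ← hinj.tsum_eq]
  · simp
  · intro k hk
    have : k ≤ 0 := by
      by_contra h
      exact hk (by simp [hc k (by omega)])
    exact ⟨(-k).toNat, by simp [this]⟩

lemma diffContOnCl_powerSeries {a : ℕ → ℂ} (ha : Summable fun n => ‖a n‖) :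
    DiffContOnCl ℂ (fun z => ∑' n, a n * z ^ n) (ball 0 1) := by
  refine ⟨differentiableOn_tsum_of_summable_norm ha (fun n => by fun_prop) isOpen_ball
    (fun n w hw => ?_), ?_⟩
  · have : ‖w‖ ≤ 1 := (by simpa using hw : ‖w‖ < 1).le
    rw [norm_mul, norm_pow]
    exact mul_le_of_le_one_right (norm_nonneg _) (pow_le_one₀ (norm_nonneg _) this)
  · rw [closure_ball (0 : ℂ) one_ne_zero]
    refine continuousOn_tsum (fun n => by fun_prop) ha fun n w hw => ?_
    have : ‖w‖ ≤ 1 := by simpa using hw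
    rw [norm_mul, norm_pow]
    exact mul_le_of_le_one_right (norm_nonneg _) (pow_le_one₀ (norm_nonneg _) this)

/-- `killed p m n y` is the probability that the walk with step law `p` stays in `[m, ∞)` at the
times `1, …, n` and is at `y` at time `n`. -/
noncomputable def killed (p : ℤ → ℝ) (m : ℤ) : ℕ → ℤ → ℝ
  | 0 => fun y => if y = 0 then 1 else 0
  | n + 1 => fun x => if m ≤ x then ∑' y, killed p m n y * p (x - y) else 0

/-- `exitAt p m n x` is the probability that the walk leaves `[m, ∞)` for the first time at time
`n + 1`, at the point `x`. -/
noncomputable def exitAt (p : ℤ → ℝ) (m : ℤ) (n : ℕ) (x : ℤ) : ℝ :=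
  if x < m then ∑' y, killed p m n y * p (x - y) else 0

/-- The generating function in time of the walk killed on leaving `[m, ∞)`. -/
noncomputable def killedGreen (p : ℤ → ℝ) (m : ℤ) (s : ℂ) (y : ℤ) : ℂ :=
  ∑' n : ℕ, s ^ n * killed p m n y

lemma killed_eq_zero {p : ℤ → ℝ} {m : ℤ} (hm : 0 ≤ m) (n : ℕ) {y : ℤ} (hy : y < 0) :
    killed p m n y = 0 := by
  cases n with
  | zero => simp [killed, hy.ne]
  | succ n => simp only [killed]; rw [if_neg (by omega)]

namespace CenteredLaw

variable {p : ℤ → ℝ}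

lemma summable_norm (hp : CenteredLaw p) : Summable fun k => ‖(p k : ℂ)‖ := by
  refine hp.hasSum_one.summable.congr fun k => ?_
  rw [Complex.norm_real, Real.norm_of_nonneg (hp.nonneg k)]

lemma tsum_norm (hp : CenteredLaw p) : ∑' k, ‖(p k : ℂ)‖ = 1 := by
  rw [← hp.hasSum_one.tsum_eq]
  refine tsum_congr fun k => ?_
  rw [Complex.norm_real, Real.norm_of_nonneg (hp.nonneg k)]

lemma ofReal_tsum_conv (p : ℤ → ℝ) (f : ℤ → ℝ) (x : ℤ) :
    ((∑' y, f y * p (x - y) : ℝ) : ℂ) = conv (fun y => (f y : ℂ)) (fun k => (p k : ℂ)) x := by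
  rw [Complex.ofReal_tsum, conv]
  simp

lemma killed_add_exitAt (p : ℤ → ℝ) (m : ℤ) (n : ℕ) (x : ℤ) :
    (killed p m (n + 1) x : ℂ) + exitAt p m n x =
      conv (fun y => (killed p m n y : ℂ)) (fun k => (p k : ℂ)) x := by
  rw [← ofReal_tsum_conv]
  simp only [killed, exitAt]
  by_cases h : m ≤ x
  · rw [if_pos h, if_neg (not_lt.2 h)]; simp
  · rw [if_neg h, if_pos (not_le.1 h)]; simp

lemma norm_killed_succ_le (p : ℤ → ℝ) (m : ℤ) (n : ℕ) (x : ℤ) :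
    ‖(killed p m (n + 1) x : ℂ)‖ ≤
      ‖conv (fun y => (killed p m n y : ℂ)) (fun k => (p k : ℂ)) x‖ := by
  rw [← ofReal_tsum_conv]
  simp only [killed]
  split_ifs <;> simp

lemma norm_exitAt_le (p : ℤ → ℝ) (m : ℤ) (n : ℕ) (x : ℤ) :
    ‖(exitAt p m n x : ℂ)‖ ≤
      ‖conv (fun y => (killed p m n y : ℂ)) (fun k => (p k : ℂ)) x‖ := by
  rw [← ofReal_tsum_conv]
  simp only [exitAt]
  split_ifs <;> simp

lemma killed_summable (hp : CenteredLaw p) (m : ℤ) (n : ℕ) :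
    (Summable fun y => ‖(killed p m n y : ℂ)‖) ∧ ∑' y, ‖(killed p m n y : ℂ)‖ ≤ 1 := by
  induction n with
  | zero =>
    have : HasSum (fun y : ℤ => ‖(killed p m 0 y : ℂ)‖) 1 := by
      convert hasSum_ite_eq (0 : ℤ) (1 : ℝ) using 2 with y
      simp only [killed]
      split_ifs <;> simp
    exact ⟨this.summable, this.tsum_eq.le⟩
  | succ n ih =>
    have h1 := summable_norm_conv ih.1 hp.summable_norm
    have h2 := tsum_norm_conv_le ih.1 hp.summable_norm
    rw [hp.tsum_norm, mul_one] at h2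
    have h3 := Summable.of_nonneg_of_le (fun _ => norm_nonneg _) (norm_killed_succ_le p m n) h1
    exact ⟨h3, (h3.tsum_le_tsum (norm_killed_succ_le p m n) h1).trans (h2.trans ih.2)⟩

lemma exitAt_summable (hp : CenteredLaw p) (m : ℤ) (n : ℕ) :
    (Summable fun y => ‖(exitAt p m n y : ℂ)‖) ∧ ∑' y, ‖(exitAt p m n y : ℂ)‖ ≤ 1 := by
  have ih := hp.killed_summable m n
  have h1 := summable_norm_conv ih.1 hp.summable_norm
  have h2 := tsum_norm_conv_le ih.1 hp.summable_norm
  rw [hp.tsum_norm, mul_one] at h2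
  have h3 := Summable.of_nonneg_of_le (fun _ => norm_nonneg _) (norm_exitAt_le p m n) h1
  exact ⟨h3, (h3.tsum_le_tsum (norm_exitAt_le p m n) h1).trans (h2.trans ih.2)⟩

lemma killed_le_one (hp : CenteredLaw p) (m : ℤ) (n : ℕ) (y : ℤ) :
    ‖(killed p m n y : ℂ)‖ ≤ 1 :=
  ((hp.killed_summable m n).1.le_tsum y fun _ _ => norm_nonneg _).trans (hp.killed_summable m n).2

/-- The coefficients of `φ ^ n`, that is the law of the walk at time `n`. -/
lemma exists_convPow (hp : CenteredLaw p) (n : ℕ) : ∃ c : ℤ → ℂ, (Summable fun k => ‖c k‖) ∧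
    ∑' k, ‖c k‖ ≤ 1 ∧ ∀ z : ℂ, ‖z‖ = 1 → laurentSum c z = genFun p z ^ n := by
  induction n with
  | zero =>
    refine ⟨fun y => (killed p 0 0 y : ℂ), (hp.killed_summable 0 0).1, (hp.killed_summable 0 0).2,
      fun z _ => ?_⟩
    rw [laurentSum, tsum_eq_single 0 fun k hk => by simp [killed, hk]]
    simp [killed]
  | succ n ih =>
    obtain ⟨c, h1, h2, h3⟩ := ih
    have h4 := tsum_norm_conv_le h1 hp.summable_norm
    rw [hp.tsum_norm, mul_one] at h4
    refine ⟨conv c fun k => (p k : ℂ), summable_norm_conv h1 hp.summable_norm, h4.trans h2,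
      fun z hz => ?_⟩
    rw [laurentSum_conv h1 hp.summable_norm hz, h3 z hz, pow_succ, genFun]

/-- For `|s| < 1` the Fourier series of `log (1 - s φ)` converges absolutely. -/
lemma summable_logCoeff (hp : CenteredLaw p) {s : ℂ} (hs : ‖s‖ < 1) :
    (Summable fun k => ‖logCoeff p k s‖) ∧ ∀ z : ℂ, ‖z‖ = 1 →
      laurentSum (fun k => logCoeff p k s) z = Complex.log (1 - s * genFun p z) := by
  choose c h1 h2 h3 using hp.exists_convPow
  have hfac : ∀ n : ℕ, ‖-(s ^ n / n)‖ ≤ ‖s‖ ^ n := fun n => by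
    rw [norm_neg, norm_div, norm_pow, Complex.norm_natCast]
    rcases Nat.eq_zero_or_pos n with rfl | hn
    · simp
    · exact div_le_self (by positivity) (by exact_mod_cast hn)
  obtain ⟨hs1, hs2⟩ := laurentSum_tsum (c := fun n k => -(s ^ n / n) * c n k)
    (u := fun n => ‖s‖ ^ n) (fun n => by simpa [norm_mul] using (h1 n).mul_left _)
    (fun n => by
      simp only [norm_mul]
      rw [tsum_mul_left]
      exact (mul_le_mul (hfac n) (h2 n) (tsum_nonneg fun _ => norm_nonneg _)
        (by positivity)).trans_eq (mul_one _))
    (summable_geometric_of_lt_one (norm_nonneg s) hs)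
  set ℓ : ℤ → ℂ := fun k => ∑' n, -(s ^ n / n) * c n k with hℓ
  have hlog : ∀ z : ℂ, ‖z‖ = 1 → laurentSum ℓ z = Complex.log (1 - s * genFun p z) := by
    intro z hz
    have e1 := Complex.hasSum_taylorSeries_neg_log (hp.norm_mul_genFun_lt_one hs hz)
    have e2 := (hs2 z hz).neg
    have e3 : (fun n : ℕ => -laurentSum (fun k => -(s ^ n / n) * c n k) z) =
        fun n : ℕ => (s * genFun p z) ^ n / n := by
      ext n
      have : laurentSum (fun k => -(s ^ n / n) * c n k) z = -(s ^ n / n) * laurentSum (c n) z := by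
        rw [laurentSum, laurentSum, ← tsum_mul_left]
        exact tsum_congr fun k => by ring
      rw [this, h3 n z hz, mul_pow]
      ring
    rw [e3] at e2
    exact neg_injective (e2.unique e1)
  have heq : (fun k => logCoeff p k s) = ℓ := by
    ext k
    rw [← circleAverage_laurentSum (c := ℓ) hs1 k, logCoeff]
    refine circleAverage_congr_sphere fun z hz => ?_
    rw [hlog z (by simpa using hz)]
  have heq' : ∀ k, logCoeff p k s = ℓ k := fun k => congrFun heq k
  simp only [heq']
  exact ⟨hs1, hlog⟩

lemma killedGreen_summable (hp : CenteredLaw p) (m : ℤ) {s : ℂ} (hs : ‖s‖ < 1) :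
    (Summable fun y => ‖killedGreen p m s y‖) ∧ ∀ z : ℂ, ‖z‖ = 1 →
      HasSum (fun n : ℕ => s ^ n * laurentSum (fun y => (killed p m n y : ℂ)) z)
        (laurentSum (killedGreen p m s) z) := by
  obtain ⟨h1, h2⟩ := laurentSum_tsum (c := fun n y => s ^ n * killed p m n y)
    (u := fun n => ‖s‖ ^ n)
    (fun n => by simpa [norm_mul] using ((hp.killed_summable m n).1).mul_left (‖s‖ ^ n))
    (fun n => by
      simp only [norm_mul, norm_pow]
      rw [tsum_mul_left]
      exact mul_le_of_le_one_right (by positivity) (hp.killed_summable m n).2)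
    (summable_geometric_of_lt_one (norm_nonneg s) hs)
  refine ⟨h1, fun z hz => ?_⟩
  have := h2 z hz
  simp only [laurentSum, mul_assoc, tsum_mul_left] at this ⊢
  exact this

/-- The first step decomposition `G(z) (1 - s φ(z)) = 1 - D(z)` on the unit circle, with `D` the
generating function of the exit time and exit point. -/
lemma exists_exit_laurentSum (hp : CenteredLaw p) (m : ℤ) {s : ℂ} (hs : ‖s‖ < 1) :
    ∃ D : ℤ → ℂ, (Summable fun x => ‖D x‖) ∧ (∀ x, m ≤ x → D x = 0) ∧ ∀ z : ℂ, ‖z‖ = 1 →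
      laurentSum (killedGreen p m s) z * (1 - s * genFun p z) = 1 - laurentSum D z := by
  obtain ⟨h1, h2⟩ := laurentSum_tsum (c := fun n y => s ^ (n + 1) * exitAt p m n y)
    (u := fun n => ‖s‖ ^ (n + 1))
    (fun n => by simpa [norm_mul] using ((hp.exitAt_summable m n).1).mul_left (‖s‖ ^ (n + 1)))
    (fun n => by
      simp only [norm_mul, norm_pow]
      rw [tsum_mul_left]
      exact mul_le_of_le_one_right (by positivity) (hp.exitAt_summable m n).2)
    ((summable_nat_add_iff 1).2 (summable_geometric_of_lt_one (norm_nonneg s) hs))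
  refine ⟨_, h1, fun x hx => ?_, fun z hz => ?_⟩
  · simp [exitAt, not_lt.2 hx]
  · have hG := (hp.killedGreen_summable m hs).2 z hz
    have h0 : laurentSum (fun y => (killed p m 0 y : ℂ)) z = 1 := by
      rw [laurentSum, tsum_eq_single 0 fun k hk => by simp [killed, hk]]
      simp [killed]
    have hstep : ∀ n, laurentSum (fun y => (killed p m (n + 1) y : ℂ)) z +
        laurentSum (fun y => (exitAt p m n y : ℂ)) z =
        laurentSum (fun y => (killed p m n y : ℂ)) z * genFun p z := by
      intro n
      rw [genFun, ← laurentSum_conv (hp.killed_summable m n).1 hp.summable_norm hz, laurentSum,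
        laurentSum, ← Summable.tsum_add]
      · rw [laurentSum]
        refine tsum_congr fun x => ?_
        rw [← killed_add_exitAt, add_mul]
      · exact (summable_norm_mul_zpow (hp.killed_summable m (n + 1)).1 hz).of_norm
      · exact (summable_norm_mul_zpow (hp.exitAt_summable m n).1 hz).of_norm
    have hD := h2 z hz
    have hD' : (fun n : ℕ => laurentSum (fun y => s ^ (n + 1) * (exitAt p m n y : ℂ)) z) =
        fun n : ℕ => s ^ (n + 1) * laurentSum (fun y => (exitAt p m n y : ℂ)) z := by
      ext n
      simp only [laurentSum, mul_assoc, tsum_mul_left]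
    rw [hD'] at hD
    have hG1 := (hasSum_nat_add_iff' 1).2 hG
    rw [Finset.sum_range_one, h0, pow_zero, one_mul] at hG1
    have h3 := hG1.add hD
    have h4 := hG.mul_right (s * genFun p z)
    have h5 : (fun n : ℕ => s ^ (n + 1) * laurentSum (fun y => (killed p m (n + 1) y : ℂ)) z +
        s ^ (n + 1) * laurentSum (fun y => (exitAt p m n y : ℂ)) z) =
        fun n : ℕ => s ^ n * laurentSum (fun y => (killed p m n y : ℂ)) z * (s * genFun p z) := by
      ext n
      rw [← mul_add, hstep, pow_succ]
      ring
    rw [h5] at h3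
    have h6 := h3.unique h4
    linear_combination h6

/-- **Wiener–Hopf factorization.** For `|s| < 1` the Green function of the killed walk has the
generating function `exp (-∑_{k ≥ m} ℓ_k(s) z ^ k)`, for `m = 0` or `m = 1`. Indeed `1 - s φ` is the
product of `exp (∑_{k ≥ m} ℓ_k z ^ k)` and `exp (∑_{k < m} ℓ_k z ^ k)`, so the first step
decomposition equates a function of `z` and one of `1 / z`, both in the disk algebra. -/
theorem killedGreen_eq (hp : CenteredLaw p) {m : ℤ} (hm : m = 0 ∨ m = 1) {s : ℂ} (hs : ‖s‖ < 1)
    (n : ℕ) : killedGreen p m s n = Complex.exp (-if m = 0 then logCoeff p 0 s else 0) *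
      expCoeff (fun j => logCoeff p j s) n := by
  obtain ⟨hℓ, hlog⟩ := hp.summable_logCoeff hs
  obtain ⟨hG, -⟩ := hp.killedGreen_summable m hs
  obtain ⟨D, hD, hD0, hGD⟩ := hp.exists_exit_laurentSum m hs
  set ℓ : ℤ → ℂ := fun k => logCoeff p k s with hℓdef
  -- the parts of the Laurent series of `log (1 - s φ)` with exponents `≥ m` and `< m`
  set ℓp : ℤ → ℂ := fun k => if m ≤ k then ℓ k else 0 with hℓp
  set ℓm : ℤ → ℂ := fun k => if m ≤ k then 0 else ℓ k with hℓm
  have hm0 : 0 ≤ m := by rcases hm with rfl | rfl <;> norm_num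
  have hm1 : m ≤ 1 := by rcases hm with rfl | rfl <;> norm_num
  have hℓps : Summable fun k => ‖ℓp k‖ := Summable.of_nonneg_of_le (fun _ => norm_nonneg _)
    (fun k => by simp only [hℓp]; split_ifs; exacts [le_rfl, by simp]) hℓ
  have hℓms : Summable fun k => ‖ℓm k‖ := Summable.of_nonneg_of_le (fun _ => norm_nonneg _)
    (fun k => by simp only [hℓm]; split_ifs; exacts [by simp, le_rfl]) hℓ
  have hneg : Function.Injective fun n : ℕ => -(n : ℤ) := fun a b h => by simpa using h
  have hGs : Summable fun n : ℕ => ‖killedGreen p m s n‖ :=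
    hG.comp_injective (Nat.cast_injective (R := ℤ))
  have hDs : Summable fun n : ℕ => ‖D (-n)‖ := hD.comp_injective hneg
  have hps : Summable fun n : ℕ => ‖ℓp n‖ := hℓps.comp_injective (Nat.cast_injective (R := ℤ))
  have hms : Summable fun n : ℕ => ‖ℓm (-n)‖ := hℓms.comp_injective hneg
  have e0 : ∀ a : ℕ → ℂ, ∑' n, a n * (0 : ℂ) ^ n = a 0 := fun a => by
    rw [tsum_eq_single 0 fun n hn => by simp [hn]]; simp
  set f : ℂ → ℂ := fun z => (∑' n : ℕ, killedGreen p m s n * z ^ n) *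
    Complex.exp (∑' n : ℕ, ℓp n * z ^ n) with hf
  set g : ℂ → ℂ := fun w => (1 - ∑' n : ℕ, D (-n) * w ^ n) *
    Complex.exp (-∑' n : ℕ, ℓm (-n) * w ^ n) with hg
  have hcexp : ∀ h : ℂ → ℂ, DiffContOnCl ℂ h (ball 0 1) →
      DiffContOnCl ℂ (fun z => Complex.exp (h z)) (ball 0 1) := fun h hh =>
    Complex.differentiable_exp.comp_diffContOnCl hh
  have hmul : ∀ h k : ℂ → ℂ, DiffContOnCl ℂ h (ball 0 1) → DiffContOnCl ℂ k (ball 0 1) →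
      DiffContOnCl ℂ (fun z => h z * k z) (ball 0 1) := fun h k hh hk => hh.smul hk
  have hfd : DiffContOnCl ℂ f (ball 0 1) :=
    hmul _ _ (diffContOnCl_powerSeries hGs) (hcexp _ (diffContOnCl_powerSeries hps))
  have hgd : DiffContOnCl ℂ g (ball 0 1) :=
    hmul _ _ (diffContOnCl_const.sub (diffContOnCl_powerSeries hDs))
      (hcexp _ (diffContOnCl_powerSeries hms).neg)
  have hsplit : ∀ z : ℂ, ‖z‖ = 1 → laurentSum ℓ z = laurentSum ℓp z + laurentSum ℓm z := by
    intro z hz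
    rw [laurentSum, laurentSum, laurentSum, ← Summable.tsum_add]
    · refine tsum_congr fun k => ?_
      simp only [hℓp, hℓm]
      split_ifs <;> simp
    · exact (summable_norm_mul_zpow hℓps hz).of_norm
    · exact (summable_norm_mul_zpow hℓms hz).of_norm
  have hfg : ∀ z : ℂ, ‖z‖ = 1 → f z = g (starRingEnd ℂ z) := by
    intro z hz
    have hconj : starRingEnd ℂ z = z⁻¹ := (Complex.inv_eq_conj hz).symm
    have a1 := laurentSum_eq_tsum_of_nonneg (c := killedGreen p m s) (fun k hk => by
      simp [killedGreen, killed_eq_zero hm0 _ hk]) z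
    have a2 := laurentSum_eq_tsum_of_nonneg (c := ℓp) (fun k hk => by
      simp only [hℓp]; rw [if_neg (by omega)]) z
    have a3 := laurentSum_eq_tsum_of_nonpos (c := D) (fun k hk => hD0 k (by omega)) z
    have a4 := laurentSum_eq_tsum_of_nonpos (c := ℓm) (fun k hk => by
      simp only [hℓm]; rw [if_pos (by omega)]) z
    simp only [hf, hg]
    rw [hconj, ← a1, ← a2, ← a3, ← a4, ← hGD z hz]
    have a5 : 1 - s * genFun p z =
        Complex.exp (laurentSum ℓp z) * Complex.exp (laurentSum ℓm z) := by
      rw [← Complex.exp_add, ← hsplit z hz, hlog z hz, Complex.exp_log]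
      exact slitPlane_ne_zero (hp.one_sub_mem_slitPlane hs hz)
    rw [a5, Complex.exp_neg]
    have := Complex.exp_ne_zero (laurentSum ℓm z)
    field_simp
  have h1 : f 0 = 1 ∨ g 0 = 1 := by
    rcases hm with rfl | rfl
    -- for `m = 0` the exit point is never `0`, for `m = 1` the killed walk never returns to `0`
    · right
      simp only [hg]
      rw [e0 fun n : ℕ => D (-n), e0 fun n : ℕ => ℓm (-n)]
      simp [hD0 0 le_rfl, hℓm]
    · left
      have hk : ∀ k : ℕ, k ≠ 0 → s ^ k * (killed p 1 k 0 : ℂ) = 0 := by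
        intro k hk
        obtain ⟨k, rfl⟩ := Nat.exists_eq_succ_of_ne_zero hk
        simp [killed]
      have : killedGreen p 1 s 0 = 1 := by
        rw [killedGreen, tsum_eq_single 0 hk]
        simp [killed]
      simp only [hf]
      rw [e0 fun n : ℕ => killedGreen p 1 s n, e0 fun n : ℕ => ℓp n]
      simp [hℓp, this]
  have hf1 : ∀ z : ℂ, ‖z‖ < 1 → ∑' n : ℕ, killedGreen p m s n * z ^ n =
      Complex.exp (-∑' n : ℕ, ℓp n * z ^ n) := by
    intro z hz
    have := eq_one_of_eq_conj_on_sphere hfd hgd hfg h1 hz.le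
    simp only [hf] at this
    rw [Complex.exp_neg]
    exact eq_inv_of_mul_eq_one_left this
  rw [eq_expCoeff_of_tsum_eq_exp hGs hps hf1 n]
  congr 1
  · congr 2
    simp only [hℓp]
    rcases hm with rfl | rfl <;> simp [hℓdef]
  · refine expCoeff_congr (fun j => ?_) n
    simp only [hℓp]
    rw [if_pos (by push_cast; omega)]

end CenteredLaw

/-! ### Continuation of the logarithmic coefficients -/

lemma mem_slitDisk {δ : ℝ} {s : ℂ} : s ∈ slitDisk δ ↔ ‖1 - s‖ < δ ∧ 1 - s ∈ slitPlane := by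
  rw [slitDisk, Set.mem_sdiff, mem_ball, dist_comm, dist_eq_norm]
  refine and_congr_right fun hs => ?_
  rw [mem_slitPlane_iff_not_le_zero, not_iff_not]
  constructor
  · rintro ⟨t, ht, rfl⟩
    rw [← ofReal_one, ← ofReal_sub, ← ofReal_zero, Complex.real_le_real]
    linarith [ht.1]
  · intro h
    obtain ⟨h1, h2⟩ := Complex.le_def.1 h
    simp only [sub_re, one_re, zero_re, sub_im, one_im, zero_im] at h1 h2
    have he : (s.re : ℂ) = s := Complex.ext rfl (by simp only [ofReal_im]; linarith)
    refine ⟨s.re, ⟨by linarith, ?_⟩, he⟩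
    have := Complex.abs_re_le_norm (1 - s)
    have h3 := neg_abs_le (1 - s).re
    simp only [sub_re, one_re] at this h3
    linarith

lemma isOpen_slitDisk (δ : ℝ) : IsOpen (slitDisk δ) := by
  have : slitDisk δ = {s | ‖1 - s‖ < δ} ∩ (fun s => 1 - s) ⁻¹' slitPlane := by
    ext s
    exact mem_slitDisk
  rw [this]
  exact (isOpen_lt (by fun_prop) continuous_const).inter
    (isOpen_slitPlane.preimage (by fun_prop))

lemma slitDisk_mono {δ δ' : ℝ} (h : δ ≤ δ') : slitDisk δ ⊆ slitDisk δ' := fun _ hs =>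
  mem_slitDisk.2 ⟨(mem_slitDisk.1 hs).1.trans_le h, (mem_slitDisk.1 hs).2⟩

lemma sqrtOneSub_sq (s : ℂ) : sqrtOneSub s ^ 2 = 1 - s := by
  rw [sqrtOneSub, ← Complex.cpow_nat_mul]
  norm_num

lemma norm_sqrtOneSub (s : ℂ) : ‖sqrtOneSub s‖ = √‖1 - s‖ := by
  rw [← sqrtOneSub_sq, norm_pow, Real.sqrt_sq (norm_nonneg _)]

lemma sqrtOneSub_mem_ball {δ : ℝ} {s : ℂ} (hs : s ∈ slitDisk δ) :
    sqrtOneSub s ∈ ball (0 : ℂ) √δ := by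
  rw [mem_ball_zero_iff, norm_sqrtOneSub]
  exact Real.sqrt_lt_sqrt (norm_nonneg _) (mem_slitDisk.1 hs).1

lemma sqrtOneSub_one_sub_sq {t : ℝ} (ht : 0 < t) : sqrtOneSub (1 - (t : ℂ) ^ 2) = t := by
  rw [sqrtOneSub, sub_sub_cancel, one_div]
  exact Complex.pow_cpow_ofNat_inv (by rw [Complex.arg_ofReal_of_nonneg ht.le]; simpa using Real.pi_pos)
    (by rw [Complex.arg_ofReal_of_nonneg ht.le]; positivity)

lemma differentiableOn_sqrtOneSub (δ : ℝ) : DifferentiableOn ℂ sqrtOneSub (slitDisk δ) :=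
  fun _ hs => (((differentiableAt_const _).sub differentiableAt_id).cpow
    (differentiableAt_const _) (mem_slitDisk.1 hs).2).differentiableWithinAt

lemma re_lt_one_of_norm_le {s : ℂ} (hs : ‖s‖ ≤ 1) (h1 : s ≠ 1) : s.re < 1 := by
  have h2 := Complex.re_le_norm s
  rcases (h2.trans hs).lt_or_eq with h | h
  · exact h
  · refine absurd (Complex.ext h ?_) h1
    have h3 := Complex.sq_norm s
    rw [normSq_apply, h] at h3
    have : ‖s‖ ^ 2 ≤ 1 := pow_le_one₀ (norm_nonneg _) hs
    simp only [one_im]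
    nlinarith

lemma one_sub_mem_slitPlane_of_norm_le {s : ℂ} (hs : ‖s‖ ≤ 1) (h1 : s ≠ 1) :
    1 - s ∈ slitPlane := by
  left
  simp only [sub_re, one_re]
  linarith [re_lt_one_of_norm_le hs h1]

/-- The identity theorem in the variable `√(1 - s)`: a holomorphic `f` on a connected part of the
slit disk is `Λ (√(1 - s))` as soon as this holds on the real interval to the left of `1`. -/
lemma eqOn_sqrtOneSub {f Λ : ℂ → ℂ} {ε₀ : ℝ} (hε₀ : 0 < ε₀) (hε₁ : ε₀ < 1) {S : Set ℂ}
    (hS : IsOpen S) (hSs : S ⊆ slitDisk (ε₀ ^ 2)) (hSc : IsPreconnected S)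
    (hf : DifferentiableOn ℂ f S) (hΛ : DifferentiableOn ℂ Λ (ball 0 ε₀))
    (hsub : ball 0 1 ∩ ball 1 (ε₀ ^ 2) ⊆ S)
    (h : ∀ t : ℝ, 0 < t → t < ε₀ → Λ t = f (1 - (t : ℂ) ^ 2)) {s : ℂ} (hs : s ∈ S) :
    Λ (sqrtOneSub s) = f s := by
  have hmaps : MapsTo sqrtOneSub S (ball 0 ε₀) := fun s hs => by
    have := sqrtOneSub_mem_ball (hSs hs)
    rwa [Real.sqrt_sq hε₀.le] at this
  have h1 : AnalyticOnNhd ℂ (fun s => Λ (sqrtOneSub s)) S :=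
    (hΛ.comp ((differentiableOn_sqrtOneSub _).mono hSs) hmaps).analyticOnNhd hS
  have h2 : AnalyticOnNhd ℂ f S := hf.analyticOnNhd hS
  have hin : ∀ t : ℝ, 0 < t → t < ε₀ → 1 - (t : ℂ) ^ 2 ∈ S := fun t h0 h1 => by
    refine hsub ⟨?_, ?_⟩
    · have : (1 - (t : ℂ) ^ 2) = ((1 - t ^ 2 : ℝ) : ℂ) := by push_cast; ring
      rw [mem_ball_zero_iff, this, Complex.norm_real, Real.norm_eq_abs, abs_lt]
      constructor <;> nlinarith
    · rw [mem_ball, dist_eq_norm, sub_sub_cancel_left, norm_neg, norm_pow, Complex.norm_real,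
        Real.norm_of_nonneg h0.le]
      gcongr
  have hh : 0 < ε₀ / 2 := half_pos hε₀
  refine h1.eqOn_of_preconnected_of_frequently_eq h2 hSc
    (hin (ε₀ / 2) hh (by linarith)) ?_ hs
  have ht : Tendsto (fun t : ℝ => 1 - (t : ℂ) ^ 2) (𝓝[>] (ε₀ / 2))
      (𝓝[≠] (1 - ((ε₀ / 2 : ℝ) : ℂ) ^ 2)) := by
    refine tendsto_nhdsWithin_iff.2 ⟨?_, ?_⟩
    · refine Tendsto.mono_left (Continuous.tendsto ?_ _) nhdsWithin_le_nhds
      fun_prop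
    · filter_upwards [self_mem_nhdsWithin] with t ht h
      have ht' : ε₀ / 2 < t := ht
      have h3 : ((t ^ 2 : ℝ) : ℂ) = (((ε₀ / 2) ^ 2 : ℝ) : ℂ) := by
        push_cast
        have : 1 - (t : ℂ) ^ 2 = 1 - ((ε₀ / 2 : ℝ) : ℂ) ^ 2 := h
        push_cast at this
        linear_combination -this
      have h4 := Complex.ofReal_injective h3
      nlinarith
  refine ht.frequently (Eventually.frequently ?_)
  have h5 : Iio ε₀ ∈ 𝓝[>] (ε₀ / 2) := mem_nhdsWithin_of_mem_nhds (Iio_mem_nhds (by linarith))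
  filter_upwards [self_mem_nhdsWithin, h5] with t h6 h7
  have h8 : 0 < t := hh.trans h6
  rw [sqrtOneSub_one_sub_sq h8]
  exact h t h8 h7

namespace CenteredLaw

variable {p : ℤ → ℝ}

lemma re_one_sub_mul_genFun_pos (hp : CenteredLaw p) {s z : ℂ} (hs : ‖s‖ ≤ 1) (h1 : s ≠ 1)
    (hz : ‖z‖ = 1) : 0 < (1 - s * genFun p z).re := by
  have h2 := hp.norm_genFun_le_one hz
  have h3 : ‖s * genFun p z‖ ≤ 1 := by
    rw [norm_mul]
    exact mul_le_one₀ hs (norm_nonneg _) h2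
  have h4 : s * genFun p z ≠ 1 := by
    by_cases hz1 : z = 1
    · rwa [hz1, hp.genFun_one, mul_one]
    · have h5 := hp.norm_genFun_lt_one hz hz1
      intro h
      have h6 : ‖s‖ * ‖genFun p z‖ = 1 := by rw [← norm_mul, h, norm_one]
      nlinarith [norm_nonneg s, norm_nonneg (genFun p z)]
  have := re_lt_one_of_norm_le h3 h4
  simp only [sub_re, one_re]
  linarith

/-- The logarithmic coefficients continue holomorphically across the unit circle away from `1`,
with uniform bounds: by aperiodicity `Re (1 - s φ)` is positive on the unit circle for `s ≠ 1` in
the closed disk, and by compactness it stays so nearby. -/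
lemma exists_thickening (hp : CenteredLaw p) {δ : ℝ} (hδ : 0 < δ) :
    ∃ κ C : ℝ, 0 < κ ∧ ∀ s ∈ thickening κ (closedBall (0 : ℂ) 1 \ ball 1 δ), ∀ j : ℤ,
      DifferentiableAt ℂ (logCoeff p j) s ∧ ‖logCoeff p j s‖ ≤ C := by
  set K : Set ℂ := closedBall (0 : ℂ) 1 \ ball 1 δ with hK
  have hKc : IsCompact K := (isCompact_closedBall _ _).diff isOpen_ball
  have hKs : ∀ s ∈ K, ‖s‖ ≤ 1 ∧ s ≠ 1 := fun s hs =>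
    ⟨by simpa using hs.1, fun h => hs.2 (by rw [h]; exact mem_ball_self hδ)⟩
  have hcont : ContinuousOn (fun q : ℂ × ℂ => (1 - q.1 * genFun p q.2).re)
      (K ×ˢ sphere (0 : ℂ) 1) := by
    refine Complex.continuous_re.comp_continuousOn
      (continuousOn_const.sub (continuousOn_fst.mul ?_))
    exact (hp.continuousOn_genFun_sphere one_pos).comp continuousOn_snd fun q hq => hq.2
  obtain ⟨κ, hκ, hκb⟩ : ∃ κ : ℝ, 0 < κ ∧ ∀ s ∈ K, ∀ z : ℂ, ‖z‖ = 1 →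
      κ ≤ (1 - s * genFun p z).re := by
    rcases (K ×ˢ sphere (0 : ℂ) 1).eq_empty_or_nonempty with he | hne
    · refine ⟨1, one_pos, fun s hs z hz => ?_⟩
      have : (s, z) ∈ K ×ˢ sphere (0 : ℂ) 1 := ⟨hs, by simpa using hz⟩
      rw [he] at this
      exact this.elim
    · obtain ⟨q, hq, hmin⟩ := (hKc.prod (isCompact_sphere _ _)).exists_isMinOn hne hcont
      refine ⟨_, hp.re_one_sub_mul_genFun_pos (hKs _ hq.1).1 (hKs _ hq.1).2
        (by simpa using hq.2), fun s hs z hz => ?_⟩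
      exact hmin (show (s, z) ∈ K ×ˢ sphere (0 : ℂ) 1 from ⟨hs, by simpa using hz⟩)
  set r := min (κ / 2) 1 with hr
  have hr0 : 0 < r := by positivity
  have hpert : ∀ s ∈ thickening r K, ∀ z : ℂ, ‖z‖ = 1 →
      κ / 2 ≤ (1 - s * genFun p z).re ∧ ‖1 - s * genFun p z‖ ≤ 3 := by
    intro s hs z hz
    obtain ⟨a, ha, hsa⟩ := mem_thickening_iff.1 hs
    have h1 := hκb a ha z hz
    have h2 := hp.norm_genFun_le_one hz
    rw [dist_eq_norm] at hsa
    have h3 : ‖(s - a) * genFun p z‖ ≤ ‖s - a‖ := by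
      rw [norm_mul]
      exact mul_le_of_le_one_right (norm_nonneg _) h2
    have h4 := Complex.re_le_norm ((s - a) * genFun p z)
    have h5 : (1 - s * genFun p z).re =
        (1 - a * genFun p z).re - ((s - a) * genFun p z).re := by
      rw [← sub_re]; ring_nf
    have h6 : r ≤ κ / 2 := min_le_left _ _
    have h7 : r ≤ 1 := min_le_right _ _
    constructor
    · linarith
    · have h8 : ‖s‖ ≤ 2 := by
        have := norm_sub_norm_le s a
        linarith [(hKs a ha).1]
      calc ‖1 - s * genFun p z‖ ≤ ‖(1 : ℂ)‖ + ‖s * genFun p z‖ := norm_sub_le _ _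
        _ ≤ 1 + 2 * 1 := by
            rw [norm_one, norm_mul]
            gcongr
        _ = 3 := by norm_num
  have hsl : ∀ s ∈ thickening r K, ∀ z : ℂ, ‖z‖ = 1 → 1 - s * genFun p z ∈ slitPlane :=
    fun s hs z hz => Or.inl (by linarith [(hpert s hs z hz).1])
  have hlow : ∀ s ∈ thickening r K, ∀ z : ℂ, ‖z‖ = 1 → κ / 2 ≤ ‖1 - s * genFun p z‖ :=
    fun s hs z hz => (hpert s hs z hz).1.trans (Complex.re_le_norm _)
  refine ⟨r, |Real.log (κ / 2)| + |Real.log 3| + π, hr0, fun s hs j =>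
    ⟨(hp.hasDerivAt_logCoeff isOpen_thickening (half_pos hκ) hsl hlow j hs).differentiableAt,
      norm_logCoeff_le (fun z hz => ?_) j⟩⟩
  have h1 := Complex.norm_le_abs_re_add_abs_im (Complex.log (1 - s * genFun p z))
  rw [Complex.log_re, Complex.log_im] at h1
  have h2 := Complex.abs_arg_le_pi (1 - s * genFun p z)
  have h3 : |Real.log ‖1 - s * genFun p z‖| ≤ |Real.log (κ / 2)| + |Real.log 3| := by
    have hpos : 0 < κ / 2 := half_pos hκ
    have e1 := Real.log_le_log hpos (hlow s hs z hz)
    have e2 := Real.log_le_log (hpos.trans_le (hlow s hs z hz)) (hpert s hs z hz).2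
    have e3 := neg_abs_le (Real.log (κ / 2))
    have e4 := le_abs_self (Real.log 3)
    rw [abs_le]
    constructor <;> linarith [abs_nonneg (Real.log 3), abs_nonneg (Real.log (κ / 2))]
  linarith

/-- The logarithmic coefficients `ℓ_j`, `j ≥ 0`, extend to a common neighbourhood of the closed
unit disk without `1`, with geometric bounds, and are holomorphic in `√(1 - s)` near `1`. -/
lemma exists_continuation_logCoeff (hp : CenteredLaw p) :
    ∃ (δ M : ℝ) (Λ L : ℕ → ℂ → ℂ) (Ω : Set ℂ), 0 < δ ∧ 0 ≤ M ∧ IsOpen Ω ∧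
      closedBall (0 : ℂ) 1 \ {1} ⊆ Ω ∧ Disjoint Ω ((fun t : ℝ => (t : ℂ)) '' Set.Ici 1) ∧
      slitDisk δ ⊆ Ω ∧ (∃ B, ∀ s ∈ Ω, ‖s‖ ≤ B) ∧
      (∀ j, DifferentiableOn ℂ (Λ j) (ball 0 √δ)) ∧
      (∀ j, ∀ ε ∈ ball (0 : ℂ) √δ, ‖Λ j ε‖ ≤ M * 2 ^ j) ∧
      (∀ j, HasDerivAt (Λ j) ((√2 / √(secondMoment p) : ℝ) : ℂ) 0) ∧
      (∀ j, DifferentiableOn ℂ (L j) Ω) ∧ (∀ j, ∀ s ∈ Ω, ‖L j s‖ ≤ M * 2 ^ j) ∧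
      (∀ j, ∀ s ∈ slitDisk δ, L j s = Λ j (sqrtOneSub s)) ∧
      ∀ (j : ℕ), ∀ s ∈ ball (0 : ℂ) 1, L j s = logCoeff p j s := by
  obtain ⟨ε₀, M, Λ, hε₀, hε₁, hM, hΛd, hΛb, hΛ', hΛe⟩ := hp.exists_local_logCoeff
  set δ := ε₀ ^ 2 / 2 with hδ
  have hδ0 : 0 < δ := by positivity
  obtain ⟨κ, C, hκ, hκC⟩ := hp.exists_thickening (half_pos hδ0)
  set K : Set ℂ := closedBall (0 : ℂ) 1 \ ball 1 (δ / 2) with hK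
  -- the thickening stays off the ray `[1, ∞)`, and its part over the disk of radius `δ` stays
  -- in the disk of radius `ε₀ ^ 2 = 2 * δ`
  set r := min κ (min (δ / 2) ((δ / 2) ^ 2 / 2)) with hr
  have hr0 : 0 < r := by positivity
  have hrκ : r ≤ κ := min_le_left _ _
  have hrδ : r ≤ δ / 2 := (min_le_right _ _).trans (min_le_left _ _)
  have hrδ2 : r ≤ (δ / 2) ^ 2 / 2 := (min_le_right _ _).trans (min_le_right _ _)
  have hre : ∀ a ∈ K, r ≤ 1 - a.re := by
    intro a ha
    have h1 : ‖a‖ ≤ 1 := by simpa using ha.1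
    have h2 : δ / 2 ≤ ‖a - 1‖ := by simpa [dist_eq_norm] using ha.2
    have h3 : ‖a - 1‖ ^ 2 = ‖a‖ ^ 2 - 2 * a.re + 1 := by
      rw [Complex.sq_norm, Complex.sq_norm, normSq_apply, normSq_apply]
      simp only [sub_re, one_re, sub_im, one_im]
      ring
    have h4 : (δ / 2) ^ 2 ≤ ‖a - 1‖ ^ 2 := by gcongr
    have h5 : ‖a‖ ^ 2 ≤ 1 := pow_le_one₀ (norm_nonneg _) h1
    linarith
  have hslit : ∀ a ∈ K, ∀ y ∈ ball a r, 1 - y ∈ slitPlane := by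
    intro a ha y hy
    left
    have h1 := hre a ha
    have h2 := Complex.re_le_norm (y - a)
    have h3 : ‖y - a‖ < r := by simpa [dist_eq_norm] using hy
    simp only [sub_re, one_re] at h2 ⊢
    linarith
  set Ω₀ : Set ℂ := ball 0 1 ∪ thickening r K with hΩ₀
  have hΩ₀o : IsOpen Ω₀ := isOpen_ball.union isOpen_thickening
  have hKΩ : ∀ s ∈ Ω₀, s ∉ slitDisk δ → s ∈ thickening r K := by
    rintro s (hs | hs) hsδ
    · refine self_subset_thickening hr0 _ ⟨ball_subset_closedBall hs, fun h => hsδ ?_⟩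
      rw [mem_ball_zero_iff] at hs
      refine mem_slitDisk.2 ⟨?_, one_sub_mem_slitPlane_of_norm_le hs.le fun h => by
        rw [h, norm_one] at hs; exact hs.false⟩
      rw [mem_ball, dist_comm, dist_eq_norm] at h
      linarith
    · exact hs
  have hlogd : ∀ j : ℤ, DifferentiableOn ℂ (logCoeff p j) Ω₀ := by
    rintro j s (hs | hs)
    · exact (hp.hasDerivAt_logCoeff_of_norm_lt_one j
        (mem_ball_zero_iff.1 hs)).differentiableAt.differentiableWithinAt
    · exact (hκC s (thickening_mono hrκ _ hs) j).1.differentiableWithinAt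
  have hball : ball (0 : ℂ) 1 ∩ ball 1 (ε₀ ^ 2) ⊆ slitDisk (ε₀ ^ 2) := by
    rintro y ⟨hy1, hy2⟩
    rw [mem_ball_zero_iff] at hy1
    refine mem_slitDisk.2 ⟨by rwa [mem_ball, dist_comm, dist_eq_norm] at hy2,
      one_sub_mem_slitPlane_of_norm_le hy1.le fun h => by
        rw [h, norm_one] at hy1; exact hy1.false⟩
  have hcv : Convex ℝ (ball (0 : ℂ) 1 ∩ ball 1 (ε₀ ^ 2)) := (convex_ball _ _).inter (convex_ball _ _)
  have hagree : ∀ (j : ℕ), ∀ s ∈ Ω₀, s ∈ slitDisk δ → Λ j (sqrtOneSub s) = logCoeff p j s := by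
    rintro j s (hs | hs) hsδ
    · refine eqOn_sqrtOneSub hε₀ hε₁ (isOpen_ball.inter isOpen_ball) hball hcv.isPreconnected
        ((hlogd j).mono fun y hy => Or.inl hy.1) (hΛd j) subset_rfl (hΛe j) ⟨hs, ?_⟩
      rw [mem_ball, dist_comm, dist_eq_norm]
      have := (mem_slitDisk.1 hsδ).1
      linarith
    -- the disk around `a` is convex and meets the convex set `ball 0 1 ∩ ball 1 (ε₀ ^ 2)`
    · obtain ⟨a, ha, hsa⟩ := mem_thickening_iff.1 hs
      have hsub : ball a r ⊆ slitDisk (ε₀ ^ 2) := fun y hy => by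
        refine mem_slitDisk.2 ⟨?_, hslit a ha y hy⟩
        rw [mem_ball, dist_comm] at hy
        have h1 := (mem_slitDisk.1 hsδ).1
        rw [← dist_eq_norm] at h1 ⊢
        have h2 := dist_triangle4 1 s a y
        linarith
      refine eqOn_sqrtOneSub (S := (ball 0 1 ∩ ball 1 (ε₀ ^ 2)) ∪ ball a r) hε₀ hε₁
        ((isOpen_ball.inter isOpen_ball).union isOpen_ball) (union_subset hball hsub) ?_
        ((hlogd j).mono ?_) (hΛd j) subset_union_left (hΛe j) (Or.inr hsa)
      · have hcl : a ∈ closure (ball (0 : ℂ) 1) := by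
          rw [closure_ball _ one_ne_zero]
          exact ha.1
        have hn : ball a r ∩ ball 1 (ε₀ ^ 2) ∈ 𝓝 a := by
          refine inter_mem (ball_mem_nhds a hr0) (isOpen_ball.mem_nhds ?_)
          have := (mem_slitDisk.1 (hsub (mem_ball_self hr0))).1
          rwa [mem_ball, dist_comm, dist_eq_norm]
        obtain ⟨b, hb1, hb2⟩ := mem_closure_iff_nhds.1 hcl _ hn
        exact IsPreconnected.union b ⟨hb2, hb1.2⟩ hb1.1 hcv.isPreconnected
          (convex_ball _ _).isPreconnected
      · rintro y (hy | hy)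
        · exact Or.inl hy.1
        · exact Or.inr (mem_thickening_iff.2 ⟨a, ha, hy⟩)
  classical
  set L : ℕ → ℂ → ℂ := fun j s => if s ∈ slitDisk δ then Λ j (sqrtOneSub s) else logCoeff p j s
    with hL
  have hLlog : ∀ (j : ℕ), ∀ s ∈ Ω₀, L j s = logCoeff p j s := fun j s hs => by
    simp only [hL]
    split_ifs with h
    · exact hagree j s hs h
    · rfl
  have hδε : √δ ≤ ε₀ := by
    rw [Real.sqrt_le_left hε₀.le]
    linarith [sq_nonneg ε₀]
  have hsqb : ∀ s ∈ slitDisk δ, sqrtOneSub s ∈ ball (0 : ℂ) ε₀ := fun s hs =>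
    ball_subset_ball hδε (sqrtOneSub_mem_ball hs)
  refine ⟨δ, max M C, Λ, L, Ω₀ ∪ slitDisk δ, hδ0, le_max_of_le_left hM,
    hΩ₀o.union (isOpen_slitDisk δ), ?_, ?_, subset_union_right, ⟨2 + δ + r, ?_⟩,
    fun j => (hΛd j).mono (ball_subset_ball hδε), fun j ε hε =>
      (hΛb j ε (ball_subset_ball hδε hε)).trans (by gcongr; exact le_max_left _ _),
    hΛ', fun j s hs => ?_, fun j s hs => ?_, fun j s hs => if_pos hs,
    fun j s hs => hLlog j s (Or.inl hs)⟩
  · rintro s ⟨hs, hs1⟩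
    by_cases h : s ∈ ball 1 (δ / 2)
    · right
      rw [mem_ball, dist_comm, dist_eq_norm] at h
      exact mem_slitDisk.2 ⟨by linarith,
        one_sub_mem_slitPlane_of_norm_le (mem_closedBall_zero_iff.1 hs) hs1⟩
    · exact Or.inl (Or.inr (self_subset_thickening hr0 _ ⟨hs, h⟩))
  · rw [Set.disjoint_left]
    rintro _ hs ⟨t, ht, rfl⟩
    have ht1 : (1 : ℝ) ≤ t := ht
    have hns : 1 - (t : ℂ) ∉ slitPlane := by
      rw [mem_slitPlane_iff_not_le_zero, not_not, ← ofReal_one, ← ofReal_sub, ← ofReal_zero,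
        Complex.real_le_real]
      linarith
    rcases hs with (hs | hs) | hs
    · rw [mem_ball_zero_iff, Complex.norm_real, Real.norm_of_nonneg (by linarith)] at hs
      linarith
    · obtain ⟨a, ha, hsa⟩ := mem_thickening_iff.1 hs
      exact hns (hslit a ha _ hsa)
    · exact hns (mem_slitDisk.1 hs).2
  · rintro s ((hs | hs) | hs)
    · rw [mem_ball_zero_iff] at hs
      linarith
    · obtain ⟨a, ha, hsa⟩ := mem_thickening_iff.1 hs
      have h1 : ‖a‖ ≤ 1 := by simpa using ha.1
      rw [dist_eq_norm] at hsa
      have := norm_sub_norm_le s a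
      linarith
    · have h1 := (mem_slitDisk.1 hs).1
      have := norm_sub_norm_le s 1
      rw [norm_sub_rev, norm_one] at this
      linarith
  · by_cases h : s ∈ slitDisk δ
    · have h1 : DifferentiableAt ℂ (fun s => Λ j (sqrtOneSub s)) s :=
        ((hΛd j).differentiableAt (isOpen_ball.mem_nhds (hsqb s h))).comp s
          ((differentiableOn_sqrtOneSub δ).differentiableAt ((isOpen_slitDisk δ).mem_nhds h))
      refine (h1.congr_of_eventuallyEq ?_).differentiableWithinAt
      filter_upwards [(isOpen_slitDisk δ).mem_nhds h] with y hy
      exact if_pos hy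
    · have hs' : s ∈ Ω₀ := hs.resolve_right h
      refine (((hlogd j).differentiableAt (hΩ₀o.mem_nhds hs')).congr_of_eventuallyEq
        ?_).differentiableWithinAt
      filter_upwards [hΩ₀o.mem_nhds hs'] with y hy
      exact hLlog j y hy
  · by_cases h : s ∈ slitDisk δ
    · simp only [hL, if_pos h]
      refine (hΛb j _ (hsqb s h)).trans ?_
      gcongr
      exact le_max_left _ _
    · simp only [hL, if_neg h]
      have h1 := (hκC s (thickening_mono hrκ _ (hKΩ s (hs.resolve_right h) h)) j).2
      have h2 : (1 : ℝ) ≤ 2 ^ j := one_le_pow₀ one_le_two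
      have h3 : 0 ≤ max M C := le_max_of_le_left hM
      calc _ ≤ C := h1
        _ ≤ max M C * 1 := by rw [mul_one]; exact le_max_right _ _
        _ ≤ _ := by gcongr

end CenteredLaw

/-! ### Expansion of the exit generating function -/

/-- The coefficients of `exp (-∑_{j ≥ m} ℓ j z ^ j)`, for `m = 0` or `m = 1`. They are those of
`killedGreen` when `ℓ j` is `logCoeff p j s`. -/
noncomputable def greenCoeff (m : ℤ) (ℓ : ℕ → ℂ) (n : ℕ) : ℂ :=
  Complex.exp (-if m = 0 then ℓ 0 else 0) * expCoeff ℓ n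

/-- The generating function at time-parameter `s` of the exit from `[m, ∞)` at `x`, expressed
through the logarithmic coefficients `ℓ`. -/
noncomputable def exitGen (p : ℤ → ℝ) (m : ℤ) (ℓ : ℕ → ℂ) (s : ℂ) (x : ℤ) : ℂ :=
  if x < m then s * ∑' n : ℕ, greenCoeff m ℓ n * p (x - n) else 0

lemma differentiableOn_greenCoeff {L : ℕ → ℂ → ℂ} {U : Set ℂ} (m : ℤ)
    (h : ∀ j, DifferentiableOn ℂ (L j) U) (n : ℕ) :
    DifferentiableOn ℂ (fun x => greenCoeff m (fun j => L j x) n) U := by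
  refine DifferentiableOn.mul (DifferentiableOn.cexp (DifferentiableOn.neg ?_))
    (differentiableOn_expCoeff h n)
  split_ifs
  · exact h 0
  · exact differentiableOn_const _

/-- At `m = 0` the factor `exp (-ℓ 0)` contributes the additional term `i = n`. -/
lemma hasDerivAt_greenCoeff {L : ℕ → ℂ → ℂ} {x c : ℂ} {m : ℤ} (hm : m = 0 ∨ m = 1)
    (h : ∀ j, HasDerivAt (L j) c x) (n : ℕ) :
    HasDerivAt (fun x => greenCoeff m (fun j => L j x) n)
      (-c * ∑ i ∈ Finset.range (n + 1 - m.toNat), greenCoeff m (fun j => L j x) i) x := by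
  simp only [greenCoeff, ← Finset.mul_sum]
  have h1 := hasDerivAt_expCoeff h n
  rcases hm with rfl | rfl
  · simp only [if_true]
    refine ((h 0).neg.cexp.mul h1).congr_deriv ?_
    rw [Int.toNat_zero, Nat.sub_zero, Finset.sum_range_succ]
    simp only [Pi.neg_apply]
    ring
  · simp only [one_ne_zero, if_false]
    refine (h1.const_mul _).congr_deriv ?_
    simp only [Int.toNat_one, Nat.add_sub_cancel]
    ring

lemma norm_greenCoeff_le {ℓ : ℕ → ℂ} {M : ℝ} (hM : 0 ≤ M) (h : ∀ j, ‖ℓ j‖ ≤ M * 2 ^ j) (m : ℤ)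
    (n : ℕ) : ‖greenCoeff m ℓ n‖ ≤ Real.exp M * (2 * (1 + M)) ^ n := by
  rw [greenCoeff, norm_mul]
  gcongr
  · rw [Complex.norm_exp]
    refine Real.exp_le_exp.2 ((Complex.re_le_norm _).trans ?_)
    rw [norm_neg]
    split_ifs
    · simpa using h 0
    · simpa using hM
  · exact norm_expCoeff_le hM h n

/-- A Cauchy-type bound for the difference quotient of a bounded holomorphic function. -/
lemma norm_dslope_le {g : ℂ → ℂ} {R C : ℝ} (hC : 0 < C) (hg : DifferentiableOn ℂ g (ball 0 R))
    (hb : ∀ ε ∈ ball (0 : ℂ) R, ‖g ε‖ ≤ C) {ε : ℂ} (hε : ε ∈ ball (0 : ℂ) R) :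
    ‖dslope g 0 ε‖ ≤ 3 * C / R := by
  refine Complex.norm_dslope_le_div_of_mapsTo_ball hg (fun y hy => ?_) hε
  have hR : 0 < R := (norm_nonneg ε).trans_lt (by simpa using hε)
  rw [mem_closedBall, dist_eq_norm]
  linarith [norm_sub_le (g y) (g 0), hb y hy, hb 0 (mem_ball_self hR)]

lemma eq_add_mul_dslope_dslope (g : ℂ → ℂ) (ε : ℂ) :
    g ε = g 0 + ε * deriv g 0 + ε ^ 2 * dslope (dslope g 0) 0 ε := by
  have h1 := sub_smul_dslope g 0 ε
  have h2 := sub_smul_dslope (dslope g 0) 0 ε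
  rw [dslope_same] at h2
  simp only [sub_zero, smul_eq_mul] at h1 h2
  linear_combination -h1 - ε * h2

lemma summable_geometric_half_mul (A : ℝ) : Summable fun n : ℕ => A * (1 / 2 : ℝ) ^ n :=
  summable_geometric_two.mul_left A

namespace CenteredLaw

variable {p : ℤ → ℝ}

lemma exists_decay (hp : CenteredLaw p) {Q : ℝ} (hQ : 0 < Q) :
    ∃ A : ℝ, 0 < A ∧ ∀ k : ℤ, Q ^ k.natAbs * p k ≤ A := by
  have h1 := (hp.exp_moments Q hQ).add (hp.exp_moments Q⁻¹ (inv_pos.2 hQ))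
  have h0 : ∀ k : ℤ, 0 ≤ Q ^ k * p k + Q⁻¹ ^ k * p k := fun k => by
    have := hp.nonneg k
    positivity
  refine ⟨∑' k : ℤ, (Q ^ k * p k + Q⁻¹ ^ k * p k) + 1,
    add_pos_of_nonneg_of_pos (tsum_nonneg h0) one_pos, fun k => ?_⟩
  have h2 := h1.le_tsum k fun j _ => h0 j
  have h3 := mul_le_mul_of_nonneg_right (pow_natAbs_le_zpow hQ k) (hp.nonneg k)
  linarith

/-- The decay of the law beats the geometric growth of the coefficients, uniformly. The points
`x ≤ 0` and `-n` lie on the same side of `0`, so `|x - n| = |x| + n`. -/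
lemma exists_norm_greenCoeff_mul_le (hp : CenteredLaw p) (m : ℤ) {M K : ℝ} (hM : 0 ≤ M)
    (hK : 1 ≤ K) : ∃ A : ℝ, 0 < A ∧ ∀ ℓ : ℕ → ℂ, (∀ j, ‖ℓ j‖ ≤ M * 2 ^ j) →
      ∀ x : ℤ, x ≤ 0 → ∀ n i : ℕ, i ≤ n →
        K ^ x.natAbs * ‖greenCoeff m ℓ i * p (x - n)‖ ≤ A * (1 / 2) ^ n := by
  set R := 2 * (1 + M) with hR
  have hR1 : 1 ≤ R := by linarith
  -- `R` is the growth rate in `norm_greenCoeff_le`, and the factor `2` leaves `(1 / 2) ^ n`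
  obtain ⟨A, hA, hAb⟩ := hp.exists_decay (Q := K * (2 * R)) (by positivity)
  refine ⟨Real.exp M * A, by positivity, fun ℓ hℓ x hx n i hi => ?_⟩
  have h1 := norm_greenCoeff_le hM hℓ m i
  have h2 := hAb (x - n)
  have h3 : (x - n).natAbs = x.natAbs + n := by omega
  have hp0 := hp.nonneg (x - n)
  rw [h3, mul_pow, pow_add K, pow_add (2 * R), mul_pow 2 R n] at h2
  have h4 : (1 : ℝ) ≤ K ^ n := one_le_pow₀ hK
  have h5 : (1 : ℝ) ≤ (2 * R) ^ x.natAbs := one_le_pow₀ (by linarith)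
  have h6 : R ^ i ≤ R ^ n := pow_le_pow_right₀ hR1 hi
  have h7 : K ^ x.natAbs * R ^ n * p (x - n) ≤ A * (1 / 2) ^ n := by
    rw [one_div, inv_pow, ← div_eq_mul_inv, le_div_iff₀ (by positivity)]
    refine le_trans ?_ h2
    calc K ^ x.natAbs * R ^ n * p (x - n) * 2 ^ n
        = K ^ x.natAbs * 1 * (1 * (2 ^ n * R ^ n)) * p (x - n) := by ring
      _ ≤ _ := by gcongr
  rw [norm_mul, Complex.norm_real, Real.norm_of_nonneg hp0]
  calc K ^ x.natAbs * (‖greenCoeff m ℓ i‖ * p (x - n))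
      ≤ K ^ x.natAbs * (Real.exp M * R ^ i * p (x - n)) := by gcongr
    _ ≤ K ^ x.natAbs * (Real.exp M * R ^ n * p (x - n)) := by gcongr
    _ = Real.exp M * (K ^ x.natAbs * R ^ n * p (x - n)) := by ring
    _ ≤ Real.exp M * (A * (1 / 2) ^ n) := by gcongr
    _ = _ := by ring

lemma summable_norm_greenCoeff_mul (hp : CenteredLaw p) (m : ℤ) {M : ℝ} (hM : 0 ≤ M) {ℓ : ℕ → ℂ}
    (hℓ : ∀ j, ‖ℓ j‖ ≤ M * 2 ^ j) {x : ℤ} (hx : x ≤ 0) :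
    Summable fun n : ℕ => ‖greenCoeff m ℓ n * p (x - n)‖ := by
  obtain ⟨A, -, hA⟩ := hp.exists_norm_greenCoeff_mul_le m hM le_rfl
  refine Summable.of_nonneg_of_le (fun _ => norm_nonneg _) (fun n => ?_)
    (summable_geometric_half_mul A)
  simpa using hA ℓ hℓ x hx n n le_rfl

lemma exists_norm_exitGen_le (hp : CenteredLaw p) {m : ℤ} (hm : m ≤ 1) {M K B : ℝ} (hM : 0 ≤ M)
    (hK : 1 ≤ K) (hB : 0 < B) : ∃ C : ℝ, 0 < C ∧ ∀ ℓ : ℕ → ℂ, (∀ j, ‖ℓ j‖ ≤ M * 2 ^ j) →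
      ∀ s : ℂ, ‖s‖ ≤ B → ∀ x : ℤ, K ^ x.natAbs * ‖exitGen p m ℓ s x‖ ≤ C := by
  obtain ⟨A, hA0, hA⟩ := hp.exists_norm_greenCoeff_mul_le m hM hK
  refine ⟨B * (2 * A), by positivity, fun ℓ hℓ s hs x => ?_⟩
  rw [exitGen]
  split_ifs with hx
  · have hx0 : x ≤ 0 := by omega
    have h1 := hp.summable_norm_greenCoeff_mul m hM hℓ hx0
    have h2 : K ^ x.natAbs * ‖∑' n : ℕ, greenCoeff m ℓ n * p (x - n)‖ ≤ 2 * A := by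
      calc _ ≤ K ^ x.natAbs * ∑' n : ℕ, ‖greenCoeff m ℓ n * p (x - n)‖ := by
            gcongr
            exact norm_tsum_le_tsum_norm h1
        _ = ∑' n : ℕ, K ^ x.natAbs * ‖greenCoeff m ℓ n * p (x - n)‖ := tsum_mul_left.symm
        _ ≤ ∑' n : ℕ, A * (1 / 2) ^ n :=
            (h1.mul_left _).tsum_le_tsum (fun n => hA ℓ hℓ x hx0 n n le_rfl)
              (summable_geometric_half_mul A)
        _ = 2 * A := by rw [tsum_mul_left, tsum_geometric_two, mul_comm]
    rw [norm_mul]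
    calc _ = ‖s‖ * (K ^ x.natAbs * ‖∑' n : ℕ, greenCoeff m ℓ n * p (x - n)‖) := by ring
      _ ≤ _ := by gcongr
  · rw [norm_zero, mul_zero]
    positivity

lemma differentiableOn_exitGen (hp : CenteredLaw p) {m : ℤ} (hm : m ≤ 1) {M : ℝ} (hM : 0 ≤ M)
    {U : Set ℂ} (hU : IsOpen U) {L : ℕ → ℂ → ℂ} {f : ℂ → ℂ} (hL : ∀ j, DifferentiableOn ℂ (L j) U)
    (hLb : ∀ j, ∀ y ∈ U, ‖L j y‖ ≤ M * 2 ^ j) (hf : DifferentiableOn ℂ f U) (x : ℤ) :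
    DifferentiableOn ℂ (fun y => exitGen p m (fun j => L j y) (f y) x) U := by
  obtain ⟨A, -, hA⟩ := hp.exists_norm_greenCoeff_mul_le m hM le_rfl
  simp only [exitGen]
  split_ifs with hx
  · refine hf.mul (differentiableOn_tsum_of_summable_norm (summable_geometric_half_mul A)
      (fun n => (differentiableOn_greenCoeff m hL n).mul_const _) hU fun n y hy => ?_)
    simpa using hA _ (fun j => hLb j y hy) x (by omega) n n le_rfl
  · exact differentiableOn_const _

/-- Rearrangement of `∑_{i, j} G i p(x - m - i - j)` along `n = m + i + j`. -/
lemma tsum_exitGen_shift (hp : CenteredLaw p) {m : ℤ} (hm : m = 0 ∨ m = 1) {M : ℝ} (hM : 0 ≤ M)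
    {ℓ : ℕ → ℂ} (hℓ : ∀ j, ‖ℓ j‖ ≤ M * 2 ^ j) {x : ℤ} (hx : x < m) :
    ∑' j : ℕ, exitGen p m ℓ 1 (x - m - j) = ∑' n : ℕ,
      (∑ i ∈ Finset.range (n + 1 - m.toNat), greenCoeff m ℓ i) * p (x - n) := by
  obtain ⟨A, hA0, hA⟩ := hp.exists_norm_greenCoeff_mul_le m hM le_rfl
  have hs : Summable fun q : ℕ × ℕ => greenCoeff m ℓ q.1 * p (x - m - (q.1 + q.2 : ℕ)) := by
    have hg := (summable_geometric_half_mul A).mul_of_nonneg summable_geometric_two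
      (fun n => by positivity) (fun n => by positivity)
    refine Summable.of_norm_bounded hg fun q => ?_
    have h2 := hA ℓ hℓ (x - m) (by omega) (q.1 + q.2) q.1 (Nat.le_add_right _ _)
    rw [one_pow, one_mul] at h2
    rw [mul_assoc, ← pow_add]
    exact h2
  have h1 : ∑' q : ℕ × ℕ, greenCoeff m ℓ q.1 * (p (x - m - (q.1 + q.2 : ℕ)) : ℂ) =
      ∑' n : ℕ, (∑ i ∈ Finset.range (n + 1), greenCoeff m ℓ i) * p (x - m - n) := by
    rw [← Finset.HasAntidiagonal.sigmaAntidiagonalEquivProd.tsum_eq]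
    have hs' := (Finset.HasAntidiagonal.sigmaAntidiagonalEquivProd (A := ℕ)).summable_iff.2 hs
    refine (hs'.tsum_sigma' fun n => (hasSum_fintype _).summable).trans (tsum_congr fun n => ?_)
    simp only [Function.comp]
    rw [tsum_fintype, Finset.sum_mul]
    simp only [Finset.HasAntidiagonal.sigmaAntidiagonalEquivProd_apply]
    rw [Finset.univ_eq_attach, Finset.sum_attach (Finset.HasAntidiagonal.antidiagonal n)
      fun q : ℕ × ℕ => greenCoeff m ℓ q.1 * (p (x - m - (q.1 + q.2 : ℕ)) : ℂ),
      Finset.Nat.sum_antidiagonal_eq_sum_range_succ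
        fun i j : ℕ => greenCoeff m ℓ i * (p (x - m - (i + j : ℕ)) : ℂ)]
    refine Finset.sum_congr rfl fun i hi => ?_
    have : i + (n - i) = n := by
      have := Finset.mem_range.1 hi
      omega
    rw [this]
  have h2 : ∑' j : ℕ, exitGen p m ℓ 1 (x - m - j) =
      ∑' q : ℕ × ℕ, greenCoeff m ℓ q.1 * (p (x - m - (q.1 + q.2 : ℕ)) : ℂ) := by
    rw [← (Equiv.prodComm ℕ ℕ).tsum_eq]
    have hs' : Summable fun q : ℕ × ℕ => greenCoeff m ℓ q.2 * (p (x - m - (q.2 + q.1 : ℕ)) : ℂ) :=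
      hs.prod_symm
    refine Eq.trans (tsum_congr fun j => ?_) hs'.tsum_prod.symm
    rw [exitGen, if_pos (by omega), one_mul]
    refine tsum_congr fun i => ?_
    push_cast
    rw [sub_sub, sub_sub, sub_sub, add_comm (j : ℤ)]
  rw [h2, h1]
  rcases hm with rfl | rfl
  · simp
  · have h3 : ∀ f : ℕ → ℂ, f 0 = 0 → ∑' n, f (n + 1) = ∑' n, f n := fun f hf => by
      rw [← (Nat.succ_injective).tsum_eq (f := f)]
      intro n hn
      cases n with
      | zero => exact absurd hf hn
      | succ n => exact ⟨n, rfl⟩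
    rw [← h3 (fun n : ℕ =>
      (∑ i ∈ Finset.range (n + 1 - (1 : ℤ).toNat), greenCoeff 1 ℓ i) * (p (x - n) : ℂ)) (by simp)]
    refine tsum_congr fun n => ?_
    simp only [Int.toNat_one, Nat.add_sub_cancel]
    push_cast
    rw [sub_sub, add_comm (1 : ℤ)]

/-- If all the logarithmic coefficients have the velocity `c` at `0`, then the derivative of the
exit generating function there is `-c` times a tail of its value. -/
lemma deriv_exitGen (hp : CenteredLaw p) {m : ℤ} (hm : m = 0 ∨ m = 1) {M r : ℝ} (hM : 0 ≤ M)
    (hr : 0 < r) {L : ℕ → ℂ → ℂ} {c : ℂ} (hL : ∀ j, DifferentiableOn ℂ (L j) (ball 0 r))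
    (hLb : ∀ j, ∀ y ∈ ball (0 : ℂ) r, ‖L j y‖ ≤ M * 2 ^ j) (hc : ∀ j, HasDerivAt (L j) c 0)
    (x : ℤ) : deriv (fun ε => exitGen p m (fun j => L j ε) (1 - ε ^ 2) x) 0 =
      -c * if x < m then ∑' j : ℕ, exitGen p m (fun j => L j 0) 1 (x - m - j) else 0 := by
  obtain ⟨A, -, hA⟩ := hp.exists_norm_greenCoeff_mul_le m hM le_rfl
  simp only [exitGen.eq_1 p m _ _ x]
  split_ifs with hx
  · have h0 : (0 : ℂ) ∈ ball (0 : ℂ) r := mem_ball_self hr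
    have hx0 : x ≤ 0 := by omega
    have hd : ∀ n : ℕ, DifferentiableOn ℂ
        (fun ε => greenCoeff m (fun j => L j ε) n * (p (x - n) : ℂ)) (ball 0 r) :=
      fun n => (differentiableOn_greenCoeff m hL n).mul_const _
    have hb : ∀ (n : ℕ) (ε : ℂ), ε ∈ ball (0 : ℂ) r →
        ‖greenCoeff m (fun j => L j ε) n * (p (x - n) : ℂ)‖ ≤ A * (1 / 2) ^ n :=
      fun n ε hε => by simpa using hA _ (fun j => hLb j ε hε) x hx0 n n le_rfl
    have h1 := hasSum_deriv_of_summable_norm (summable_geometric_half_mul A) hd isOpen_ball hb h0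
    have h2 := (differentiableOn_tsum_of_summable_norm (summable_geometric_half_mul A) hd
      isOpen_ball hb).differentiableAt (isOpen_ball.mem_nhds h0)
    have h3 : HasDerivAt (fun ε : ℂ => 1 - ε ^ 2) 0 0 := by
      simpa using ((hasDerivAt_id (0 : ℂ)).pow 2).const_sub 1
    have h4 := (h3.mul h2.hasDerivAt).deriv
    rw [zero_mul, zero_add, zero_pow two_ne_zero, sub_zero, one_mul] at h4
    refine Eq.trans h4 ?_
    rw [hp.tsum_exitGen_shift hm hM (fun j => hLb j 0 h0) hx, ← tsum_mul_left, ← h1.tsum_eq]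
    refine tsum_congr fun n => ?_
    rw [((hasDerivAt_greenCoeff hm hc n).mul_const _).deriv]
    ring
  · simp

/-- The analytic half of the theorem, for the exit of `[m, ∞)`, `m = 0` or `m = 1`. The function
`T x` is the generating function of the exit at `x`, and `w x` the probability of this exit. Near `1`
it is a function `g x` of `ε = √(1 - s)`, the sum of its expansion of order one and of `ε ^ 2` times a
second difference quotient, which is the remainder `O x`. -/
theorem exists_exit_expansion (hp : CenteredLaw p) {m : ℤ} (hm : m = 0 ∨ m = 1) :
    ∃ (Ω : Set ℂ) (δ : ℝ) (T O : ℤ → ℂ → ℂ) (w : ℤ → ℂ), IsOpen Ω ∧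
      closedBall (0 : ℂ) 1 \ {1} ⊆ Ω ∧ Disjoint Ω ((fun t : ℝ => (t : ℂ)) '' Set.Ici 1) ∧
      0 < δ ∧ slitDisk δ ⊆ Ω ∧ (∀ x, AnalyticOnNhd ℂ (T x) Ω) ∧
      (∀ x, AnalyticInSqrt δ (T x)) ∧ (∀ x, AnalyticInSqrt δ (O x)) ∧
      (∀ x, ∀ s ∈ Ω, T x s = w x - sqrtOneSub s * ((√2 / √(secondMoment p) : ℝ) : ℂ) *
        (if x < m then ∑' j : ℕ, w (x - m - j) else 0) + (1 - s) * O x s) ∧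
      (∀ K : ℝ, 1 ≤ K → ∃ C : ℝ, 0 < C ∧ ∀ x : ℤ, ∀ s ∈ Ω,
        K ^ x.natAbs * ‖T x s‖ ≤ C ∧ K ^ x.natAbs * ‖O x s‖ ≤ C) ∧
      (∀ x < m, ∀ s ∈ ball (0 : ℂ) 1, T x s = s * ∑' n : ℕ, killedGreen p m s n * p (x - n)) ∧
      (∀ x, m ≤ x → ∀ s, T x s = 0) ∧
      ∀ x, Tendsto (fun t : ℝ => T x t) (𝓝[<] 1) (𝓝 (w x)) := by
  obtain ⟨δ, M, Λ, L, Ω, hδ, hM, hΩ, hcb, hdis, hsub, ⟨B, hB⟩, hΛd, hΛb, hΛ', hLd, hLb, hLΛ, hLℓ⟩ :=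
    hp.exists_continuation_logCoeff
  have hm1 : m ≤ 1 := by omega
  set c : ℂ := ((√2 / √(secondMoment p) : ℝ) : ℂ) with hc
  set g : ℤ → ℂ → ℂ := fun x ε => exitGen p m (fun j => Λ j ε) (1 - ε ^ 2) x with hg
  set T : ℤ → ℂ → ℂ := fun x s => exitGen p m (fun j => L j s) s x with hT
  set t : ℤ → ℂ := fun x => if x < m then ∑' j : ℕ, g (x - m - j) 0 else 0 with ht
  set O : ℤ → ℂ → ℂ := fun x s => (T x s - g x 0 + sqrtOneSub s * c * t x) / (1 - s) with hO
  have hδ' : 0 < √δ := Real.sqrt_pos.2 hδ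
  have hTg : ∀ x, ∀ s ∈ slitDisk δ, T x s = g x (sqrtOneSub s) := fun x s hs => by
    simp only [hT, hg]
    rw [sqrtOneSub_sq, sub_sub_cancel]
    congr 1
    ext j
    exact hLΛ j s hs
  have hgd : ∀ x, DifferentiableOn ℂ (g x) (ball 0 √δ) := fun x =>
    hp.differentiableOn_exitGen hm1 hM isOpen_ball hΛd hΛb (by fun_prop) x
  have hg' : ∀ x, deriv (g x) 0 = -c * t x := fun x => by
    have := hp.deriv_exitGen hm hM hδ' hΛd hΛb hΛ' x
    simp only [hg, ht]
    rw [this, zero_pow two_ne_zero, sub_zero]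
  have hdd : ∀ x, DifferentiableOn ℂ (dslope (g x) 0) (ball 0 √δ) := fun x =>
    (Complex.differentiableOn_dslope (ball_mem_nhds _ hδ')).2 (hgd x)
  have hddd : ∀ x, DifferentiableOn ℂ (dslope (dslope (g x) 0) 0) (ball 0 √δ) := fun x =>
    (Complex.differentiableOn_dslope (ball_mem_nhds _ hδ')).2 (hdd x)
  have hne : ∀ s ∈ Ω, 1 - s ≠ 0 := fun s hs h => by
    refine Set.disjoint_left.1 hdis hs ⟨1, Set.self_mem_Ici, ?_⟩
    simpa using sub_eq_zero.1 h
  have hOg : ∀ x, ∀ s ∈ slitDisk δ, O x s = dslope (dslope (g x) 0) 0 (sqrtOneSub s) := by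
    intro x s hs
    simp only [hO]
    rw [div_eq_iff (hne s (hsub hs)), hTg x s hs, eq_add_mul_dslope_dslope (g x) (sqrtOneSub s),
      hg', sqrtOneSub_sq]
    ring
  have hoff : ∀ s ∈ Ω, s ∉ slitDisk δ → δ ≤ ‖1 - s‖ := by
    intro s hs hsδ
    by_contra! h
    refine hsδ ⟨by rwa [mem_ball, dist_comm, dist_eq_norm], ?_⟩
    rintro ⟨u, hu, rfl⟩
    exact Set.disjoint_left.1 hdis hs ⟨u, hu.1, rfl⟩
  refine ⟨Ω, δ, T, O, fun x => g x 0, hΩ, hcb, hdis, hδ, hsub, fun x => ?_, fun x => ?_,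
    fun x => ?_, fun x s hs => ?_, fun K hK => ?_, fun x hx s hs => ?_, fun x hx s => ?_,
    fun x => ?_⟩
  · exact (hp.differentiableOn_exitGen hm1 hM hΩ hLd hLb differentiableOn_id x).analyticOnNhd hΩ
  · exact ⟨g x, (hgd x).analyticOnNhd isOpen_ball, hTg x⟩
  · exact ⟨_, (hddd x).analyticOnNhd isOpen_ball, hOg x⟩
  · have h1 := hne s hs
    simp only [hO]
    rw [mul_div_cancel₀ _ h1]
    simp only [ht]
    ring
  -- on the slit disk the remainder is bounded by the Schwarz lemma, elsewhere `|1 - s| ≥ δ`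
  · obtain ⟨C, hC, hCb⟩ := hp.exists_norm_exitGen_le hm1 hM hK (B := |B| + 1 + δ) (by positivity)
    have hTb : ∀ x, ∀ s ∈ Ω, K ^ x.natAbs * ‖T x s‖ ≤ C := fun x s hs =>
      hCb _ (fun j => hLb j s hs) s (by linarith [hB s hs, le_abs_self B]) x
    have hgb : ∀ x, ∀ ε ∈ ball (0 : ℂ) √δ, ‖g x ε‖ ≤ C / K ^ x.natAbs := fun x ε hε => by
      rw [le_div_iff₀ (by positivity), mul_comm]
      refine hCb _ (fun j => hΛb j ε hε) _ ?_ x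
      have h1 : ‖ε‖ ^ 2 < δ := by
        rw [mem_ball_zero_iff] at hε
        exact (Real.lt_sqrt (norm_nonneg _)).1 hε
      have h2 := norm_sub_le (1 : ℂ) (ε ^ 2)
      rw [norm_one, norm_pow] at h2
      linarith [abs_nonneg B]
    have hdb : ∀ x, ∀ ε ∈ ball (0 : ℂ) √δ, ‖dslope (g x) 0 ε‖ ≤ 3 * (C / K ^ x.natAbs) / √δ :=
      fun x ε hε => norm_dslope_le (by positivity) (hgd x) (hgb x) hε
    have hddb : ∀ x, ∀ ε ∈ ball (0 : ℂ) √δ, ‖dslope (dslope (g x) 0) 0 ε‖ ≤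
        3 * (3 * (C / K ^ x.natAbs) / √δ) / √δ :=
      fun x ε hε => norm_dslope_le (by positivity) (hdd x) (hdb x) hε
    have h0 : (0 : ℂ) ∈ ball (0 : ℂ) √δ := mem_ball_self hδ'
    set C₁ := 9 * C / δ with hC₁
    set C₂ := (C + C + √(1 + |B|) * (3 * C / √δ)) / δ with hC₂
    refine ⟨C + C₁ + C₂, by positivity, fun x s hs => ⟨?_, ?_⟩⟩
    · have h1 : 0 ≤ C₁ := by positivity
      have h2 : 0 ≤ C₂ := by positivity
      linarith [hTb x s hs]
    · have hKp : 0 < K ^ x.natAbs := by positivity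
      by_cases hsδ : s ∈ slitDisk δ
      · rw [hOg x s hsδ]
        have h1 := hddb x _ (sqrtOneSub_mem_ball hsδ)
        have h2 : 0 ≤ C₂ := by positivity
        have h3 : K ^ x.natAbs * (3 * (3 * (C / K ^ x.natAbs) / √δ) / √δ) = C₁ := by
          rw [hC₁]
          field_simp
          rw [Real.sq_sqrt hδ.le]
          ring
        have h4 := mul_le_mul_of_nonneg_left h1 hKp.le
        rw [h3] at h4
        linarith
      · have h1 := hoff s hs hsδ
        have h2 : 0 ≤ C₁ := by positivity
        have h3 : ‖sqrtOneSub s‖ ≤ √(1 + |B|) := by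
          rw [norm_sqrtOneSub]
          refine Real.sqrt_le_sqrt ((norm_sub_le _ _).trans ?_)
          rw [norm_one]
          linarith [hB s hs, le_abs_self B]
        have h4 : K ^ x.natAbs * ‖c * t x‖ ≤ 3 * C / √δ := by
          have h5 := hdb x 0 h0
          rw [dslope_same, hg', neg_mul, norm_neg] at h5
          have h6 := mul_le_mul_of_nonneg_left h5 hKp.le
          have h7 : K ^ x.natAbs * (3 * (C / K ^ x.natAbs) / √δ) = 3 * C / √δ := by
            field_simp
          rwa [h7] at h6
        have h5 : K ^ x.natAbs * ‖g x 0‖ ≤ C := by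
          have := hgb x 0 h0
          rwa [le_div_iff₀ hKp, mul_comm] at this
        have h6 : K ^ x.natAbs * ‖O x s‖ ≤ C₂ := by
          simp only [hO]
          rw [norm_div, ← mul_div_assoc, hC₂]
          gcongr
          calc K ^ x.natAbs * ‖T x s - g x 0 + sqrtOneSub s * c * t x‖
              ≤ K ^ x.natAbs * (‖T x s‖ + ‖g x 0‖ + ‖sqrtOneSub s‖ * ‖c * t x‖) := by
                gcongr
                refine (norm_add_le _ _).trans (add_le_add (norm_sub_le _ _) ?_)
                rw [mul_assoc, norm_mul]
            _ = K ^ x.natAbs * ‖T x s‖ + K ^ x.natAbs * ‖g x 0‖ +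
                ‖sqrtOneSub s‖ * (K ^ x.natAbs * ‖c * t x‖) := by ring
            _ ≤ _ := by
                gcongr
                exact hTb x s hs
        linarith
  · simp only [hT, exitGen, if_pos hx]
    congr 1
    refine tsum_congr fun n => ?_
    rw [hp.killedGreen_eq hm (mem_ball_zero_iff.1 hs), greenCoeff,
      funext fun j => hLℓ j s hs, hLℓ 0 s hs]
    rfl
  · simp only [hT, exitGen, if_neg (not_lt.2 hx)]
  · have h1 : Tendsto (fun t : ℝ => sqrtOneSub t) (𝓝[<] 1) (𝓝 0) := by
      rw [tendsto_zero_iff_norm_tendsto_zero]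
      simp only [norm_sqrtOneSub]
      refine Tendsto.mono_left ?_ nhdsWithin_le_nhds
      have : Continuous fun t : ℝ => √‖1 - (t : ℂ)‖ := by fun_prop
      simpa using this.tendsto 1
    have h2 := ((hgd x).differentiableAt (ball_mem_nhds _ hδ')).continuousAt.tendsto.comp h1
    refine h2.congr' ?_
    have h3 : Ioi (1 - δ) ∈ 𝓝[<] (1 : ℝ) :=
      mem_nhdsWithin_of_mem_nhds (Ioi_mem_nhds (by linarith))
    filter_upwards [self_mem_nhdsWithin, h3] with u hu hu'
    have hu1 : u < 1 := hu
    have hu2 : 1 - δ < u := hu'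
    refine (hTg x u (mem_slitDisk.2 ?_)).symm
    have : 1 - (u : ℂ) = ((1 - u : ℝ) : ℂ) := by push_cast; rfl
    rw [this, Complex.norm_real, Real.norm_of_nonneg (by linarith)]
    exact ⟨by linarith, Complex.ofReal_mem_slitPlane.2 (by linarith)⟩

end CenteredLaw

/-! ### Exit times of the random walk -/

lemma hasSum_measureReal_iUnion {α ι : Type*} [MeasurableSpace α] [Countable ι] (P : Measure α)
    [IsFiniteMeasure P] {A : ι → Set α} (hA : ∀ i, MeasurableSet (A i))
    (hd : Pairwise (Function.onFun Disjoint A)) :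
    HasSum (fun i => P.real (A i)) (P.real (⋃ i, A i)) := by
  have h1 := measure_iUnion hd hA (μ := P)
  have h2 : ∑' i, P (A i) ≠ ⊤ := by
    rw [← h1]
    exact measure_ne_top _ _
  have h3 := ENNReal.hasSum_toReal h2
  rwa [← ENNReal.tsum_toReal_eq fun i => measure_ne_top _ _, ← h1] at h3

lemma hasSum_measureReal_inter_preimage {α : Type*} [MeasurableSpace α] (P : Measure α)
    [IsFiniteMeasure P] {A : Set α} (hA : MeasurableSet A) {f : α → ℤ} (hf : Measurable f) :
    HasSum (fun y => P.real (A ∩ f ⁻¹' {y})) (P.real A) := by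
  have h1 := hasSum_measureReal_iUnion P (A := fun y : ℤ => A ∩ f ⁻¹' {y})
    (fun y => hA.inter (hf (measurableSet_singleton y))) fun y y' hy =>
      Set.disjoint_left.2 fun ω h h' => hy (h.2.symm.trans h'.2)
  have h2 : ⋃ y : ℤ, A ∩ f ⁻¹' {y} = A := by
    ext ω
    simp
  rwa [h2] at h1

/-- The first time `n ≥ 1` at which the walk is below `m`. -/
noncomputable def exitTime {α : Type*} (Y : ℕ → α → ℤ) (m : ℤ) (ω : α) : ℕ∞ :=
  ⨅ (n : ℕ) (_ : 1 ≤ n ∧ walk Y n ω < m), (n : ℕ∞)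

/-- The event that the walk stays in `[m, ∞)` at the times `1, …, n`. -/
def alive {α : Type*} (Y : ℕ → α → ℤ) (m : ℤ) (n : ℕ) : Set α :=
  {ω | ∀ k, 1 ≤ k → k ≤ n → m ≤ walk Y k ω}

section Walk
variable {α : Type*} {Y : ℕ → α → ℤ} {m : ℤ}

lemma walk_succ (n : ℕ) (ω : α) : walk Y (n + 1) ω = walk Y n ω + Y n ω :=
  Finset.sum_range_succ _ _

lemma mem_alive_succ {n : ℕ} {ω : α} :
    ω ∈ alive Y m (n + 1) ↔ ω ∈ alive Y m n ∧ m ≤ walk Y (n + 1) ω := by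
  constructor
  · exact fun h => ⟨fun k h1 h2 => h k h1 (by omega), h _ (by omega) le_rfl⟩
  · rintro ⟨h1, h2⟩ k hk1 hk2
    rcases hk2.lt_or_eq with h | rfl
    · exact h1 k hk1 (by omega)
    · exact h2

lemma exitTime_eq_coe_succ {n : ℕ} {ω : α} :
    exitTime Y m ω = ((n + 1 : ℕ) : ℕ∞) ↔ ω ∈ alive Y m n ∧ walk Y (n + 1) ω < m := by
  constructor
  · intro h
    have h1 : ∀ k, 1 ≤ k → walk Y k ω < m → n + 1 ≤ k := fun k hk hw => by
      have : exitTime Y m ω ≤ k := iInf₂_le k ⟨hk, hw⟩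
      rw [h] at this
      exact_mod_cast this
    refine ⟨fun k hk1 hk2 => ?_, ?_⟩
    · by_contra! hw
      have := h1 k hk1 hw
      omega
    · by_contra! hw
      have : ((n + 2 : ℕ) : ℕ∞) ≤ exitTime Y m ω := le_iInf₂ fun k hk => by
        have h2 := h1 k hk.1 hk.2
        have h3 : k ≠ n + 1 := fun e => by
          rw [e] at hk
          exact absurd hk.2 (not_lt.2 hw)
        exact_mod_cast (by omega : n + 2 ≤ k)
      rw [h] at this
      have : n + 2 ≤ n + 1 := by exact_mod_cast this
      omega
  · rintro ⟨h1, h2⟩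
    refine le_antisymm (iInf₂_le (n + 1) ⟨by omega, h2⟩) (le_iInf₂ fun k hk => ?_)
    have : n + 1 ≤ k := by
      by_contra! h
      exact absurd hk.2 (not_lt.2 (h1 k hk.1 (by omega)))
    exact_mod_cast this

lemma exists_exitTime_eq {ω : α} (h : exitTime Y m ω < ⊤) :
    ∃ n : ℕ, exitTime Y m ω = ((n + 1 : ℕ) : ℕ∞) := by
  obtain ⟨k, hk⟩ := ENat.ne_top_iff_exists.1 h.ne
  cases k with
  | succ n => exact ⟨n, hk.symm⟩
  | zero =>
    have h1 : ((1 : ℕ) : ℕ∞) ≤ exitTime Y m ω := le_iInf₂ fun k hk => by exact_mod_cast hk.1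
    rw [← hk] at h1
    have : 1 ≤ 0 := by exact_mod_cast h1
    omega

lemma setOf_exitTime_lt_top (x : ℤ) :
    {ω | exitTime Y m ω < ⊤ ∧ walk Y (exitTime Y m ω).toNat ω = x} =
      ⋃ n : ℕ, {ω | exitTime Y m ω = ((n + 1 : ℕ) : ℕ∞) ∧ walk Y (n + 1) ω = x} := by
  ext ω
  simp only [Set.mem_ofPred_eq, mem_iUnion]
  constructor
  · rintro ⟨h1, h2⟩
    obtain ⟨n, hn⟩ := exists_exitTime_eq h1
    refine ⟨n, hn, ?_⟩
    rwa [hn, ENat.toNat_natCast] at h2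
  · rintro ⟨n, hn, h2⟩
    rw [hn, ENat.toNat_natCast]
    exact ⟨ENat.natCast_lt_top _, h2⟩

lemma walk_congr {n k : ℕ} {ω ω' : α} (h : ∀ i < n, Y i ω = Y i ω') (hk : k ≤ n) :
    walk Y k ω = walk Y k ω' :=
  Finset.sum_congr rfl fun i hi => h i ((Finset.mem_range.1 hi).trans_le hk)

variable [MeasurableSpace α]

lemma measurable_walk (hY : ∀ n, Measurable (Y n)) (n : ℕ) : Measurable (walk Y n) :=
  Finset.measurable_fun_sum _ fun i _ => hY i

lemma measurableSet_alive (hY : ∀ n, Measurable (Y n)) (n : ℕ) : MeasurableSet (alive Y m n) := by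
  have : alive Y m n = ⋂ k, {ω | 1 ≤ k → k ≤ n → m ≤ walk Y k ω} := by
    ext ω
    simp [alive]
  rw [this]
  refine MeasurableSet.iInter fun k => ?_
  by_cases h : 1 ≤ k ∧ k ≤ n
  · simp only [h.1, h.2, true_imp_iff]
    exact measurable_walk hY k measurableSet_Ici
  · have : {ω | 1 ≤ k → k ≤ n → m ≤ walk Y k ω} = Set.univ := by
      ext ω
      simp only [Set.mem_ofPred_eq, mem_univ, iff_true]
      exact fun h1 h2 => absurd ⟨h1, h2⟩ h
    rw [this]
    exact MeasurableSet.univ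

/-- An event determined by the first `n` increments is independent of the next one. -/
lemma measureReal_inter_increment {P : Measure α} (hY : ∀ n, Measurable (Y n))
    (hind : iIndepFun Y P) {n : ℕ} {A : Set α}
    (hA : ∀ ω ω', (∀ i < n, Y i ω = Y i ω') → ω ∈ A → ω' ∈ A) (k : ℤ) :
    P.real (A ∩ Y n ⁻¹' {k}) = P.real A * P.real (Y n ⁻¹' {k}) := by
  have h1 := hind.indepFun_finset (Finset.range n) {n} (by simp) hY
  -- `A` is the preimage of its image under the first `n` increments, and every set in the
  -- countable range is measurable
  set V : α → (Finset.range n → ℤ) := fun ω i => Y i ω with hV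
  have h2 : V ⁻¹' (V '' A) = A := by
    refine subset_antisymm ?_ (subset_preimage_image _ _)
    rintro ω ⟨ω', h, he⟩
    exact hA ω' ω (fun i hi => congrFun he ⟨i, Finset.mem_range.2 hi⟩) h
  have h3 := h1.measure_inter_preimage_eq_mul (V '' A) {v | v ⟨n, Finset.mem_singleton_self n⟩ = k}
    (MeasurableSet.of_discrete) (MeasurableSet.of_discrete)
  change P (V ⁻¹' (V '' A) ∩ Y n ⁻¹' {k}) = P (V ⁻¹' (V '' A)) * P (Y n ⁻¹' {k}) at h3
  rw [h2] at h3
  rw [measureReal_def, h3, ENNReal.toReal_mul]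
  rfl

/-- The Markov property at time `n`. -/
lemma measureReal_alive_inter_succ {P : Measure α} [IsProbabilityMeasure P] {p : ℤ → ℝ}
    (hY : ∀ n, Measurable (Y n)) (hind : iIndepFun Y P)
    (hp : ∀ n k, P.real (Y n ⁻¹' {k}) = p k) (n : ℕ) (x : ℤ) :
    P.real (alive Y m n ∩ walk Y (n + 1) ⁻¹' {x}) =
      ∑' y, P.real (alive Y m n ∩ walk Y n ⁻¹' {y}) * p (x - y) := by
  have h1 := hasSum_measureReal_inter_preimage P ((measurableSet_alive (m := m) hY n).inter
    (measurable_walk hY (n + 1) (measurableSet_singleton x))) (measurable_walk hY n)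
  rw [← h1.tsum_eq]
  refine tsum_congr fun y => ?_
  rw [← hp n, ← measureReal_inter_increment hY hind (A := alive Y m n ∩ walk Y n ⁻¹' {y})]
  · congr 1
    ext ω
    simp only [mem_inter_iff, mem_preimage, mem_singleton_iff, walk_succ]
    constructor
    · rintro ⟨⟨h1, h2⟩, h3⟩
      exact ⟨⟨h1, h3⟩, by omega⟩
    · rintro ⟨⟨h1, h2⟩, h3⟩
      exact ⟨⟨h1, by omega⟩, h2⟩
  · rintro ω ω' h ⟨h1, h2⟩
    refine ⟨fun k hk1 hk2 => ?_, ?_⟩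
    · rw [← walk_congr h hk2]
      exact h1 k hk1 hk2
    · rw [mem_preimage, ← walk_congr h le_rfl]
      exact h2

lemma measureReal_alive_inter {P : Measure α} [IsProbabilityMeasure P] {p : ℤ → ℝ}
    (hY : ∀ n, Measurable (Y n)) (hind : iIndepFun Y P)
    (hp : ∀ n k, P.real (Y n ⁻¹' {k}) = p k) (n : ℕ) (x : ℤ) :
    P.real (alive Y m n ∩ walk Y n ⁻¹' {x}) = killed p m n x := by
  induction n generalizing x with
  | zero =>
    have h1 : alive Y m 0 ∩ walk Y 0 ⁻¹' {x} = if x = 0 then Set.univ else ∅ := by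
      ext ω
      simp only [alive, walk, mem_inter_iff, Set.mem_ofPred_eq, mem_preimage, Finset.range_zero,
        Finset.sum_empty, mem_singleton_iff]
      split_ifs with h
      · simp only [mem_univ, iff_true]
        exact ⟨fun k h1 h2 => by omega, h.symm⟩
      · simp only [mem_empty_iff_false, iff_false]
        exact fun h' => h h'.2.symm
    rw [h1]
    simp only [killed]
    split_ifs <;> simp
  | succ n ih =>
    simp only [killed]
    split_ifs with h
    · have h1 : alive Y m (n + 1) ∩ walk Y (n + 1) ⁻¹' {x} =
          alive Y m n ∩ walk Y (n + 1) ⁻¹' {x} := by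
        ext ω
        simp only [mem_inter_iff, mem_alive_succ, mem_preimage, mem_singleton_iff]
        constructor
        · exact fun h => ⟨h.1.1, h.2⟩
        · exact fun h' => ⟨⟨h'.1, h'.2 ▸ h⟩, h'.2⟩
      rw [h1, measureReal_alive_inter_succ hY hind hp]
      simp only [ih]
    · have h1 : alive Y m (n + 1) ∩ walk Y (n + 1) ⁻¹' {x} = ∅ := by
        ext ω
        simp only [mem_inter_iff, mem_alive_succ, mem_preimage, mem_singleton_iff,
          mem_empty_iff_false, iff_false]
        exact fun h' => h (h'.2 ▸ h'.1.2)
      rw [h1, measureReal_empty]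

lemma measureReal_exitTime_eq {P : Measure α} [IsProbabilityMeasure P] {p : ℤ → ℝ}
    (hY : ∀ n, Measurable (Y n)) (hind : iIndepFun Y P)
    (hp : ∀ n k, P.real (Y n ⁻¹' {k}) = p k) (n : ℕ) (x : ℤ) :
    P.real {ω | exitTime Y m ω = ((n + 1 : ℕ) : ℕ∞) ∧ walk Y (n + 1) ω = x} = exitAt p m n x := by
  simp only [exitTime_eq_coe_succ]
  rw [exitAt]
  split_ifs with h
  · simp only [← measureReal_alive_inter hY hind hp]
    rw [← measureReal_alive_inter_succ hY hind hp]
    congr 1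
    ext ω
    simp only [Set.mem_ofPred_eq, mem_inter_iff, mem_preimage, mem_singleton_iff]
    exact ⟨fun h => ⟨h.1.1, h.2⟩, fun h' => ⟨⟨h'.1, h'.2 ▸ h⟩, h'.2⟩⟩
  · have : {ω | (ω ∈ alive Y m n ∧ walk Y (n + 1) ω < m) ∧ walk Y (n + 1) ω = x} = ∅ := by
      ext ω
      simp only [Set.mem_ofPred_eq, mem_empty_iff_false, iff_false]
      exact fun h' => h (h'.2 ▸ h'.1.2)
    rw [this, measureReal_empty]

lemma measurableSet_exitTime_eq (hY : ∀ n, Measurable (Y n)) (n : ℕ) (x : ℤ) :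
    MeasurableSet {ω | exitTime Y m ω = ((n + 1 : ℕ) : ℕ∞) ∧ walk Y (n + 1) ω = x} := by
  simp only [exitTime_eq_coe_succ]
  exact ((measurableSet_alive hY n).inter (measurable_walk hY _ measurableSet_Iio)).inter
    (measurable_walk hY _ (measurableSet_singleton x))

lemma hasSum_exitAt {P : Measure α} [IsProbabilityMeasure P] {p : ℤ → ℝ}
    (hY : ∀ n, Measurable (Y n)) (hind : iIndepFun Y P)
    (hp : ∀ n k, P.real (Y n ⁻¹' {k}) = p k) (x : ℤ) :
    HasSum (fun n => exitAt p m n x) (ladderLaw P Y (exitTime Y m) {x}) := by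
  simp only [ladderLaw, mem_singleton_iff, ← measureReal_exitTime_eq (m := m) hY hind hp]
  rw [setOf_exitTime_lt_top]
  refine hasSum_measureReal_iUnion P (fun n => measurableSet_exitTime_eq hY n x)
    fun n n' h => Set.disjoint_left.2 fun ω h1 h2 => h ?_
  have : n + 1 = n' + 1 := by exact_mod_cast h1.1.symm.trans h2.1
  omega

lemma hasSum_ladderGen {P : Measure α} [IsProbabilityMeasure P] {p : ℤ → ℝ}
    (hY : ∀ n, Measurable (Y n)) (hind : iIndepFun Y P)
    (hp : ∀ n k, P.real (Y n ⁻¹' {k}) = p k) (x : ℤ) {s : ℂ} (hs : ‖s‖ ≤ 1) :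
    HasSum (fun n : ℕ => s ^ (n + 1) * exitAt p m n x)
      (ladderGen P Y (exitTime Y m) x s) := by
  set E : ℕ → Set α := fun n =>
    {ω | exitTime Y m ω = ((n + 1 : ℕ) : ℕ∞) ∧ walk Y (n + 1) ω = x} with hE
  have hEm : ∀ n, MeasurableSet (E n) := fun n => measurableSet_exitTime_eq hY n x
  have hEp : ∀ n, P.real (E n) = exitAt p m n x := fun n => measureReal_exitTime_eq hY hind hp n x
  set F : ℕ → α → ℂ := fun n => (E n).indicator fun _ => s ^ (n + 1) with hF
  have hFi : ∀ n, ∫ ω, F n ω ∂P = s ^ (n + 1) * exitAt p m n x := fun n => by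
    rw [hF, integral_indicator_const _ (hEm n), hEp, Complex.real_smul, mul_comm]
  have h1 : Summable fun n => ∫ ω, ‖F n ω‖ ∂P := by
    refine Summable.of_nonneg_of_le (fun n => integral_nonneg fun _ => norm_nonneg _) (fun n => ?_)
      (hasSum_exitAt (m := m) hY hind hp x).summable
    simp only [hF, norm_indicator_eq_indicator_norm]
    rw [integral_indicator_const _ (hEm n), hEp, smul_eq_mul, norm_pow]
    have : 0 ≤ exitAt p m n x := by rw [← hEp]; exact measureReal_nonneg
    exact mul_le_of_le_one_right this (pow_le_one₀ (norm_nonneg _) hs)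
  have h2 := hasSum_integral_of_summable_integral_norm (F := F) (μ := P)
    (fun n => (integrable_const _).indicator (hEm n)) h1
  simp only [hFi] at h2
  suffices h3 : ladderGen P Y (exitTime Y m) x s = ∫ ω, ∑' n, F n ω ∂P by rwa [h3]
  unfold ladderGen
  refine integral_congr_ae (Eventually.of_forall fun ω => ?_)
  simp only
  by_cases h : exitTime Y m ω < ⊤
  · obtain ⟨n, hn⟩ := exists_exitTime_eq h
    rw [tsum_eq_single n]
    · simp only [hF, hn, ENat.toNat_natCast, hE, indicator, Set.mem_ofPred_eq, ENat.natCast_lt_top, true_and]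
    · intro n' hn'
      refine indicator_of_notMem (fun h' => hn' ?_) _
      have : n' + 1 = n + 1 := by exact_mod_cast h'.1.symm.trans hn
      omega
  · rw [if_neg fun h' => h h'.1]
    have : ∀ n, F n ω = 0 := fun n => indicator_of_notMem (fun h' => h (by
      rw [h'.1]
      exact ENat.natCast_lt_top _)) _
    simp only [this, tsum_zero]

lemma ladderGen_one {P : Measure α} [IsProbabilityMeasure P] {p : ℤ → ℝ}
    (hY : ∀ n, Measurable (Y n)) (hind : iIndepFun Y P)
    (hp : ∀ n k, P.real (Y n ⁻¹' {k}) = p k) (x : ℤ) :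
    ladderGen P Y (exitTime Y m) x 1 = ladderLaw P Y (exitTime Y m) {x} := by
  have h1 := hasSum_ladderGen (m := m) hY hind hp x (s := 1) (by simp)
  simp only [one_pow, one_mul] at h1
  exact h1.unique (Complex.hasSum_ofReal.2 (hasSum_exitAt hY hind hp x))

lemma continuousOn_ladderGen {P : Measure α} [IsProbabilityMeasure P] {p : ℤ → ℝ}
    (hY : ∀ n, Measurable (Y n)) (hind : iIndepFun Y P)
    (hp : ∀ n k, P.real (Y n ⁻¹' {k}) = p k) (x : ℤ) :
    ContinuousOn (ladderGen P Y (exitTime Y m) x) (closedBall 0 1) := by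
  have h1 : ContinuousOn (fun s : ℂ => ∑' n : ℕ, s ^ (n + 1) * (exitAt p m n x : ℂ))
      (closedBall 0 1) := by
    refine continuousOn_tsum (fun n => by fun_prop)
      (hasSum_exitAt (m := m) hY hind hp x).summable fun n s hs => ?_
    rw [mem_closedBall_zero_iff] at hs
    have : 0 ≤ exitAt p m n x := by
      rw [← measureReal_exitTime_eq hY hind hp n x]
      exact measureReal_nonneg
    rw [norm_mul, norm_pow, Complex.norm_real, Real.norm_of_nonneg this]
    exact mul_le_of_le_one_left this (pow_le_one₀ (norm_nonneg _) hs)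
  exact h1.congr fun s hs =>
    (hasSum_ladderGen hY hind hp x (mem_closedBall_zero_iff.1 hs)).tsum_eq.symm

lemma hasSum_ladderLaw_Iic {P : Measure α} [IsProbabilityMeasure P] (hY : ∀ n, Measurable (Y n))
    (a : ℤ) : HasSum (fun j : ℕ => ladderLaw P Y (exitTime Y m) {a - j})
      (ladderLaw P Y (exitTime Y m) (Iic a)) := by
  have h1 := hasSum_measureReal_iUnion P
    (A := fun j : ℕ => {ω | exitTime Y m ω < ⊤ ∧ walk Y (exitTime Y m ω).toNat ω ∈ ({a - j} : Set ℤ)})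
    (fun j => by
      simp only [mem_singleton_iff]
      rw [setOf_exitTime_lt_top]
      exact MeasurableSet.iUnion fun n => measurableSet_exitTime_eq hY n _)
    (fun i j hij => Set.disjoint_left.2 fun ω h1 h2 => hij (by
      have := h1.2.symm.trans h2.2
      omega))
  suffices h2 : {ω | exitTime Y m ω < ⊤ ∧ walk Y (exitTime Y m ω).toNat ω ∈ Iic a} =
      ⋃ j : ℕ, {ω | exitTime Y m ω < ⊤ ∧
        walk Y (exitTime Y m ω).toNat ω ∈ ({a - j} : Set ℤ)} by
    rw [← h2] at h1
    exact h1
  ext ω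
  simp only [Set.mem_ofPred_eq, mem_iUnion, mem_singleton_iff, mem_Iic]
  constructor
  · rintro ⟨h1, h2⟩
    exact ⟨(a - walk Y (exitTime Y m ω).toNat ω).toNat, h1, by omega⟩
  · rintro ⟨j, h1, h2⟩
    exact ⟨h1, by omega⟩

end Walk

/-- Last step decomposition of the exit. -/
lemma CenteredLaw.mul_tsum_killedGreen {p : ℤ → ℝ} (hp : CenteredLaw p) {m : ℤ} (hm : 0 ≤ m)
    {x : ℤ} (hx : x < m) {s : ℂ} (hs : ‖s‖ < 1) :
    s * ∑' n : ℕ, killedGreen p m s n * p (x - n) =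
      ∑' n : ℕ, s ^ (n + 1) * (exitAt p m n x : ℂ) := by
  have hpx : Summable fun y : ℕ => p (x - y) :=
    hp.hasSum_one.summable.comp_injective
      (show Function.Injective fun y : ℕ => x - (y : ℤ) from fun a b h => by simpa using h)
  have hsum : Summable fun q : ℕ × ℕ => s ^ q.2 * (killed p m q.2 q.1 : ℂ) * (p (x - q.1) : ℂ) := by
    refine Summable.of_norm_bounded (hpx.mul_of_nonneg
      (summable_geometric_of_lt_one (norm_nonneg s) hs) (fun y => hp.nonneg _)
      fun n => by positivity) fun q => ?_
    rw [norm_mul, norm_mul, norm_pow, Complex.norm_real (p _), Real.norm_of_nonneg (hp.nonneg _),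
      mul_comm (p _)]
    have := hp.killed_le_one m q.2 q.1
    have h0 := hp.nonneg (x - q.1)
    gcongr
    exact mul_le_of_le_one_right (by positivity) this
  have h1 : ∑' n : ℕ, killedGreen p m s n * (p (x - n) : ℂ) =
      ∑' q : ℕ × ℕ, s ^ q.2 * (killed p m q.2 q.1 : ℂ) * (p (x - q.1) : ℂ) := by
    refine Eq.trans (tsum_congr fun y => ?_) hsum.tsum_prod.symm
    exact tsum_mul_right.symm
  have hsum' : Summable fun q : ℕ × ℕ =>
      s ^ q.1 * (killed p m q.1 q.2 : ℂ) * (p (x - q.2) : ℂ) := hsum.prod_symm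
  rw [h1, ← (Equiv.prodComm ℕ ℕ).tsum_eq]
  refine Eq.trans (congrArg (s * ·) hsum'.tsum_prod) ?_
  simp only
  rw [← tsum_mul_left]
  refine tsum_congr fun n => ?_
  rw [exitAt, if_pos hx, Complex.ofReal_tsum, ← (Nat.cast_injective (R := ℤ)).tsum_eq]
  · rw [← tsum_mul_left, ← tsum_mul_left]
    refine tsum_congr fun y => ?_
    push_cast
    ring
  · intro k hk
    refine ⟨k.toNat, Int.toNat_of_nonneg ?_⟩
    by_contra! h
    exact hk (by simp [killed_eq_zero hm n h])

/-- The expansion of the generating function of the exit time and place of `[m, ∞)`, for a walk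
with a centered aperiodic law having all exponential moments, and `m = 0` or `m = 1`. -/
theorem exists_ladderGen_expansion {α : Type*} [MeasurableSpace α] {P : Measure α}
    [IsProbabilityMeasure P] {p : ℤ → ℝ} (hp : CenteredLaw p) {Y : ℕ → α → ℤ}
    (hY : ∀ n, Measurable (Y n)) (hind : iIndepFun Y P)
    (hlaw : ∀ n k, P.real (Y n ⁻¹' {k}) = p k) {m : ℤ} (hm : m = 0 ∨ m = 1) :
    ∃ (Ω : Set ℂ) (δ : ℝ) (T O : ℤ → ℂ → ℂ), IsOpen Ω ∧
      closedBall (0 : ℂ) 1 \ {1} ⊆ Ω ∧ Disjoint Ω ((fun t : ℝ => (t : ℂ)) '' Set.Ici 1) ∧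
      0 < δ ∧ slitDisk δ ⊆ Ω ∧ (∀ x, AnalyticOnNhd ℂ (T x) Ω) ∧
      (∀ x, AnalyticInSqrt δ (T x)) ∧ (∀ x, AnalyticInSqrt δ (O x)) ∧
      (∀ x, ∀ s ∈ closedBall (0 : ℂ) 1 \ {1}, T x s = ladderGen P Y (exitTime Y m) x s) ∧
      (∀ x, ∀ s ∈ Ω, T x s = (ladderLaw P Y (exitTime Y m) {x} : ℂ) -
        sqrtOneSub s * ((√2 / √(secondMoment p) : ℝ) : ℂ) *
        (if x < m then (ladderLaw P Y (exitTime Y m) (Iic (x - m)) : ℂ) else 0) +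
        (1 - s) * O x s) ∧
      ∀ K : ℝ, 1 ≤ K → ∃ C : ℝ, 0 < C ∧ ∀ x : ℤ, ∀ s ∈ Ω,
        K ^ x.natAbs * ‖T x s‖ ≤ C ∧ K ^ x.natAbs * ‖O x s‖ ≤ C := by
  obtain ⟨Ω, δ, T, O, w, hΩ, hcb, hdis, hδ, hsub, hT, hTs, hOs, hexp, hK, hTG, hT0, hlim⟩ :=
    hp.exists_exit_expansion hm
  have hball : ∀ x, EqOn (T x) (ladderGen P Y (exitTime Y m) x) (ball 0 1) := by
    intro x s hs
    have hs1 : ‖s‖ < 1 := mem_ball_zero_iff.1 hs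
    rw [← (hasSum_ladderGen hY hind hlaw x hs1.le).tsum_eq]
    by_cases hx : x < m
    · rw [hTG x hx s hs, hp.mul_tsum_killedGreen (by omega) hx hs1]
    · rw [hT0 x (not_lt.1 hx) s]
      simp [exitAt, hx]
  have hclosed : ∀ x, EqOn (T x) (ladderGen P Y (exitTime Y m) x) (closedBall (0 : ℂ) 1 \ {1}) :=
    fun x => (hball x).of_subset_closure ((hT x).continuousOn.mono hcb)
      ((continuousOn_ladderGen hY hind hlaw x).mono sdiff_subset)
      (fun s hs => ⟨ball_subset_closedBall hs, fun h => by
        rw [mem_singleton_iff.1 h, mem_ball_zero_iff, norm_one] at hs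
        exact hs.false⟩)
      (by rw [closure_ball _ one_ne_zero]; exact sdiff_subset)
  have hw : ∀ x, w x = ladderLaw P Y (exitTime Y m) {x} := fun x => by
    rw [← ladderGen_one hY hind hlaw]
    refine tendsto_nhds_unique (hlim x) ?_
    have hIoo : Ioi (-1) ∈ 𝓝[<] (1 : ℝ) :=
      mem_nhdsWithin_of_mem_nhds (Ioi_mem_nhds (by norm_num))
    have hin : ∀ᶠ t : ℝ in 𝓝[<] 1, (t : ℂ) ∈ ball (0 : ℂ) 1 := by
      filter_upwards [self_mem_nhdsWithin, hIoo] with t h1 h2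
      rw [mem_ball_zero_iff, Complex.norm_real, Real.norm_eq_abs, abs_lt]
      exact ⟨h2, h1⟩
    have h1 : Tendsto (fun t : ℝ => (t : ℂ)) (𝓝[<] 1) (𝓝[closedBall 0 1] 1) := by
      refine tendsto_nhdsWithin_iff.2 ⟨?_, hin.mono fun t h => ball_subset_closedBall h⟩
      exact (Complex.continuous_ofReal.tendsto' 1 1 Complex.ofReal_one).mono_left
        nhdsWithin_le_nhds
    have h2 := (continuousOn_ladderGen (m := m) hY hind hlaw x 1 (by simp)).tendsto.comp h1
    exact h2.congr' (hin.mono fun t h => (hball x h).symm)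
  refine ⟨Ω, δ, T, O, hΩ, hcb, hdis, hδ, hsub, hT, hTs, hOs, hclosed, fun x s hs => ?_, hK⟩
  rw [hexp x s hs]
  simp only [hw, ← (hasSum_ladderLaw_Iic hY _).tsum_eq, Complex.ofReal_tsum]

/-! ### Descending and ascending ladder times -/

lemma HypothesesH.centeredLaw {μ : Measure ℤ} [IsProbabilityMeasure μ] (hH : HypothesesH μ)
    (hc : mean μ = 0) : CenteredLaw fun k => μ.real {k} where
  nonneg _ := measureReal_nonneg
  hasSum_one := by
    simpa using hasSum_measureReal_inter_preimage μ MeasurableSet.univ measurable_id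
  exp_moments := hH.exp_moments
  mean_zero := hc
  aperiodic := by
    rw [← hH.aperiodic]
    congr 1
    ext k
    have h0 : ∀ a, μ.real {a} ≠ 0 ↔ a ∈ supp μ := fun a => (measureReal_eq_zero_iff).not
    simp only [Set.mem_ofPred_eq, h0]
    constructor
    · rintro ⟨a, b, ha, hb, h⟩
      exact ⟨a, ha, b, hb, h⟩
    · rintro ⟨a, ha, b, hb, h⟩
      exact ⟨a, b, ha, hb, h⟩

lemma AnalyticInSqrt.mono {δ δ' : ℝ} {f : ℂ → ℂ} (h : AnalyticInSqrt δ f) (hδ : δ' ≤ δ) :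
    AnalyticInSqrt δ' f := by
  obtain ⟨g, hg, hfg⟩ := h
  exact ⟨g, hg.mono (ball_subset_ball (Real.sqrt_le_sqrt hδ)), fun s hs =>
    hfg s (slitDisk_mono hδ hs)⟩

section Reflection
variable {α : Type*} (Y : ℕ → α → ℤ)

lemma walk_neg (n : ℕ) (ω : α) : walk (fun n ω => -Y n ω) n ω = -walk Y n ω := by
  simp [walk]

/-- The weak ascending time is the exit time of `[1, ∞)` for the reflected walk. -/
lemma tauAsc_eq_exitTime : tauAsc Y = exitTime (fun n ω => -Y n ω) 1 := by
  ext1 ω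
  simp only [tauAsc, exitTime, walk_neg]
  have : ∀ n, (1 ≤ n ∧ 0 ≤ walk Y n ω ↔ 1 ≤ n ∧ -walk Y n ω < 1) := fun n => by omega
  simp only [this]

variable [MeasurableSpace α] (P : Measure α)

lemma ladderGen_tauAsc (x : ℤ) (s : ℂ) : ladderGen P Y (tauAsc Y) x s =
    ladderGen P (fun n ω => -Y n ω) (exitTime (fun n ω => -Y n ω) 1) (-x) s := by
  simp only [ladderGen, tauAsc_eq_exitTime, walk_neg, neg_inj]

lemma ladderLaw_tauAsc (A : Set ℤ) : ladderLaw P Y (tauAsc Y) A =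
    ladderLaw P (fun n ω => -Y n ω) (exitTime (fun n ω => -Y n ω) 1) {x | -x ∈ A} := by
  simp only [ladderLaw, tauAsc_eq_exitTime, walk_neg, Set.mem_ofPred_eq, neg_neg]

end Reflection

end LadderWalk

theorem proposition3p3p1 {α : Type*} [MeasurableSpace α] (P : Measure α) [IsProbabilityMeasure P]
    (μ : Measure ℤ) (hH : LadderWalk.HypothesesH μ) (hcentered : LadderWalk.mean μ = 0)
    (Y : ℕ → α → ℤ) (hmeas : ∀ n, Measurable (Y n)) (hindep : iIndepFun Y P)
    (hlaw : ∀ n, Measure.map (Y n) P = μ) :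
    ∃ (Ω : Set ℂ) (δ : ℝ) (Tdesc Tasc Odesc Oasc : ℤ → ℂ → ℂ),
      -- `Ω` is an open neighborhood of the closed unit disk minus `1`, avoiding `[1, ∞)`
      IsOpen Ω ∧ Metric.closedBall (0 : ℂ) 1 \ {1} ⊆ Ω ∧
      Disjoint Ω ((fun t : ℝ => (t : ℂ)) '' Set.Ici 1) ∧ 0 < δ ∧
      -- analytic continuation
      (∀ x : ℤ,
        AnalyticOnNhd ℂ (Tdesc x) (Ω ∪ LadderWalk.slitDisk δ) ∧
        AnalyticOnNhd ℂ (Tasc x) (Ω ∪ LadderWalk.slitDisk δ) ∧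
        ∀ s ∈ Metric.closedBall (0 : ℂ) 1 \ {1},
          Tdesc x s = LadderWalk.ladderGen P Y (LadderWalk.tauDesc Y) x s ∧
          Tasc x s = LadderWalk.ladderGen P Y (LadderWalk.tauAsc Y) x s) ∧
      -- analyticity in the variable `√(1 - s)`
      (∀ x : ℤ,
        LadderWalk.AnalyticInSqrt δ (Tdesc x) ∧ LadderWalk.AnalyticInSqrt δ (Tasc x) ∧
        LadderWalk.AnalyticInSqrt δ (Odesc x) ∧ LadderWalk.AnalyticInSqrt δ (Oasc x)) ∧
      -- local expansions of order 1
      (∀ x : ℤ, ∀ s ∈ Ω ∪ LadderWalk.slitDisk δ,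
        Tdesc x s =
          (LadderWalk.ladderLaw P Y (LadderWalk.tauDesc Y) {x} : ℂ)
            - LadderWalk.sqrtOneSub s * ((Real.sqrt 2 / LadderWalk.sigma μ : ℝ) : ℂ)
              * (if x < 0 then
                  (LadderWalk.ladderLaw P Y (LadderWalk.tauDesc Y) (Set.Iic x) : ℂ) else 0)
            + (1 - s) * Odesc x s ∧
        Tasc x s =
          (LadderWalk.ladderLaw P Y (LadderWalk.tauAsc Y) {x} : ℂ)
            - LadderWalk.sqrtOneSub s * ((Real.sqrt 2 / LadderWalk.sigma μ : ℝ) : ℂ)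
              * (if 0 ≤ x then
                  (LadderWalk.ladderLaw P Y (LadderWalk.tauAsc Y) (Set.Ioi x) : ℂ) else 0)
            + (1 - s) * Oasc x s) ∧
      -- uniform boundedness of the remainders
      (∃ C : ℝ, ∀ x : ℤ, ∀ s ∈ LadderWalk.slitDisk δ, ‖Odesc x s‖ ≤ C ∧ ‖Oasc x s‖ ≤ C) ∧
      -- uniform exponential bounds
      (∀ K : ℝ, 1 < K → ∃ C : ℝ, 0 < C ∧ ∀ x : ℤ, ∀ s ∈ Ω ∪ LadderWalk.slitDisk δ,
        K ^ x.natAbs * ‖Tdesc x s‖ ≤ C ∧ K ^ x.natAbs * ‖Tasc x s‖ ≤ C ∧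
        K ^ x.natAbs * ‖Odesc x s‖ ≤ C ∧ K ^ x.natAbs * ‖Oasc x s‖ ≤ C) := by
  have : IsProbabilityMeasure μ := by
    rw [← hlaw 0]
    exact Measure.isProbabilityMeasure_map (hmeas 0).aemeasurable
  have hp := hH.centeredLaw hcentered
  have hreal : ∀ n k, P.real (Y n ⁻¹' {k}) = μ.real {k} := fun n k => by
    rw [← hlaw n, map_measureReal_apply (hmeas n) (measurableSet_singleton k)]
  have hreal' : ∀ n k, P.real ((fun ω => -Y n ω) ⁻¹' {k}) = μ.real {-k} := fun n k => by
    rw [← hreal n]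
    congr 1
    ext ω
    simp only [Set.mem_preimage, Set.mem_singleton_iff]
    omega
  have hσ : LadderWalk.sigma μ = Real.sqrt (LadderWalk.secondMoment fun k => μ.real {k}) := rfl
  obtain ⟨Ω₁, δ₁, T₁, O₁, hΩ₁, hcb₁, hdis₁, hδ₁, hsub₁, hT₁, hTs₁, hOs₁, hgen₁, hexp₁, hK₁⟩ :=
    LadderWalk.exists_ladderGen_expansion hp hmeas hindep hreal (m := 0) (Or.inl rfl)
  obtain ⟨Ω₂, δ₂, T₂, O₂, hΩ₂, hcb₂, hdis₂, hδ₂, hsub₂, hT₂, hTs₂, hOs₂, hgen₂, hexp₂, hK₂⟩ :=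
    LadderWalk.exists_ladderGen_expansion (Y := fun n ω => -Y n ω) hp.reflect (fun n => (hmeas n).neg)
      (hindep.comp (fun _ k => -k) fun _ => measurable_neg) hreal' (m := 1) (Or.inr rfl)
  have hsub : Ω₁ ∩ Ω₂ ∪ LadderWalk.slitDisk (min δ₁ δ₂) = Ω₁ ∩ Ω₂ :=
    Set.union_eq_left.2 (Set.subset_inter
      ((LadderWalk.slitDisk_mono (min_le_left _ _)).trans hsub₁)
      ((LadderWalk.slitDisk_mono (min_le_right _ _)).trans hsub₂))
  rw [LadderWalk.CenteredLaw.secondMoment_reflect fun k => μ.real {k}] at hexp₂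
  have hbound : ∀ K : ℝ, 1 ≤ K → ∃ C : ℝ, 0 < C ∧ ∀ x : ℤ, ∀ s ∈ Ω₁ ∩ Ω₂,
      K ^ x.natAbs * ‖T₁ x s‖ ≤ C ∧ K ^ x.natAbs * ‖T₂ (-x) s‖ ≤ C ∧
      K ^ x.natAbs * ‖O₁ x s‖ ≤ C ∧ K ^ x.natAbs * ‖O₂ (-x) s‖ ≤ C := fun K hK => by
    obtain ⟨C₁, hC₁, hb₁⟩ := hK₁ K hK
    obtain ⟨C₂, hC₂, hb₂⟩ := hK₂ K hK
    refine ⟨max C₁ C₂, lt_max_of_lt_left hC₁, fun x s hs => ?_⟩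
    have h1 := hb₁ x s hs.1
    have h2 := hb₂ (-x) s hs.2
    rw [Int.natAbs_neg] at h2
    exact ⟨h1.1.trans (le_max_left _ _), h2.1.trans (le_max_right _ _),
      h1.2.trans (le_max_left _ _), h2.2.trans (le_max_right _ _)⟩
  refine ⟨Ω₁ ∩ Ω₂, min δ₁ δ₂, T₁, fun x => T₂ (-x), O₁, fun x => O₂ (-x), hΩ₁.inter hΩ₂,
    Set.subset_inter hcb₁ hcb₂, hdis₁.mono_left Set.inter_subset_left, lt_min hδ₁ hδ₂, ?_, ?_, ?_,
    ?_, ?_⟩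
  · rw [hsub]
    refine fun x => ⟨(hT₁ x).mono Set.inter_subset_left, (hT₂ (-x)).mono Set.inter_subset_right,
      fun s hs => ⟨hgen₁ x s hs, ?_⟩⟩
    rw [LadderWalk.ladderGen_tauAsc]
    exact hgen₂ (-x) s hs
  · exact fun x => ⟨(hTs₁ x).mono (min_le_left _ _), (hTs₂ (-x)).mono (min_le_right _ _),
      (hOs₁ x).mono (min_le_left _ _), (hOs₂ (-x)).mono (min_le_right _ _)⟩
  · rw [hsub, hσ]
    refine fun x s hs => ⟨?_, ?_⟩
    · rw [hexp₁ x s hs.1, sub_zero]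
      rfl
    · beta_reduce
      rw [hexp₂ (-x) s hs.2, LadderWalk.ladderLaw_tauAsc, LadderWalk.ladderLaw_tauAsc]
      have h1 : {y : ℤ | -y ∈ ({x} : Set ℤ)} = {-x} := by
        ext y
        simp only [Set.mem_ofPred_eq, Set.mem_singleton_iff]
        omega
      have h2 : {y : ℤ | -y ∈ Set.Ioi x} = Set.Iic (-x - 1) := by
        ext y
        simp only [Set.mem_ofPred_eq, Set.mem_Ioi, Set.mem_Iic]
        omega
      have h3 : -x < 1 ↔ 0 ≤ x := by omega
      simp only [h1, h2, h3]
  · obtain ⟨C, -, hC⟩ := hbound 1 le_rfl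
    refine ⟨C, fun x s hs => ?_⟩
    have h := hC x s (hsub ▸ Or.inr hs)
    simp only [one_pow, one_mul] at h
    exact h.2.2
  · rw [hsub]
    exact fun K hK => hbound K hK.le
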